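/- Let $S,T\in\mathbf{C}[x,y]$ be homogeneous of degrees $2$ and $4$ such that the plane quartic $$C=\{[x:y:z]\in\mathbf{P}^2 \mid (z^2+S(x,y))^2=T(x,y)\}$$ is nonsingular. Let $\sigma:[x:y:z]\mapsto[x:y:-z]$ be its bielliptic involution and let $$\pi:C\to E=C/\sigma=\{[x:y:w]\in\mathbf{P}(1,1,2)\mid (w+S(x,y))^2=T(x,y)\},\qquad [x:y:z]\mapsto[x:y:z^2],$$ be the quotient map. Let $\eta\in\mathrm{Pic}^{(2)}(E)$ be the canonical point of $\pi$, i.e. the (unique) class such that $2\eta$ (written additively) is the class of the branch divisor of $\pi$ and $\pi^*\eta$ is the canonical class of $C$. Let $W\subset\mathrm{Pic}^{(2)}(C)$ be the image of the symmetric square $C^{(2)}$ under $q+q'\mapsto[\mathcal{O}_C(q+q')]$, let $P_\eta\subset\mathrm{Pic}^{(2)}(C)$ be the fibre over $\eta$ of the norm map $\mathrm{Pic}^{(2)}(C)\to\mathrm{Pic}^{(2)}(E)$, and define the dual of $C$ to be the curve $C^\vee=D_\eta=W\cap P_\eta$, with the involution induced by $\sigma$. Then such an $\eta$ exists and is unique,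 the plane quartic $$C'=\{[x:y:z]\in\mathbf{P}^2 \mid (z^2+S(x,y))^2=S(x,y)^2-T(x,y)\}$$ is nonsingular and non-hyperelliptic, and there is an isomorphism of algebraic curves $C^\vee\simeq C'$ under which the involution of $C^\vee$ corresponds to $[x:y:z]\mapsto[x:y:-z]$. -/

import Mathlib

open MvPolynomial
open scoped KaehlerDifferential Topology

noncomputable section

namespace BiellipticDual

/-! ### Curves in weighted projective planes -/

/-- Two nonzero zeros of `F` represent the same point of the weighted projective plane
`ℙ(wt 0, wt 1, wt 2)` when they differ by the action `c • v = (c ^ wt i * v i)` of `ℂˣ`. -/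
def coneSetoid (wt : Fin 3 → ℕ) (F : MvPolynomial (Fin 3) ℂ) :
    Setoid {v : Fin 3 → ℂ // v ≠ 0 ∧ eval v F = 0} where
  r u v := ∃ c : ℂ, c ≠ 0 ∧ ∀ i, v.1 i = c ^ wt i * u.1 i
  iseqv :=
    { refl := fun u => ⟨1, one_ne_zero, fun i => by simp⟩
      symm := by
        rintro u v ⟨c, hc, h⟩
        refine ⟨c⁻¹, inv_ne_zero hc, fun i => ?_⟩
        rw [h i, ← mul_assoc, ← mul_pow, inv_mul_cancel₀ hc, one_pow, one_mul]
      trans := by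
        rintro u v w ⟨c, hc, h⟩ ⟨d, hd, k⟩
        refine ⟨d * c, mul_ne_zero hd hc, fun i => ?_⟩
        rw [k i, h i, mul_pow, mul_assoc] }

/-- The points of the closed subset `F = 0` of the weighted projective plane with weights `wt`
(for a weighted homogeneous polynomial `F`). -/
def Curve (wt : Fin 3 → ℕ) (F : MvPolynomial (Fin 3) ℂ) : Type := Quotient (coneSetoid wt F)

/-- Homogeneous coordinates of a point. -/
def Curve.rep {wt : Fin 3 → ℕ} {F : MvPolynomial (Fin 3) ℂ} (p : Curve wt F) : Fin 3 → ℂ :=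
  (Quotient.out p).1

/-- The Jacobian criterion for nonsingularity of the plane projective curve `F = 0`. -/
def IsNonsingular (F : MvPolynomial (Fin 3) ℂ) : Prop :=
  ∀ v : Fin 3 → ℂ, v ≠ 0 → eval v F = 0 → ∃ i, eval v (pderiv i F) ≠ 0

/-! ### Varieties as spaces with functions -/

/-- A set with a (Zariski) topology and, for each point, the collection of the `ℂ`-valued functions
that are regular near that point. -/
structure SpaceWithFunctions (X : Type) where
  /-- the Zariski topology -/
  top : TopologicalSpace X
  /-- `RegularAt f x`: the function `f` is regular in a neighbourhood of `x` -/
  RegularAt : (X → ℂ) → X → Prop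

/-- The structure of a (multi)projective variety on a set `X` whose points have (multi)homogeneous
coordinates `rep x`: the sets `Q ≠ 0`, for `Q` homogeneous, form a basis of the topology, and regular
functions are locally quotients `P / Q` of homogeneous polynomials of the same degree. -/
def homogeneousStructure {X σ M : Type} [AddCommMonoid M] (wt : σ → M) (rep : X → σ → ℂ) :
    SpaceWithFunctions X where
  top := TopologicalSpace.generateFrom
    {U | ∃ (d : M) (Q : MvPolynomial σ ℂ), Q.IsWeightedHomogeneous wt d ∧
      U = {x | eval (rep x) Q ≠ 0}}
  RegularAt f x := ∃ (d : M) (P Q : MvPolynomial σ ℂ),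
    P.IsWeightedHomogeneous wt d ∧ Q.IsWeightedHomogeneous wt d ∧ eval (rep x) Q ≠ 0 ∧
      ∀ y, eval (rep y) Q ≠ 0 → f y = eval (rep y) P / eval (rep y) Q

/-- The structure of a projective variety on a curve. -/
def Curve.structure (wt : Fin 3 → ℕ) (F : MvPolynomial (Fin 3) ℂ) :
    SpaceWithFunctions (Curve wt F) :=
  homogeneousStructure wt Curve.rep

/-- The product variety `X × X`, a closed subset of a product of two weighted projective planes; it is
described by bihomogeneous polynomials. -/
def Curve.squareStructure (wt : Fin 3 → ℕ) (F : MvPolynomial (Fin 3) ℂ) :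
    SpaceWithFunctions (Curve wt F × Curve wt F) :=
  homogeneousStructure (M := ℕ × ℕ)
    (Sum.elim (fun i : Fin 3 => (wt i, 0)) (fun i : Fin 3 => (0, wt i)))
    (fun x => Sum.elim x.1.rep x.2.rep)

/-- The quotient structure along `a : X → Y`. -/
def SpaceWithFunctions.coinduced {X Y : Type} (𝒳 : SpaceWithFunctions X) (a : X → Y) :
    SpaceWithFunctions Y where
  top := 𝒳.top.coinduced a
  RegularAt g y := ∃ U : Set Y, IsOpen[𝒳.top.coinduced a] U ∧ y ∈ U ∧
    ∀ x, a x ∈ U → 𝒳.RegularAt (g ∘ a) x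

/-- The (reduced) induced structure on a subset `Z` of `X`: regular functions are those which locally
extend to regular functions on `X`. -/
def SpaceWithFunctions.restrict {X : Type} (𝒳 : SpaceWithFunctions X) (Z : Set X) :
    SpaceWithFunctions Z where
  top := 𝒳.top.induced Subtype.val
  RegularAt f z := ∃ (g : X → ℂ) (U : Set X), IsOpen[𝒳.top] U ∧ (z : X) ∈ U ∧
    𝒳.RegularAt g z ∧ ∀ y : Z, (y : X) ∈ U → f y = g y

/-- Morphisms: continuous maps which pull back regular functions to regular functions. -/
def IsMorphism {X Y : Type} (𝒳 : SpaceWithFunctions X) (𝒴 : SpaceWithFunctions Y)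
    (φ : X → Y) : Prop :=
  Continuous[𝒳.top, 𝒴.top] φ ∧
    ∀ (x : X) (g : Y → ℂ), 𝒴.RegularAt g (φ x) → 𝒳.RegularAt (g ∘ φ) x

/-! ### Rational functions, orders, divisors, differentials -/

/-- The total fraction ring of the homogeneous coordinate ring `ℂ[x₀, x₁, x₂] / (F)`. -/
abbrev CoordFrac (F : MvPolynomial (Fin 3) ℂ) : Type :=
  FractionRing (MvPolynomial (Fin 3) ℂ ⧸ Ideal.span {F})

/-- The class of a polynomial in `CoordFrac F`. -/
def toFrac (F : MvPolynomial (Fin 3) ℂ) : MvPolynomial (Fin 3) ℂ →ₐ[ℂ] CoordFrac F :=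
  (IsScalarTower.toAlgHom ℂ (MvPolynomial (Fin 3) ℂ ⧸ Ideal.span {F}) (CoordFrac F)).comp
    (Ideal.Quotient.mkₐ ℂ (Ideal.span {F}))

/-- `f` is the quotient `P / Q` of two homogeneous polynomials of the same degree. -/
def IsFraction (wt : Fin 3 → ℕ) (F : MvPolynomial (Fin 3) ℂ) (f : CoordFrac F)
    (P Q : MvPolynomial (Fin 3) ℂ) : Prop :=
  (∃ d, P.IsWeightedHomogeneous wt d ∧ Q.IsWeightedHomogeneous wt d) ∧
    IsUnit (toFrac F Q) ∧ f * toFrac F Q = toFrac F P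

/-- The function field of the curve `F = 0` (for irreducible `F`): the quotients of homogeneous
polynomials of the same degree. -/
def functionField (wt : Fin 3 → ℕ) (F : MvPolynomial (Fin 3) ℂ) : Subalgebra ℂ (CoordFrac F) where
  carrier := {f | ∃ P Q, IsFraction wt F f P Q}
  mul_mem' := by
    rintro f g ⟨P, Q, ⟨d, hP, hQ⟩, hu, h⟩ ⟨P', Q', ⟨d', hP', hQ'⟩, hu', h'⟩
    refine ⟨P * P', Q * Q', ⟨d + d', hP.mul hP', hQ.mul hQ'⟩, ?_, ?_⟩
    · rw [map_mul]; exact hu.mul hu'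
    · rw [map_mul, map_mul, ← h, ← h']; ring
  add_mem' := by
    rintro f g ⟨P, Q, ⟨d, hP, hQ⟩, hu, h⟩ ⟨P', Q', ⟨d', hP', hQ'⟩, hu', h'⟩
    refine ⟨P * Q' + Q * P', Q * Q', ⟨d + d', (hP.mul hQ').add (hQ.mul hP'), hQ.mul hQ'⟩, ?_, ?_⟩
    · rw [map_mul]; exact hu.mul hu'
    · rw [map_add, map_mul, map_mul, map_mul, ← h, ← h']; ring
  algebraMap_mem' := by
    intro c
    refine ⟨C c, 1, ⟨0, isWeightedHomogeneous_C wt c, isWeightedHomogeneous_one ℂ wt⟩, ?_, ?_⟩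
    · rw [map_one]; exact isUnit_one
    · rw [map_one, mul_one, ← MvPolynomial.algebraMap_eq, AlgHom.commutes]

section Curve

variable {wt : Fin 3 → ℕ} {F : MvPolynomial (Fin 3) ℂ}

/-- `f` lies in the local ring of the curve at `p`. -/
def InLocalRing (p : Curve wt F) (f : functionField wt F) : Prop :=
  ∃ P Q, IsFraction wt F (f : CoordFrac F) P Q ∧ eval p.rep Q ≠ 0

/-- `f` lies in the maximal ideal of the local ring at `p`. -/
def InMaximalIdeal (p : Curve wt F) (f : functionField wt F) : Prop :=
  ∃ P Q, IsFraction wt F (f : CoordFrac F) P Q ∧ eval p.rep Q ≠ 0 ∧ eval p.rep P = 0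

/-- `f` is a unit of the local ring at `p`. -/
def IsUnitAt (p : Curve wt F) (f : functionField wt F) : Prop :=
  ∃ P Q, IsFraction wt F (f : CoordFrac F) P Q ∧ eval p.rep Q ≠ 0 ∧ eval p.rep P ≠ 0

/-- `t` generates the maximal ideal of the local ring at `p`. -/
def IsUniformizer (p : Curve wt F) (t : functionField wt F) : Prop :=
  InMaximalIdeal p t ∧ ∀ g, InMaximalIdeal p g → ∃ h, InLocalRing p h ∧ g = h * t

/-- The (nonzero) rational function `f` has order `n` at `p`: `f = u * t ^ n` with a unit `u` and a
uniformizer `t`. -/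
def HasOrder (p : Curve wt F) (f : functionField wt F) (n : ℤ) : Prop :=
  ∃ t u, IsUniformizer p t ∧ IsUnitAt p u ∧ f * t ^ (-n).toNat = u * t ^ n.toNat

/-- Divisors on the curve. -/
abbrev Divisor (wt : Fin 3 → ℕ) (F : MvPolynomial (Fin 3) ℂ) : Type := Curve wt F →₀ ℤ

/-- `D` is the divisor of a nonzero rational function. -/
def IsPrincipal (D : Divisor wt F) : Prop :=
  ∃ f : functionField wt F, ∀ p, HasOrder p f (D p)

/-- The rational differential `ω` has order `n` at `p`: `ω = f dt` with a uniformizer `t` at `p` and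
a rational function `f` of order `n` at `p`. -/
def HasOrderDiff (p : Curve wt F) (ω : Ω[functionField wt F⁄ℂ]) (n : ℤ) : Prop :=
  ∃ t f, IsUniformizer p t ∧ HasOrder p f n ∧
    ω = f • KaehlerDifferential.D ℂ (functionField wt F) t

/-- `D` is the divisor of a nonzero rational differential. -/
def IsCanonicalDivisor (D : Divisor wt F) : Prop :=
  ∃ ω : Ω[functionField wt F⁄ℂ], ω ≠ 0 ∧ ∀ p, HasOrderDiff p ω (D p)

variable (wt F) in
/-- The Picard group: divisors modulo linear equivalence. -/
abbrev Pic : Type := Divisor wt F ⧸ AddSubgroup.closure {D : Divisor wt F | IsPrincipal D}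

/-- The class of a divisor. -/
def divClass (D : Divisor wt F) : Pic wt F := QuotientAddGroup.mk D

variable (wt F) in
/-- The curve carries a pencil of degree two, that is `h⁰(𝒪(p + q)) ≥ 2` for some points `p`, `q`:
there is a nonconstant rational function `f` with `div f + p + q ≥ 0`. For a nonsingular projective
curve of genus at least two this means that it is hyperelliptic. -/
def IsHyperelliptic : Prop :=
  ∃ (p q : Curve wt F) (f : functionField wt F),
    f ∉ Set.range (algebraMap ℂ (functionField wt F)) ∧
      ∀ r, ∃ n : ℤ, HasOrder r f n ∧
        0 ≤ n + (Finsupp.single p 1 + Finsupp.single q 1 : Divisor wt F) r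

end Curve

/-! ### The bielliptic quartic and its quotient -/

/-- The weights of the projective plane. -/
abbrev planeWt : Fin 3 → ℕ := ![1, 1, 1]

/-- The weights of `ℙ(1, 1, 2)`. -/
abbrev ellWt : Fin 3 → ℕ := ![1, 1, 2]

/-- A binary form in `x, y` as a polynomial in three variables. -/
def inXY (S : MvPolynomial (Fin 2) ℂ) : MvPolynomial (Fin 3) ℂ := rename ![0, 1] S

/-- The polynomial `(z² + S)² - T`. -/
def quartic (S T : MvPolynomial (Fin 2) ℂ) : MvPolynomial (Fin 3) ℂ :=
  (X 2 ^ 2 + inXY S) ^ 2 - inXY T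

/-- The polynomial `(w + S)² - T`. -/
def ellEq (S T : MvPolynomial (Fin 2) ℂ) : MvPolynomial (Fin 3) ℂ :=
  (X 2 + inXY S) ^ 2 - inXY T

/-- The curve `(z² + S)² = T` in the projective plane. -/
abbrev CurveC (S T : MvPolynomial (Fin 2) ℂ) : Type := Curve planeWt (quartic S T)

/-- The curve `(w + S)² = T` in `ℙ(1, 1, 2)`. -/
abbrev CurveE (S T : MvPolynomial (Fin 2) ℂ) : Type := Curve ellWt (ellEq S T)

theorem eval_inXY (S : MvPolynomial (Fin 2) ℂ) (v : Fin 3 → ℂ) :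
    eval v (inXY S) = eval ![v 0, v 1] S := by
  rw [inXY, eval_rename]
  congr 2
  funext i
  fin_cases i <;> rfl

/-- The bielliptic involution `[x : y : z] ↦ [x : y : -z]`. -/
def invol (S T : MvPolynomial (Fin 2) ℂ) : CurveC S T → CurveC S T :=
  Quotient.map (fun v => ⟨![v.1 0, v.1 1, -v.1 2], by
      refine ⟨fun h => v.2.1 ?_, ?_⟩
      · funext i
        have h0 := congrFun h 0
        have h1 := congrFun h 1
        have h2 := congrFun h 2
        fin_cases i <;> simp_all
      · have := v.2.2
        simpa [quartic, eval_inXY] using this⟩) (by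
    rintro u v ⟨c, hc, h⟩
    refine ⟨c, hc, fun i => ?_⟩
    have h0 := h 0
    have h1 := h 1
    have h2 := h 2
    fin_cases i <;> simp_all)

/-- The double covering `π : C → E`, `[x : y : z] ↦ [x : y : z²]`. -/
def proj (S T : MvPolynomial (Fin 2) ℂ) : CurveC S T → CurveE S T :=
  Quotient.map (fun v => ⟨![v.1 0, v.1 1, v.1 2 ^ 2], by
      refine ⟨fun h => v.2.1 ?_, ?_⟩
      · funext i
        have h0 := congrFun h 0
        have h1 := congrFun h 1
        have h2 := congrFun h 2
        fin_cases i <;> simp_all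
      · have := v.2.2
        simpa [quartic, ellEq, eval_inXY] using this⟩) (by
    rintro u v ⟨c, hc, h⟩
    refine ⟨c, hc, fun i => ?_⟩
    have h0 := h 0
    have h1 := h 1
    have h2 := h 2
    fin_cases i <;> simp_all [mul_pow])

section Bielliptic

variable (S T : MvPolynomial (Fin 2) ℂ)

open Classical in
/-- The ramification index of `π` at `q`: as `π` is the quotient by the involution, this is the order
of the stabilizer of `q`. -/
def ramIndex (q : CurveC S T) : ℤ := if invol S T q = q then 2 else 1

/-- The pull-back `π^* D = ∑ e_q D(π q) q` of a divisor on `E`. -/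
def pullback (D : Divisor ellWt (ellEq S T)) : Divisor planeWt (quartic S T) :=
  ∑ᶠ q : CurveC S T, Finsupp.single q (ramIndex S T q * D (proj S T q))

/-- The push-forward of a divisor, `∑ n_q q ↦ ∑ n_q π(q)`. -/
def pushforward (D : Divisor planeWt (quartic S T)) : Divisor ellWt (ellEq S T) :=
  D.mapDomain (proj S T)

/-- The sum of the branch points of `π`. -/
def branchDivisor : Divisor ellWt (ellEq S T) :=
  ∑ᶠ e ∈ {e : CurveE S T | ∃ q, invol S T q = q ∧ proj S T q = e}, Finsupp.single e 1

/-- `η ∈ Pic²(E)` is the canonical point of the covering `π`: `η ^ 2` is the class of the branch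
divisor, and `π^* η` is the canonical class of `C`. -/
def IsCanonicalPoint (η : Pic ellWt (ellEq S T)) : Prop :=
  (∃ D : Divisor ellWt (ellEq S T), divClass D = η ∧ D.degree = 2 ∧
    IsCanonicalDivisor (pullback S T D)) ∧
  2 • η = divClass (branchDivisor S T)

/-- The map `C × C → Pic²(C)`, `(q, q') ↦ [q + q']`. -/
def abel (x : CurveC S T × CurveC S T) : Pic planeWt (quartic S T) :=
  divClass (Finsupp.single x.1 1 + Finsupp.single x.2 1)

/-- `W ⊆ Pic²(C)`, the image of the symmetric square of `C`. -/
abbrev W : Type := Set.range (abel S T)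

/-- `W` as a variety: its structure is that of the image of `C × C` (equivalently, of the symmetric
square of `C`). -/
def W.structure : SpaceWithFunctions (W S T) :=
  (Curve.squareStructure planeWt (quartic S T)).coinduced (Set.rangeFactorization (abel S T))

/-- The fibre `P_ξ` over `ξ` of the norm map `Pic(C) → Pic(E)`, `[D] ↦ [π_* D]`. -/
def normFibre (ξ : Pic ellWt (ellEq S T)) : Set (Pic planeWt (quartic S T)) :=
  {L | ∃ D, divClass D = L ∧ divClass (pushforward S T D) = ξ}

/-- The curve `D_ξ = W ∩ P_ξ`. -/
def curveD (ξ : Pic ellWt (ellEq S T)) : Set (W S T) := {L | L.1 ∈ normFibre S T ξ}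

/-- `D_ξ` as a (reduced) variety. -/
def curveD.structure (ξ : Pic ellWt (ellEq S T)) : SpaceWithFunctions (curveD S T ξ) :=
  (W.structure S T).restrict (curveD S T ξ)

/-- The class `L'` is the image of the class `L` under the involution of `Pic(C)` induced by the
bielliptic involution of `C`. -/
def IsInvolImage (L L' : Pic planeWt (quartic S T)) : Prop :=
  ∃ D : Divisor planeWt (quartic S T),
    divClass D = L ∧ divClass (D.mapDomain (invol S T)) = L'

end Bielliptic

end BiellipticDual

end

open MvPolynomial
open scoped KaehlerDifferential Topology

set_option linter.unusedSectionVars false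

noncomputable section

namespace BiellipticDual

/-! The forms `T` and `S² - T` play symmetric roles. The quartic `C` is nonsingular exactly when
neither of them has a multiple root (`Biell.of_isNonsingular`, `Biell.isNonsingular_quartic`), and
`T ↦ S² - T` exchanges the two conditions. Hence `C'` is nonsingular, and a nonsingular plane
quartic carries no pencil of degree two (`not_isHyperelliptic`).

The canonical point is the class of the fibres of `E → ℙ¹`, `[x : y : w] ↦ [x : y]`. Such a fibre is
the divisor of a linear form `ℓ` in `x, y`. The function `ℓ² / w` shows that twice a fibre is
equivalent to `div w`, the branch divisor, and on `C` the differential `(ℓ x² / F_z) d(y / x)` has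
divisor `π^* div ℓ`. Uniqueness holds because `π^*` is injective on divisor classes, `π` being
ramified (`isPrincipal_of_pullback`).

The class of `q + q'` has norm `η` when `π q + π q'` is equivalent to a fibre. Since equivalent
points of `E` coincide, this means that `π q'` is conjugate to `π q` under `w ↦ -w - 2S`. Since `C`
has no pencil of degree two, the class determines the unordered pair `{q, q'}`. In suitable
coordinates `q = [x : y : z]` and `q' = [x : y : z']` with `z² + z'² = -2S`, whence `z² z'² = S² -
T`. Put `ζ = (z + z') / √2`. Then `ζ² + S = z z'`, so `[x : y : ζ]` lies on `C'`. Conversely `ζ`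
determines the sum `√2 ζ` and the product `ζ² + S` of `z, z'`, hence the pair. The involution
changes the signs of `z` and `z'`, and so that of `ζ`. This is the relation `Corr`.

The bijection is biregular. Homogeneous coordinates of the image are symmetric bihomogeneous
polynomials in the pair (`liftPoly`). In the other direction a symmetrized bihomogeneous polynomial
is a polynomial in `x, y, ζ`, because power sums of `z, z'` are (`exists_symmetrization`,
`exists_descent`).

The geometric input is an elementary theory of orders of homogeneous fractions. Its main tool is
that a homogeneous fraction without poles is a polynomial (`NiceCurve.exists_polynomial`). It shows
that a function with poles bounded by `p + q` on a quartic is a quotient of two linear forms;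
counting intersections with a line then makes it constant. It also gives the statement about
equivalent points of `E`. -/

/-! ### General theory of a nonsingular curve in a weighted projective plane -/

/-- A nonsingular curve in `ℙ(1, 1, m)` which does not pass through `[0 : 0 : 1]` and maps onto the
projective line. -/
structure NiceCurve (wt : Fin 3 → ℕ) (F : MvPolynomial (Fin 3) ℂ) : Prop where
  wt_zero : wt 0 = 1
  wt_one : wt 1 = 1
  homogeneous : ∃ N, F.IsWeightedHomogeneous wt N
  eq_zero_of_top : ∀ z, eval ![0, 0, z] F = 0 → z = 0
  exists_root : ∀ x y, ∃ z, eval ![x, y, z] F = 0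
  nonsingular : IsNonsingular F

theorem aeval_smul_of_isWeightedHomogeneous {σ A : Type*} [CommRing A] [Algebra ℂ A] {wt : σ → ℕ}
    {P : MvPolynomial σ ℂ} {d : ℕ} (hP : P.IsWeightedHomogeneous wt d) (c : A) (v : σ → A) :
    aeval (fun i => c ^ wt i * v i) P = c ^ d * aeval v P := by
  induction hP using IsWeightedHomogeneous.induction_on with
  | zero => simp
  | add p q _ _ hp hq => rw [map_add, map_add, hp, hq, mul_add]
  | monomial n r h =>
    rw [aeval_monomial, aeval_monomial, Finsupp.prod, Finsupp.prod]
    simp only [mul_pow, Finset.prod_mul_distrib, ← pow_mul]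
    rw [Finset.prod_pow_eq_pow_sum, ← h, Finsupp.weight_apply, Finsupp.sum]
    simp only [smul_eq_mul]
    rw [Finset.sum_congr rfl fun i _ => mul_comm (wt i) (n i)]
    ring

theorem eval_smul_of_isWeightedHomogeneous {σ : Type*} {wt : σ → ℕ} {P : MvPolynomial σ ℂ} {d : ℕ}
    (hP : P.IsWeightedHomogeneous wt d) (c : ℂ) (v : σ → ℂ) :
    eval (fun i => c ^ wt i * v i) P = c ^ d * eval v P := by
  simpa [coe_aeval_eq_eval] using aeval_smul_of_isWeightedHomogeneous hP c v

/-! ### Points and homogeneous coordinates. -/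

section Points

variable {wt : Fin 3 → ℕ} {F : MvPolynomial (Fin 3) ℂ}

theorem Curve.rep_ne_zero (p : Curve wt F) : p.rep ≠ 0 := (Quotient.out p).2.1

theorem Curve.eval_rep (p : Curve wt F) : eval p.rep F = 0 := (Quotient.out p).2.2

/-- The point with given homogeneous coordinates. -/
def Curve.mk (v : Fin 3 → ℂ) (hv : v ≠ 0 ∧ eval v F = 0) : Curve wt F :=
  Quotient.mk (coneSetoid wt F) ⟨v, hv⟩

theorem Curve.mk_rep (p : Curve wt F) : Curve.mk p.rep ⟨p.rep_ne_zero, p.eval_rep⟩ = p :=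
  Quotient.out_eq p

theorem Curve.mk_eq_mk_iff {u v : Fin 3 → ℂ} (hu : u ≠ 0 ∧ eval u F = 0)
    (hv : v ≠ 0 ∧ eval v F = 0) : (Curve.mk u hu : Curve wt F) = Curve.mk v hv ↔
      ∃ c : ℂ, c ≠ 0 ∧ ∀ i, v i = c ^ wt i * u i :=
  Quotient.eq (r := coneSetoid wt F)

theorem Curve.rep_mk (v : Fin 3 → ℂ) (hv : v ≠ 0 ∧ eval v F = 0) :
    ∃ c : ℂ, c ≠ 0 ∧ ∀ i, (Curve.mk v hv : Curve wt F).rep i = c ^ wt i * v i :=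
  (Curve.mk_eq_mk_iff hv _).1 (Curve.mk_rep (Curve.mk v hv : Curve wt F)).symm

theorem Curve.eval_rep_mk {P : MvPolynomial (Fin 3) ℂ} {d : ℕ} (hP : P.IsWeightedHomogeneous wt d)
    (v : Fin 3 → ℂ) (hv : v ≠ 0 ∧ eval v F = 0) :
    eval (Curve.mk v hv : Curve wt F).rep P = 0 ↔ eval v P = 0 := by
  obtain ⟨c, hc, h⟩ := Curve.rep_mk (wt := wt) v hv
  rw [funext h, eval_smul_of_isWeightedHomogeneous hP]
  simp [hc]

theorem Curve.eq_of_rep {p q : Curve wt F} {c : ℂ} (hc : c ≠ 0)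
    (h : ∀ i, q.rep i = c ^ wt i * p.rep i) : p = q := by
  rw [← p.mk_rep, ← q.mk_rep, Curve.mk_eq_mk_iff]
  exact ⟨c, hc, h⟩

end Points

theorem toFrac_eq_zero_iff_dvd {F P : MvPolynomial (Fin 3) ℂ} : toFrac F P = 0 ↔ F ∣ P := by
  rw [← Ideal.mem_span_singleton, ← Ideal.Quotient.eq_zero_iff_mem]
  exact IsFractionRing.to_map_eq_zero_iff (R := MvPolynomial (Fin 3) ℂ ⧸ Ideal.span {F})
    (K := CoordFrac F)

theorem toFrac_eq_iff_dvd {F P Q : MvPolynomial (Fin 3) ℂ} : toFrac F P = toFrac F Q ↔ F ∣ P - Q := by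
  rw [← toFrac_eq_zero_iff_dvd, map_sub, sub_eq_zero]

theorem eval_eq_of_toFrac_eq {F P Q : MvPolynomial (Fin 3) ℂ} (h : toFrac F P = toFrac F Q)
    {v : Fin 3 → ℂ} (hv : eval v F = 0) : eval v P = eval v Q := by
  obtain ⟨R, hR⟩ := toFrac_eq_iff_dvd.1 h
  rw [← sub_eq_zero, ← map_sub, hR, map_mul, hv, zero_mul]

/-- Nullstellensatz: `(F)` is prime, hence equal to the vanishing ideal of its zero locus.
Identities in the coordinate ring can thus be checked at points of the cone. -/
theorem dvd_iff_eval {F P : MvPolynomial (Fin 3) ℂ} (hF : Prime F) :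
    F ∣ P ↔ ∀ v, eval v F = 0 → eval v P = 0 := by
  refine ⟨fun ⟨R, hR⟩ v hv => by rw [hR, map_mul, hv, zero_mul], fun h => ?_⟩
  have := (Ideal.span_singleton_prime hF.ne_zero).2 hF
  rw [← Ideal.mem_span_singleton, ← MvPolynomial.IsPrime.vanishingIdeal_zeroLocus
    (K := ℂ) (Ideal.span {F})]
  intro v hv
  rw [zeroLocus_span] at hv
  simpa using h v (by simpa using hv)

/-- Two polynomials which are homogeneous of different degrees and agree on the curve vanish on it. -/
theorem toFrac_eq_zero_of_ne {wt : Fin 3 → ℕ} {F P Q : MvPolynomial (Fin 3) ℂ} (hF : Prime F)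
    {N a b : ℕ} (hN : F.IsWeightedHomogeneous wt N) (hP : P.IsWeightedHomogeneous wt a)
    (hQ : Q.IsWeightedHomogeneous wt b) (hab : a ≠ b) (h : toFrac F P = toFrac F Q) :
    toFrac F P = 0 := by
  rw [toFrac_eq_zero_iff_dvd, dvd_iff_eval hF]
  intro v hv
  have h1 := eval_eq_of_toFrac_eq h hv
  -- Rescaling a point by `2` separates the degrees, since `2 ^ a ≠ 2 ^ b`.
  have h2 := eval_eq_of_toFrac_eq h (v := fun i => (2 : ℂ) ^ wt i * v i) (by
    rw [eval_smul_of_isWeightedHomogeneous hN, hv, mul_zero])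
  rw [eval_smul_of_isWeightedHomogeneous hP, eval_smul_of_isWeightedHomogeneous hQ, ← h1] at h2
  have h3 : (2 : ℂ) ^ a ≠ 2 ^ b := by
    intro h
    exact hab (Nat.pow_right_injective le_rfl (by exact_mod_cast h))
  rw [← sub_eq_zero, ← sub_mul, mul_eq_zero] at h2
  exact h2.resolve_left (sub_ne_zero.2 h3)

instance isDomain_quotient {F : MvPolynomial (Fin 3) ℂ} [h : Fact (Prime F)] :
    IsDomain (MvPolynomial (Fin 3) ℂ ⧸ Ideal.span {F}) :=
  (Ideal.Quotient.isDomain_iff_prime _).2 ((Ideal.span_singleton_prime h.out.ne_zero).2 h.out)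

/-! ### Values of rational functions and local rings. -/

section Values

variable {wt : Fin 3 → ℕ} {F : MvPolynomial (Fin 3) ℂ}

theorem toFrac_ne_zero_of_eval {P : MvPolynomial (Fin 3) ℂ} {v : Fin 3 → ℂ} (hv : eval v F = 0)
    (hP : eval v P ≠ 0) : toFrac F P ≠ 0 := fun h =>
  hP (by rw [eval_eq_of_toFrac_eq (h.trans (map_zero (toFrac F)).symm) hv, map_zero])

/-- `g` is regular at `p` and takes the value `c` there. -/
def HasValue (p : Curve wt F) (g : CoordFrac F) (c : ℂ) : Prop :=
  ∃ P Q, IsFraction wt F g P Q ∧ eval p.rep Q ≠ 0 ∧ eval p.rep P = c * eval p.rep Q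

variable [hF : Fact (Prime F)]

theorem hasValue_div {p : Curve wt F} {P Q : MvPolynomial (Fin 3) ℂ} {d : ℕ}
    (hP : P.IsWeightedHomogeneous wt d) (hQ : Q.IsWeightedHomogeneous wt d)
    (hQp : eval p.rep Q ≠ 0) :
    HasValue p (toFrac F P / toFrac F Q) (eval p.rep P / eval p.rep Q) := by
  have h := toFrac_ne_zero_of_eval p.eval_rep hQp
  exact ⟨P, Q, ⟨⟨d, hP, hQ⟩, h.isUnit, div_mul_cancel₀ _ h⟩, hQp, (div_mul_cancel₀ _ hQp).symm⟩

theorem HasValue.exists_div {p : Curve wt F} {g : CoordFrac F} {c : ℂ} (h : HasValue p g c) :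
    ∃ (d : ℕ) (P Q : MvPolynomial (Fin 3) ℂ), P.IsWeightedHomogeneous wt d ∧
      Q.IsWeightedHomogeneous wt d ∧ eval p.rep Q ≠ 0 ∧ g = toFrac F P / toFrac F Q ∧
      eval p.rep P = c * eval p.rep Q := by
  obtain ⟨P, Q, ⟨⟨d, hP, hQ⟩, hu, h⟩, hQp, hPp⟩ := h
  exact ⟨d, P, Q, hP, hQ, hQp, by rw [← h, mul_div_cancel_right₀ _ hu.ne_zero], hPp⟩

theorem HasValue.mem {p : Curve wt F} {g : CoordFrac F} {c : ℂ} (h : HasValue p g c) :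
    g ∈ functionField wt F := by
  obtain ⟨P, Q, h, -⟩ := h
  exact ⟨P, Q, h⟩

theorem HasValue.unique {p : Curve wt F} {g : CoordFrac F} {c c' : ℂ} (h : HasValue p g c)
    (h' : HasValue p g c') : c = c' := by
  obtain ⟨d, P, Q, hP, hQ, hQp, rfl, hv⟩ := h.exists_div
  obtain ⟨d', P', Q', hP', hQ', hQp', he, hv'⟩ := h'.exists_div
  have h1 := toFrac_ne_zero_of_eval p.eval_rep hQp
  have h2 := toFrac_ne_zero_of_eval p.eval_rep hQp'
  rw [div_eq_div_iff h1 h2, ← map_mul, ← map_mul] at he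
  have := eval_eq_of_toFrac_eq he p.eval_rep
  rw [map_mul, map_mul, hv, hv'] at this
  exact mul_right_cancel₀ (mul_ne_zero hQp hQp') (by linear_combination this)

theorem HasValue.add {p : Curve wt F} {f g : CoordFrac F} {c d : ℂ} (hf : HasValue p f c)
    (hg : HasValue p g d) : HasValue p (f + g) (c + d) := by
  obtain ⟨d, P, Q, hP, hQ, hQp, rfl, hv⟩ := hf.exists_div
  obtain ⟨d', P', Q', hP', hQ', hQp', rfl, hv'⟩ := hg.exists_div
  have h1 := toFrac_ne_zero_of_eval p.eval_rep hQp
  have h2 := toFrac_ne_zero_of_eval p.eval_rep hQp'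
  convert hasValue_div (p := p) ((hP.mul hQ').add (hQ.mul hP')) (hQ.mul hQ')
    (by rw [map_mul]; exact mul_ne_zero hQp hQp') using 1
  · rw [map_add, map_mul, map_mul, map_mul, div_add_div _ _ h1 h2]
  · rw [map_add, map_mul, map_mul, map_mul, hv, hv']; field_simp

theorem HasValue.mul {p : Curve wt F} {f g : CoordFrac F} {c d : ℂ} (hf : HasValue p f c)
    (hg : HasValue p g d) : HasValue p (f * g) (c * d) := by
  obtain ⟨d, P, Q, hP, hQ, hQp, rfl, hv⟩ := hf.exists_div
  obtain ⟨d', P', Q', hP', hQ', hQp', rfl, hv'⟩ := hg.exists_div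
  convert hasValue_div (p := p) (hP.mul hP') (hQ.mul hQ')
    (by rw [map_mul]; exact mul_ne_zero hQp hQp') using 1
  · rw [map_mul, map_mul, div_mul_div_comm]
  · rw [map_mul, map_mul, hv, hv']; field_simp

theorem HasValue.inv {p : Curve wt F} {f : CoordFrac F} {c : ℂ} (hf : HasValue p f c)
    (hc : c ≠ 0) : HasValue p f⁻¹ c⁻¹ := by
  obtain ⟨d, P, Q, hP, hQ, hQp, rfl, hv⟩ := hf.exists_div
  convert hasValue_div (p := p) hQ hP (by rw [hv]; exact mul_ne_zero hc hQp) using 1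
  · rw [inv_div]
  · rw [hv]; field_simp

theorem hasValue_algebraMap (p : Curve wt F) (c : ℂ) : HasValue p (algebraMap ℂ (CoordFrac F) c) c := by
  refine ⟨C c, 1, ⟨⟨0, isWeightedHomogeneous_C wt c, isWeightedHomogeneous_one ℂ wt⟩, ?_, ?_⟩, ?_, ?_⟩
  · rw [map_one]; exact isUnit_one
  · rw [map_one, mul_one, ← MvPolynomial.algebraMap_eq, AlgHom.commutes]
  · simp
  · simp

theorem hasValue_one (p : Curve wt F) : HasValue p (1 : CoordFrac F) 1 := by
  simpa using hasValue_algebraMap p 1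

theorem HasValue.neg {p : Curve wt F} {f : CoordFrac F} {c : ℂ} (hf : HasValue p f c) :
    HasValue p (-f) (-c) := by
  simpa using (hasValue_algebraMap p (-1)).mul hf

theorem HasValue.sub {p : Curve wt F} {f g : CoordFrac F} {c d : ℂ} (hf : HasValue p f c)
    (hg : HasValue p g d) : HasValue p (f - g) (c - d) := by
  simpa [sub_eq_add_neg] using hf.add hg.neg

theorem HasValue.pow {p : Curve wt F} {f : CoordFrac F} {c : ℂ} (hf : HasValue p f c) (n : ℕ) :
    HasValue p (f ^ n) (c ^ n) := by
  induction n with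
  | zero => simpa using hasValue_one p
  | succ n ih => rw [pow_succ, pow_succ]; exact ih.mul hf

theorem inLocalRing_iff {p : Curve wt F} {f : functionField wt F} :
    InLocalRing p f ↔ ∃ c, HasValue p (f : CoordFrac F) c :=
  ⟨fun ⟨P, Q, h, hQ⟩ => ⟨eval p.rep P / eval p.rep Q, P, Q, h, hQ, (div_mul_cancel₀ _ hQ).symm⟩,
    fun ⟨_, P, Q, h, hQ, _⟩ => ⟨P, Q, h, hQ⟩⟩

theorem inMaximalIdeal_iff {p : Curve wt F} {f : functionField wt F} :
    InMaximalIdeal p f ↔ HasValue p (f : CoordFrac F) 0 := by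
  simp only [InMaximalIdeal, HasValue, zero_mul]

theorem isUnitAt_iff {p : Curve wt F} {f : functionField wt F} :
    IsUnitAt p f ↔ ∃ c ≠ 0, HasValue p (f : CoordFrac F) c :=
  ⟨fun ⟨P, Q, h, hQ, hP⟩ => ⟨eval p.rep P / eval p.rep Q, div_ne_zero hP hQ, P, Q, h, hQ,
    (div_mul_cancel₀ _ hQ).symm⟩,
    fun ⟨_, hc, P, Q, h, hQ, hP⟩ => ⟨P, Q, h, hQ, by rw [hP]; exact mul_ne_zero hc hQ⟩⟩

/-- `t` generates the maximal ideal of the local ring at `p`. -/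
def Unif (p : Curve wt F) (t : CoordFrac F) : Prop :=
  HasValue p t 0 ∧ ∀ g, HasValue p g 0 → ∃ h c, HasValue p h c ∧ g = h * t

theorem isUniformizer_iff {p : Curve wt F} {t : functionField wt F} :
    IsUniformizer p t ↔ Unif p (t : CoordFrac F) := by
  simp only [IsUniformizer, Unif, inMaximalIdeal_iff, inLocalRing_iff]
  refine and_congr_right fun _ => ⟨fun h g hg => ?_, fun h g hg => ?_⟩
  · obtain ⟨k, ⟨c, hk⟩, e⟩ := h ⟨g, hg.mem⟩ hg
    exact ⟨k, c, hk, congrArg Subtype.val e⟩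
  · obtain ⟨k, c, hk, e⟩ := h g hg
    exact ⟨⟨k, hk.mem⟩, ⟨c, hk⟩, Subtype.ext e⟩

end Values

/-! ### Affine charts and first-order expansions. -/

section Chart

variable {wt : Fin 3 → ℕ} {F : MvPolynomial (Fin 3) ℂ}

/-- The curve avoids `[0 : 0 : 1]`, so the two charts given by the variables of weight one cover it.
-/
theorem NiceCurve.exists_chart (hC : NiceCurve wt F) (p : Curve wt F) :
    ∃ j : Fin 3, j ≠ 2 ∧ wt j = 1 ∧ p.rep j ≠ 0 := by
  by_contra! h
  have h0 := h 0 (by decide) hC.wt_zero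
  have h1 := h 1 (by decide) hC.wt_one
  have e : p.rep = ![0, 0, p.rep 2] := by
    funext i; fin_cases i
    · exact h0
    · exact h1
    · rfl
  have h2 := hC.eq_zero_of_top (p.rep 2) (e ▸ p.eval_rep)
  rw [h2] at e
  exact p.rep_ne_zero (e.trans (by funext i; fin_cases i <;> rfl))

theorem toFrac_eq_aeval : toFrac F = aeval (fun i => toFrac F (X i)) := by
  ext i; simp

variable (wt F) in
/-- Dehomogenization with respect to the variable `X j`. -/
def dehom [Fact (Prime F)] (j : Fin 3) : MvPolynomial (Fin 3) ℂ →ₐ[ℂ] CoordFrac F :=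
  aeval (fun i => toFrac F (X i) / toFrac F (X j) ^ wt i)

/-- The coordinates of `p` normalized by `X j = 1`. -/
def Curve.affine (p : Curve wt F) (j : Fin 3) : Fin 3 → ℂ := fun i => p.rep i / p.rep j ^ wt i

variable [hF : Fact (Prime F)]

theorem dehom_eq_div {P : MvPolynomial (Fin 3) ℂ} {d : ℕ} (hP : P.IsWeightedHomogeneous wt d)
    (j : Fin 3) : dehom wt F j P = toFrac F P / toFrac F (X j) ^ d := by
  rw [toFrac_eq_aeval (F := F), dehom, div_eq_inv_mul, ← inv_pow,
    ← aeval_smul_of_isWeightedHomogeneous hP]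
  simp only [inv_pow, aeval_X, div_eq_inv_mul]

theorem Curve.eval_affine {P : MvPolynomial (Fin 3) ℂ} {d : ℕ} (hP : P.IsWeightedHomogeneous wt d)
    (p : Curve wt F) (j : Fin 3) : eval (p.affine j) P = eval p.rep P / p.rep j ^ d := by
  rw [div_eq_inv_mul, ← inv_pow, ← eval_smul_of_isWeightedHomogeneous hP]
  congr 2
  funext i
  rw [Curve.affine, inv_pow, div_eq_inv_mul]

theorem hasValue_dehom {p : Curve wt F} {j : Fin 3} (hj : p.rep j ≠ 0) (hw : wt j = 1)
    (P : MvPolynomial (Fin 3) ℂ) :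
    HasValue p (dehom wt F j P) (eval (p.affine j) P) := by
  induction P using MvPolynomial.induction_on with
  | C a => simpa [← MvPolynomial.algebraMap_eq] using hasValue_algebraMap p a
  | add P Q hP hQ => rw [map_add, map_add]; exact hP.add hQ
  | mul_X P i hP =>
    rw [map_mul, map_mul]
    refine hP.mul ?_
    have := hasValue_div (p := p) (isWeightedHomogeneous_X ℂ wt i)
      (by simpa [hw] using (isWeightedHomogeneous_X ℂ wt j).pow (wt i)) (by simp [hj])
    simpa [dehom, Curve.affine] using this

theorem HasValue.exists_dehom {p : Curve wt F} {j : Fin 3} (hj : p.rep j ≠ 0)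
    {g : CoordFrac F} {c : ℂ} (h : HasValue p g c) :
    ∃ P Q, g = dehom wt F j P / dehom wt F j Q ∧ eval (p.affine j) Q ≠ 0 ∧
      eval (p.affine j) P = c * eval (p.affine j) Q := by
  obtain ⟨d, P, Q, hP, hQ, hQp, rfl, hv⟩ := h.exists_div
  have hX : toFrac F (X j) ≠ 0 := toFrac_ne_zero_of_eval p.eval_rep (by simpa)
  refine ⟨P, Q, ?_, ?_, ?_⟩
  · rw [dehom_eq_div hP, dehom_eq_div hQ, div_div_div_cancel_right₀ (pow_ne_zero _ hX)]
  · rw [Curve.eval_affine hQ]; exact div_ne_zero hQp (pow_ne_zero _ hj)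
  · rw [Curve.eval_affine hQ, Curve.eval_affine hP, hv, mul_div_assoc]

/-- The coefficients `A i` are polynomials, not constants: the expansion is exact and can be
transported to the function field. It is applied to `F` and to numerators of rational functions. -/
theorem exists_taylor {σ : Type*} [Fintype σ] (v : σ → ℂ) (P : MvPolynomial σ ℂ) :
    ∃ A : σ → MvPolynomial σ ℂ, P = C (eval v P) + ∑ i, (X i - C (v i)) * A i := by
  classical
  induction P using MvPolynomial.induction_on with
  | C a => exact ⟨0, by simp⟩
  | add P Q hP hQ =>
    obtain ⟨A, hA⟩ := hP
    obtain ⟨B, hB⟩ := hQ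
    refine ⟨A + B, ?_⟩
    simp only [Pi.add_apply, mul_add, Finset.sum_add_distrib, map_add]
    linear_combination hA + hB
  | mul_X P k hP =>
    obtain ⟨A, hA⟩ := hP
    refine ⟨fun i => X k * A i + if i = k then C (eval v P) else 0, ?_⟩
    simp only [mul_add, Finset.sum_add_distrib, mul_ite, mul_zero, Finset.sum_ite_eq',
      Finset.mem_univ, if_true, map_mul, eval_X]
    rw [Finset.sum_congr rfl fun i _ => mul_left_comm (X i - C (v i)) (X k) (A i), ← Finset.mul_sum]
    linear_combination X k * hA

/-- The coefficients of an exact expansion are not unique, but their values at the centre are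
forced. -/
theorem eval_taylor {σ : Type*} [Fintype σ] [DecidableEq σ] {v : σ → ℂ} {P : MvPolynomial σ ℂ}
    {A : σ → MvPolynomial σ ℂ} (h : P = C (eval v P) + ∑ i, (X i - C (v i)) * A i) (k : σ) :
    eval v (pderiv k P) = eval v (A k) := by
  rw [h]
  simp only [map_add, map_sum, pderiv_C, Derivation.leibniz, smul_eq_mul, map_mul, map_sub, eval_X,
    eval_C, sub_self, zero_mul, zero_add, pderiv_X, sub_zero]
  rw [Finset.sum_eq_single k]
  · simp
  · intro b _ hb
    simp [hb.symm]
  · simp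

end Chart

/-! ### Uniformizers and orders -/

section Orders

variable {wt : Fin 3 → ℕ} {F : MvPolynomial (Fin 3) ℂ} [hF : Fact (Prime F)]

theorem Curve.affine_self (p : Curve wt F) {j : Fin 3} (hj : p.rep j ≠ 0) (hw : wt j = 1) :
    p.affine j j = 1 := by
  rw [Curve.affine, hw, pow_one, div_self hj]

/-- A coordinate function vanishing at `p`. -/
def localCoord (p : Curve wt F) (j i : Fin 3) : CoordFrac F :=
  dehom wt F j (X i - C (p.affine j i))

theorem hasValue_localCoord {p : Curve wt F} {j : Fin 3} (hj : p.rep j ≠ 0) (hw : wt j = 1)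
    (i : Fin 3) : HasValue p (localCoord p j i) 0 := by
  have := hasValue_dehom hj hw (X i - C (p.affine j i))
  rwa [map_sub (eval _), eval_X, eval_C, sub_self] at this

theorem localCoord_self {p : Curve wt F} {j : Fin 3} (hj : p.rep j ≠ 0) (hw : wt j = 1) :
    localCoord p j j = 0 := by
  have hX : toFrac F (X j) ≠ 0 := toFrac_ne_zero_of_eval p.eval_rep (by simpa)
  rw [localCoord, p.affine_self hj hw]
  simp [dehom, hw, hX]

theorem sum_fin_three_eq {M : Type*} [AddCommMonoid M] {i j k : Fin 3} (hij : i ≠ j) (hkj : k ≠ j)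
    (hik : i ≠ k) (f : Fin 3 → M) : ∑ l, f l = f j + f i + f k := by
  have : (Finset.univ : Finset (Fin 3)) = {j, i, k} := by
    revert i j k; decide
  rw [this, Finset.sum_insert (by simp [hij.symm, hkj.symm]), Finset.sum_insert (by simp [hik]),
    Finset.sum_singleton, add_assoc]

theorem dehom_self (hC : NiceCurve wt F) (j : Fin 3) : dehom wt F j F = 0 := by
  obtain ⟨N, hN⟩ := hC.homogeneous
  rw [dehom_eq_div hN, toFrac_eq_zero_iff_dvd.2 dvd_rfl, zero_div]

theorem dehom_taylor {p : Curve wt F} {i j k : Fin 3} (hj : p.rep j ≠ 0) (hw : wt j = 1)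
    (hij : i ≠ j) (hkj : k ≠ j) (hik : i ≠ k) {P : MvPolynomial (Fin 3) ℂ}
    {A : Fin 3 → MvPolynomial (Fin 3) ℂ}
    (h : P = C (eval (p.affine j) P) + ∑ i, (X i - C (p.affine j i)) * A i) :
    dehom wt F j P = algebraMap ℂ _ (eval (p.affine j) P) + (localCoord p j i * dehom wt F j (A i) +
      localCoord p j k * dehom wt F j (A k)) := by
  conv_lhs => rw [h]
  rw [sum_fin_three_eq hij hkj hik]
  rw [map_add, map_add, map_add, map_mul, map_mul, map_mul]
  change _ + (localCoord p j j * _ + localCoord p j i * _ + localCoord p j k * _) = _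
  rw [localCoord_self hj hw, zero_mul, zero_add, ← MvPolynomial.algebraMap_eq, AlgHom.commutes]

/-- A coordinate is a uniformizer if the partial derivative with respect to the other coordinate does
not vanish. -/
theorem unif_localCoord (hC : NiceCurve wt F) {p : Curve wt F} {i j k : Fin 3} (hj : p.rep j ≠ 0)
    (hw : wt j = 1) (hij : i ≠ j) (hkj : k ≠ j) (hik : i ≠ k)
    (h : eval (p.affine j) (pderiv i F) ≠ 0) : Unif p (localCoord p j k) := by
  refine ⟨hasValue_localCoord hj hw k, fun g hg => ?_⟩
  obtain ⟨A, hA⟩ := exists_taylor (p.affine j) F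
  obtain ⟨N, hN⟩ := hC.homogeneous
  have e : eval (p.affine j) F = 0 := by rw [Curve.eval_affine hN, p.eval_rep, zero_div]
  have h1 := dehom_taylor hj hw hij hkj hik hA
  rw [e, map_zero, zero_add, dehom_self hC] at h1
  rw [eval_taylor hA] at h
  obtain ⟨P, Q, rfl, hQ, hP⟩ := hg.exists_dehom hj
  obtain ⟨B, hB⟩ := exists_taylor (p.affine j) P
  have h2 := dehom_taylor hj hw hij hkj hik hB
  rw [hP, zero_mul, map_zero, zero_add] at h2
  have hd : ∀ R, HasValue p (dehom wt F j R) (eval (p.affine j) R) := hasValue_dehom hj hw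
  refine ⟨_, _, (((hd (B k)).sub ((hd (B i)).mul ((hd (A k)).mul ((hd (A i)).inv h)))).mul
    ((hd Q).inv hQ)), ?_⟩
  have hAi : dehom wt F j (A i) ≠ 0 := fun h0 => h ((hd (A i)).unique (by
    rw [h0]; simpa using hasValue_algebraMap p 0))
  -- On the curve the expansion of `F` reads `x_i A_i + x_k A_k = 0`, and `A_i` is a unit at `p`. So
  -- `x_i` is a regular multiple of `x_k`, and any function vanishing at `p` is one too.
  have h3 : localCoord p j i = - (localCoord p j k * dehom wt F j (A k)) * (dehom wt F j (A i))⁻¹ := by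
    field_simp
    linear_combination -h1
  rw [h2, h3]
  ring

/-- By Euler's relation, the derivative with respect to the normalized variable vanishes as soon as
the two others do. -/
theorem NiceCurve.exists_pderiv (hC : NiceCurve wt F) {p : Curve wt F} {j : Fin 3} (hj : p.rep j ≠ 0)
    (hw : wt j = 1) : ∃ i, i ≠ j ∧ eval (p.affine j) (pderiv i F) ≠ 0 := by
  obtain ⟨N, hN⟩ := hC.homogeneous
  have e : eval (p.affine j) F = 0 := by rw [Curve.eval_affine hN, p.eval_rep, zero_div]
  obtain ⟨i, hi⟩ := hC.nonsingular (p.affine j) (fun h => by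
    have := p.affine_self hj hw; rw [h] at this; simp at this) e
  by_cases hij : i = j
  · subst hij
    by_contra! hne
    have h := congrArg (eval (p.affine i)) hN.sum_weight_X_mul_pderiv
    rw [map_sum, Finset.sum_eq_single i] at h
    · simp [hw, e, p.affine_self hj hw] at h
      exact hi h
    · intro b _ hb
      simp [hne b hb]
    · simp
  · exact ⟨i, hij, hi⟩

theorem exists_third {i j : Fin 3} (h : i ≠ j) : ∃ k, k ≠ j ∧ i ≠ k := by
  revert i j; decide

theorem NiceCurve.exists_unif (hC : NiceCurve wt F) (p : Curve wt F) : ∃ t, Unif p t := by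
  obtain ⟨j, -, hw, hj⟩ := hC.exists_chart p
  obtain ⟨i, hij, hi⟩ := hC.exists_pderiv hj hw
  obtain ⟨k, hkj, hik⟩ := exists_third hij
  exact ⟨_, unif_localCoord hC hj hw hij hkj hik hi⟩

theorem hasValue_zero (p : Curve wt F) : HasValue p (0 : CoordFrac F) 0 := by
  simpa using hasValue_algebraMap p 0

theorem HasValue.ne_zero {p : Curve wt F} {g : CoordFrac F} {c : ℂ} (h : HasValue p g c)
    (hc : c ≠ 0) : g ≠ 0 := by
  rintro rfl
  exact hc (h.unique (hasValue_zero p))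

/-- A nonzero linear form in `X 0, X 1` does not vanish on the curve. -/
theorem NiceCurve.linear_ne_zero (hC : NiceCurve wt F) {a b : ℂ} (h : ¬ (a = 0 ∧ b = 0)) :
    toFrac F (C a * X 0 + C b * X 1) ≠ 0 := by
  obtain ⟨x, y, hxy⟩ : ∃ x y, a * x + b * y ≠ 0 := by
    by_cases ha : a = 0
    · exact ⟨0, 1, by simpa [ha] using h⟩
    · exact ⟨1, 0, by simpa⟩
  obtain ⟨z, hz⟩ := hC.exists_root x y
  exact toFrac_ne_zero_of_eval hz (by simpa using hxy)

/-- If `0` generated the maximal ideal, the local coordinate coming from the other variable of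
weight one would vanish identically. Then a nonzero linear form in `X 0, X 1` would vanish on a
curve that maps onto `ℙ¹`. -/
theorem Unif.ne_zero (hC : NiceCurve wt F) {p : Curve wt F} {t : CoordFrac F} (ht : Unif p t) :
    t ≠ 0 := by
  rintro rfl
  obtain ⟨j, hj2, hw, hj⟩ := hC.exists_chart p
  have hX : toFrac F (X j) ≠ 0 := toFrac_ne_zero_of_eval p.eval_rep (by simpa)
  obtain ⟨i, hw', a, b, hab, e⟩ : ∃ i : Fin 3, wt i = 1 ∧ ∃ a b : ℂ, ¬ (a = 0 ∧ b = 0) ∧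
      localCoord p j i * toFrac F (X j) = toFrac F (C a * X 0 + C b * X 1) := by
    have hC' : ∀ c : ℂ, toFrac F (C c) = algebraMap ℂ _ c := fun c => by
      rw [← MvPolynomial.algebraMap_eq, AlgHom.commutes]
    fin_cases j
    · refine ⟨1, hC.wt_one, - p.affine 0 1, 1, by simp, ?_⟩
      simp only [localCoord, dehom, map_sub, aeval_X, hC.wt_one, pow_one, algHom_C, map_add, map_mul, hC']
      simp at hX ⊢
      field_simp
      ring
    · refine ⟨0, hC.wt_zero, 1, - p.affine 1 0, by simp, ?_⟩
      simp only [localCoord, dehom, map_sub, aeval_X, hC.wt_zero, pow_one, algHom_C, map_add, map_mul, hC']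
      simp at hX ⊢
      field_simp
      ring
    · exact absurd rfl hj2
  have h0 := hC.linear_ne_zero hab
  obtain ⟨h, c, -, h'⟩ := ht.2 _ (hasValue_localCoord hj hw i)
  rw [← e, h'] at h0
  simp at h0

theorem Unif.exists_mul (hC : NiceCurve wt F) {p : Curve wt F} {t t' : CoordFrac F} (ht : Unif p t)
    (ht' : Unif p t') : ∃ u c, c ≠ 0 ∧ HasValue p u c ∧ t' = u * t := by
  obtain ⟨u, c, hu, e⟩ := ht.2 t' ht'.1
  obtain ⟨u', c', hu', e'⟩ := ht'.2 t ht.1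
  refine ⟨u, c, ?_, hu, e⟩
  have h1 : u' * u = 1 := by
    have := ht.ne_zero hC
    rw [e] at e'
    field_simp at e'
    exact e'.symm
  have := (hu'.mul hu).unique (h1 ▸ hasValue_one p)
  rintro rfl
  simp at this

/-- `g` is a quotient of two homogeneous polynomials not vanishing at `p`. -/
def HU (p : Curve wt F) (g : CoordFrac F) : Prop :=
  ∃ P Q : MvPolynomial (Fin 3) ℂ, ∃ a b : ℕ, P.IsWeightedHomogeneous wt a ∧
    Q.IsWeightedHomogeneous wt b ∧ eval p.rep P ≠ 0 ∧ eval p.rep Q ≠ 0 ∧ g = toFrac F P / toFrac F Q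

theorem HU.ne_zero {p : Curve wt F} {g : CoordFrac F} (h : HU p g) : g ≠ 0 := by
  obtain ⟨P, Q, a, b, hP, hQ, hPp, hQp, rfl⟩ := h
  exact div_ne_zero (toFrac_ne_zero_of_eval p.eval_rep hPp) (toFrac_ne_zero_of_eval p.eval_rep hQp)

theorem HU.mul {p : Curve wt F} {f g : CoordFrac F} (hf : HU p f) (hg : HU p g) : HU p (f * g) := by
  obtain ⟨P, Q, a, b, hP, hQ, hPp, hQp, rfl⟩ := hf
  obtain ⟨P', Q', a', b', hP', hQ', hPp', hQp', rfl⟩ := hg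
  exact ⟨_, _, _, _, hP.mul hP', hQ.mul hQ', by simp [hPp, hPp'], by simp [hQp, hQp'], by
    rw [map_mul, map_mul, div_mul_div_comm]⟩

theorem HU.inv {p : Curve wt F} {f : CoordFrac F} (hf : HU p f) : HU p f⁻¹ := by
  obtain ⟨P, Q, a, b, hP, hQ, hPp, hQp, rfl⟩ := hf
  exact ⟨_, _, _, _, hQ, hP, hQp, hPp, by rw [inv_div]⟩

theorem HU.toFrac {p : Curve wt F} {P : MvPolynomial (Fin 3) ℂ} {d : ℕ}
    (hP : P.IsWeightedHomogeneous wt d) (h : eval p.rep P ≠ 0) : HU p (toFrac F P) :=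
  ⟨P, 1, d, 0, hP, isWeightedHomogeneous_one ℂ wt, h, by simp, by simp⟩

theorem HasValue.hU {p : Curve wt F} {f : CoordFrac F} {c : ℂ} (hf : HasValue p f c) (hc : c ≠ 0) :
    HU p f := by
  obtain ⟨d, P, Q, hP, hQ, hQp, rfl, hv⟩ := hf.exists_div
  exact ⟨P, Q, d, d, hP, hQ, by rw [hv]; exact mul_ne_zero hc hQp, hQp, rfl⟩

theorem HU.pow {p : Curve wt F} {f : CoordFrac F} (hf : HU p f) (n : ℕ) : HU p (f ^ n) := by
  induction n with
  | zero => simpa using (hasValue_one p).hU one_ne_zero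
  | succ n ih => rw [pow_succ]; exact ih.mul hf

theorem HU.zpow {p : Curve wt F} {f : CoordFrac F} (hf : HU p f) (n : ℤ) : HU p (f ^ n) := by
  cases n with
  | ofNat n => simpa using hf.pow n
  | negSucc n => rw [zpow_negSucc]; exact (hf.pow _).inv

theorem HU.not_hasValue_zero {p : Curve wt F} {f : CoordFrac F} (hf : HU p f) :
    ¬ HasValue p f 0 := by
  intro h
  obtain ⟨d, P, Q, hP, hQ, hQp, he, hv⟩ := h.exists_div
  obtain ⟨P', Q', a, b, hP', hQ', hPp', hQp', he'⟩ := hf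
  rw [he, div_eq_div_iff (toFrac_ne_zero_of_eval p.eval_rep hQp)
    (toFrac_ne_zero_of_eval p.eval_rep hQp'), ← map_mul, ← map_mul] at he'
  have := eval_eq_of_toFrac_eq he' p.eval_rep
  rw [map_mul, map_mul, hv, zero_mul, zero_mul] at this
  exact mul_ne_zero hPp' hQp this.symm

/-- An element of the function field has degree zero. If numerator and denominator had different
degrees, the cross products would agree on the cone in different degrees and hence vanish. -/
theorem HU.exists_hasValue (hC : NiceCurve wt F) {p : Curve wt F} {f : CoordFrac F} (hf : HU p f)
    (h : f ∈ functionField wt F) : ∃ c, c ≠ 0 ∧ HasValue p f c := by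
  obtain ⟨P', Q', ⟨⟨d, hP', hQ'⟩, hu, he⟩⟩ := h
  obtain ⟨P, Q, a, b, hP, hQ, hPp, hQp, rfl⟩ := hf
  obtain ⟨N, hN⟩ := hC.homogeneous
  have hQ0 := toFrac_ne_zero_of_eval p.eval_rep hQp
  have hP0 := toFrac_ne_zero_of_eval p.eval_rep hPp
  have hab : a = b := by
    by_contra hab
    rw [div_mul_eq_mul_div, div_eq_iff hQ0, ← map_mul, ← map_mul] at he
    have := toFrac_eq_zero_of_ne hF.out hN (hP.mul hQ') (hP'.mul hQ) (by omega) he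
    rw [map_mul] at this
    exact mul_ne_zero hP0 hu.ne_zero this
  subst hab
  exact ⟨_, div_ne_zero hPp hQp, hasValue_div hP hQ hQp⟩

/-- The order at `p` of a quotient of homogeneous polynomials. -/
def HOrd (p : Curve wt F) (g : CoordFrac F) (n : ℤ) : Prop :=
  ∃ t, Unif p t ∧ HU p (g / t ^ n)

theorem HOrd.of_unif (hC : NiceCurve wt F) {p : Curve wt F} {g : CoordFrac F} {n : ℤ}
    (h : HOrd p g n) {t : CoordFrac F} (ht : Unif p t) : HU p (g / t ^ n) := by
  obtain ⟨t', ht', h⟩ := h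
  obtain ⟨u, c, hc, hu, rfl⟩ := ht.exists_mul hC ht'
  have := h.mul ((hu.hU hc).zpow n)
  have hu0 := zpow_ne_zero n (hu.ne_zero hc)
  have ht0 := zpow_ne_zero n (ht.ne_zero hC)
  rw [mul_zpow] at this
  convert this using 1
  field_simp

theorem HOrd.ne_zero {p : Curve wt F} {g : CoordFrac F} {n : ℤ}
    (h : HOrd p g n) : g ≠ 0 := by
  obtain ⟨t', ht', h⟩ := h
  rintro rfl
  exact h.ne_zero (zero_div _)

theorem HOrd.mul (hC : NiceCurve wt F) {p : Curve wt F} {f g : CoordFrac F} {m n : ℤ}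
    (hf : HOrd p f m) (hg : HOrd p g n) : HOrd p (f * g) (m + n) := by
  obtain ⟨t, ht, hf⟩ := hf
  refine ⟨t, ht, ?_⟩
  rw [zpow_add₀ (ht.ne_zero hC), ← div_mul_div_comm]
  exact hf.mul (hg.of_unif hC ht)

theorem HOrd.inv {p : Curve wt F} {f : CoordFrac F} {m : ℤ}
    (hf : HOrd p f m) : HOrd p f⁻¹ (-m) := by
  obtain ⟨t, ht, hf⟩ := hf
  refine ⟨t, ht, ?_⟩
  rw [zpow_neg, ← inv_div_inv, inv_inv, inv_inv, ← inv_div]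
  exact hf.inv

theorem HOrd.div (hC : NiceCurve wt F) {p : Curve wt F} {f g : CoordFrac F} {m n : ℤ}
    (hf : HOrd p f m) (hg : HOrd p g n) : HOrd p (f / g) (m - n) := by
  rw [div_eq_mul_inv, sub_eq_add_neg]
  exact hf.mul hC hg.inv

theorem HU.hOrd (hC : NiceCurve wt F) {p : Curve wt F} {f : CoordFrac F} (h : HU p f) :
    HOrd p f 0 := by
  obtain ⟨t, ht⟩ := hC.exists_unif p
  exact ⟨t, ht, by simpa⟩

theorem HOrd.hU (hC : NiceCurve wt F) {p : Curve wt F} {f : CoordFrac F} (h : HOrd p f 0) :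
    HU p f := by
  obtain ⟨t, ht⟩ := hC.exists_unif p
  simpa using h.of_unif hC ht

theorem HOrd.pow (hC : NiceCurve wt F) {p : Curve wt F} {f : CoordFrac F} {m : ℤ}
    (hf : HOrd p f m) (n : ℕ) : HOrd p (f ^ n) (n * m) := by
  induction n with
  | zero => simpa using ((hasValue_one p).hU one_ne_zero).hOrd hC
  | succ n ih =>
    rw [pow_succ]
    convert ih.mul hC hf using 1
    push_cast; ring

theorem Unif.hOrd (hC : NiceCurve wt F) {p : Curve wt F} {t : CoordFrac F} (ht : Unif p t) :
    HOrd p t 1 :=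
  ⟨t, ht, by simpa [ht.ne_zero hC] using (hasValue_one p).hU one_ne_zero⟩

theorem HOrd.zpow (hC : NiceCurve wt F) {p : Curve wt F} {f : CoordFrac F} {m : ℤ}
    (hf : HOrd p f m) (n : ℤ) : HOrd p (f ^ n) (n * m) := by
  cases n with
  | ofNat n => simpa using hf.pow hC n
  | negSucc n =>
    rw [zpow_negSucc]
    convert (hf.pow hC (n + 1)).inv using 1
    rw [Int.negSucc_eq]; push_cast; ring

/-- A regular function has nonnegative order. -/
theorem HOrd.nonneg_of_hasValue {p : Curve wt F} {g : CoordFrac F} {n : ℤ}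
    (h : HOrd p g n) {c : ℂ} (hv : HasValue p g c) : 0 ≤ n := by
  by_contra! hn
  obtain ⟨t, ht, h⟩ := h
  obtain ⟨m, rfl⟩ : ∃ m : ℕ, n = -(m + 1 : ℕ) := ⟨(-n - 1).toNat, by omega⟩
  rw [zpow_neg, div_inv_eq_mul, zpow_natCast] at h
  have := hv.mul (ht.1.pow (m + 1))
  rw [zero_pow (by omega), mul_zero] at this
  exact h.not_hasValue_zero this

/-- Two orders `m, n` of one function give `1` the orders `m - n` and `n - m`, and a regular
function has no negative order. -/
theorem HOrd.unique (hC : NiceCurve wt F) {p : Curve wt F} {g : CoordFrac F} {m n : ℤ}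
    (hm : HOrd p g m) (hn : HOrd p g n) : m = n := by
  have h1 : HOrd p (1 : CoordFrac F) (m - n) := by
    have := hm.div hC hn
    rwa [div_self hm.ne_zero] at this
  have h2 := h1.inv
  rw [inv_one] at h2
  have := h1.nonneg_of_hasValue (hasValue_one p)
  have := h2.nonneg_of_hasValue (hasValue_one p)
  omega

theorem HOrd.pos_of_hasValue (hC : NiceCurve wt F) {p : Curve wt F} {g : CoordFrac F} {n : ℤ}
    (h : HOrd p g n) (hv : HasValue p g 0) : 0 < n := by
  refine (h.nonneg_of_hasValue hv).lt_of_ne ?_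
  rintro rfl
  exact (h.hU hC).not_hasValue_zero hv

theorem HOrd.mem_zpow (hC : NiceCurve wt F) {p : Curve wt F} {g : CoordFrac F} {n : ℤ}
    (h : HOrd p g n) (hg : g ∈ functionField wt F) {t : CoordFrac F} (ht : Unif p t) :
    ∃ u c, c ≠ 0 ∧ HasValue p u c ∧ g = u * t ^ n := by
  have ht0 := ht.ne_zero hC
  have h1 := h.of_unif hC ht
  have hinv : t⁻¹ ∈ functionField wt F := by
    obtain ⟨P, Q, hPQ, hu, e⟩ := ht.1.mem
    refine ⟨Q, P, ⟨hPQ.imp fun d h => h.symm, ?_, ?_⟩⟩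
    · rw [← e]; exact (mul_ne_zero ht0 hu.ne_zero).isUnit
    · rw [← e]; field_simp
  have h2 : g / t ^ n ∈ functionField wt F := by
    rw [div_eq_mul_inv]
    refine mul_mem hg ?_
    cases n with
    | ofNat n => simpa using pow_mem hinv n
    | negSucc n => rw [zpow_negSucc, inv_inv]; exact pow_mem ht.1.mem _
  obtain ⟨c, hc, hv⟩ := h1.exists_hasValue hC h2
  exact ⟨_, c, hc, hv, (div_mul_cancel₀ _ (zpow_ne_zero _ ht0)).symm⟩

theorem HOrd.exists_hasValue (hC : NiceCurve wt F) {p : Curve wt F} {g : CoordFrac F} {n : ℤ}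
    (h : HOrd p g n) (hg : g ∈ functionField wt F) (hn : 0 ≤ n) : ∃ c, HasValue p g c := by
  obtain ⟨t, ht⟩ := hC.exists_unif p
  obtain ⟨u, c, hc, hu, rfl⟩ := h.mem_zpow hC hg ht
  lift n to ℕ using hn
  rw [zpow_natCast]
  exact ⟨_, hu.mul (ht.1.pow n)⟩

theorem hasOrder_iff (hC : NiceCurve wt F) {p : Curve wt F} {f : functionField wt F} {n : ℤ} :
    HasOrder p f n ↔ HOrd p (f : CoordFrac F) n := by
  have key : ∀ {a u t : CoordFrac F}, t ≠ 0 →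
      (a * t ^ (-n).toNat = u * t ^ n.toNat ↔ a = u * t ^ n) := by
    intro a u t ht
    have : t ^ n = t ^ n.toNat / t ^ (-n).toNat := by
      rw [← zpow_natCast, ← zpow_natCast, ← zpow_sub₀ ht]
      congr 1
      omega
    rw [this, mul_div_assoc', eq_div_iff (pow_ne_zero _ ht)]
  constructor
  · rintro ⟨t, u, ht, hu, e⟩
    rw [isUniformizer_iff] at ht
    obtain ⟨c, hc, hu⟩ := isUnitAt_iff.1 hu
    have e' := (key (ht.ne_zero hC)).1 (congrArg Subtype.val e)
    exact ⟨t, ht, by rw [e', mul_div_cancel_right₀ _ (zpow_ne_zero _ (ht.ne_zero hC))]; exact hu.hU hc⟩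
  · intro h
    obtain ⟨t, ht⟩ := hC.exists_unif p
    obtain ⟨u, c, hc, hu, e⟩ := h.mem_zpow hC f.2 ht
    exact ⟨⟨t, ht.1.mem⟩, ⟨u, hu.mem⟩, isUniformizer_iff.2 ht, isUnitAt_iff.2 ⟨c, hc, hu⟩,
      Subtype.ext ((key (ht.ne_zero hC)).2 e)⟩

/-- Every nonzero regular function at `p` has an order. -/
theorem HasValue.exists_hOrd (hC : NiceCurve wt F) {p : Curve wt F} {g : CoordFrac F} {c : ℂ}
    (hg : HasValue p g c) (hg0 : g ≠ 0) : ∃ n, HOrd p g n := by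
  obtain ⟨t, ht⟩ := hC.exists_unif p
  have ht0 := ht.ne_zero hC
  by_contra! hne
  -- Without an order, every `g / t ^ n` is regular with value zero, so `g` is divisible by all
  -- powers of `t`.
  have hreg : ∀ n : ℕ, ∃ c, HasValue p (g / t ^ n) c := by
    intro n
    induction n with
    | zero => exact ⟨c, by simpa⟩
    | succ n ih =>
      obtain ⟨c, hc⟩ := ih
      have hc0 : c = 0 := by
        by_contra hc0
        exact hne n ⟨t, ht, by simpa using hc.hU hc0⟩
      subst hc0
      obtain ⟨h, d, hd, e⟩ := ht.2 _ hc
      refine ⟨d, ?_⟩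
      rwa [pow_succ, ← div_div, e, mul_div_cancel_right₀ _ ht0]
  obtain ⟨j, hj2, hw, hj⟩ := hC.exists_chart p
  -- `J n` consists of the polynomials whose dehomogenization is a regular multiple of `g / t ^ n`.
  -- The chain increases, so it is stationary by noetherianity.
  let J : ℕ →o Ideal (MvPolynomial (Fin 3) ℂ) :=
    { toFun := fun n =>
        { carrier := {P | ∃ h c, HasValue p h c ∧ dehom wt F j P = g / t ^ n * h}
          zero_mem' := ⟨0, 0, hasValue_zero p, by simp⟩
          add_mem' := by
            rintro P Q ⟨h, c, hh, e⟩ ⟨h', c', hh', e'⟩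
            exact ⟨_, _, hh.add hh', by rw [map_add, e, e', mul_add]⟩
          smul_mem' := by
            rintro A P ⟨h, c, hh, e⟩
            exact ⟨_, _, (hasValue_dehom hj hw A).mul hh, by
              rw [smul_eq_mul, map_mul, e]; ring⟩ }
      monotone' := by
        refine monotone_nat_of_le_succ fun n P => ?_
        rintro ⟨h, c, hh, e⟩
        exact ⟨_, _, ht.1.mul hh, by rw [e]; field_simp; ring⟩ }
  obtain ⟨n, hn⟩ := monotone_stabilizes_iff_noetherian.2
    (inferInstance : IsNoetherian (MvPolynomial (Fin 3) ℂ) (MvPolynomial (Fin 3) ℂ)) J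
  obtain ⟨c', hc'⟩ := hreg (n + 1)
  obtain ⟨P, Q, e, hQ, -⟩ := hc'.exists_dehom hj
  have hQ' := hasValue_dehom hj hw Q
  -- Write `g / t ^ (n + 1) = P / Q` with `Q` a unit at `p`. Then `P ∈ J (n + 1) = J n`, which makes
  -- `Q` a regular multiple of `t`, contrary to `Q` being a unit.
  have hP : P ∈ J (n + 1) := ⟨_, _, hQ', by rw [e, div_mul_cancel₀ _ (hQ'.ne_zero hQ)]⟩
  rw [← hn (n + 1) (Nat.le_succ n)] at hP
  obtain ⟨h, d, hd, e'⟩ := hP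
  have h1 : dehom wt F j Q = t * h := by
    rw [eq_div_iff (hQ'.ne_zero hQ), e', pow_succ] at e
    field_simp at e
    exact e
  rw [h1] at hQ'
  have := hQ'.unique (ht.1.mul hd)
  simp at this
  exact hQ this

theorem exists_hOrd_toFrac (hC : NiceCurve wt F) (p : Curve wt F) {P : MvPolynomial (Fin 3) ℂ} {d : ℕ}
    (hP : P.IsWeightedHomogeneous wt d) (h0 : toFrac F P ≠ 0) : ∃ n, HOrd p (toFrac F P) n := by
  obtain ⟨j, hj2, hw, hj⟩ := hC.exists_chart p
  have hX : (X j ^ d : MvPolynomial (Fin 3) ℂ).IsWeightedHomogeneous wt d := by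
    simpa [hw] using (isWeightedHomogeneous_X ℂ wt j).pow d
  have hXp : eval p.rep (X j ^ d) ≠ 0 := by simp [hj]
  have hX0 := toFrac_ne_zero_of_eval p.eval_rep hXp
  obtain ⟨n, hn⟩ := (hasValue_div hP hX hXp).exists_hOrd hC (div_ne_zero h0 hX0)
  refine ⟨n + 0, ?_⟩
  have := hn.mul hC ((HU.toFrac hX hXp).hOrd hC)
  rwa [div_mul_cancel₀ _ hX0] at this

theorem HOrd.toFrac_nonneg (hC : NiceCurve wt F) {p : Curve wt F} {P : MvPolynomial (Fin 3) ℂ} {d : ℕ}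
    (hP : P.IsWeightedHomogeneous wt d) {n : ℤ} (h : HOrd p (toFrac F P) n) :
    0 ≤ n ∧ (eval p.rep P = 0 → 0 < n) := by
  obtain ⟨j, hj2, hw, hj⟩ := hC.exists_chart p
  have hX : (X j ^ d : MvPolynomial (Fin 3) ℂ).IsWeightedHomogeneous wt d := by
    simpa [hw] using (isWeightedHomogeneous_X ℂ wt j).pow d
  have hXp : eval p.rep (X j ^ d) ≠ 0 := by simp [hj]
  have h1 := h.div hC ((HU.toFrac hX hXp).hOrd hC)
  rw [sub_zero] at h1
  refine ⟨h1.nonneg_of_hasValue (hasValue_div hP hX hXp), fun h0 => ?_⟩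
  refine h1.pos_of_hasValue hC ?_
  simpa [h0] using hasValue_div hP hX hXp

end Orders

/-! ### Homogeneous functions without poles are polynomials -/

section Hartogs

theorem coe_decompose_weighted {σ : Type*} (wt : σ → ℕ) (D : MvPolynomial σ ℂ) (m : ℕ) :
    letI := weightedGradedAlgebra ℂ wt
    (DirectSum.decompose (weightedHomogeneousSubmodule ℂ wt) D m : MvPolynomial σ ℂ) =
      weightedHomogeneousComponent wt m D :=
  weightedDecomposition.decompose'_apply ℂ wt D m

theorem weightedHomogeneousComponent_mul_right {σ : Type*} {wt : σ → ℕ} {B : MvPolynomial σ ℂ} {b : ℕ}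
    (hB : B.IsWeightedHomogeneous wt b) (A : MvPolynomial σ ℂ) (n : ℕ) :
    weightedHomogeneousComponent wt (n + b) (A * B) = weightedHomogeneousComponent wt n A * B := by
  classical
  let := weightedGradedAlgebra ℂ wt
  have := DirectSum.coe_decompose_mul_add_of_right_mem (weightedHomogeneousSubmodule ℂ wt) (i := n)
    (a := A) ((mem_weightedHomogeneousSubmodule ℂ wt b B).2 hB)
  rwa [coe_decompose_weighted, coe_decompose_weighted] at this

theorem weightedHomogeneousComponent_mul_right_of_lt {σ : Type*} {wt : σ → ℕ} {B : MvPolynomial σ ℂ}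
    {b : ℕ} (hB : B.IsWeightedHomogeneous wt b) (A : MvPolynomial σ ℂ) {n : ℕ} (hn : n < b) :
    weightedHomogeneousComponent wt n (A * B) = 0 := by
  classical
  let := weightedGradedAlgebra ℂ wt
  have := DirectSum.coe_decompose_mul_of_right_mem_of_not_le (weightedHomogeneousSubmodule ℂ wt)
    (n := n) (a := A) ((mem_weightedHomogeneousSubmodule ℂ wt b B).2 hB) (by omega)
  rwa [coe_decompose_weighted] at this

theorem dvd_weightedHomogeneousComponent {σ : Type*} {wt : σ → ℕ} {F D : MvPolynomial σ ℂ} {N : ℕ}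
    (hF : F.IsWeightedHomogeneous wt N) (h : F ∣ D) (n : ℕ) :
    F ∣ weightedHomogeneousComponent wt n D := by
  obtain ⟨R, rfl⟩ := h
  rw [mul_comm]
  by_cases hn : n < N
  · rw [weightedHomogeneousComponent_mul_right_of_lt hF _ hn]
    exact dvd_zero _
  · obtain ⟨m, rfl⟩ := Nat.exists_eq_add_of_le' (not_lt.1 hn)
    rw [weightedHomogeneousComponent_mul_right hF]
    exact dvd_mul_left _ _

/-- Splits `e` into its restriction to the axis `X 0 = X 1 = 0` and a remainder in the ideal `(X 0,
X 1)`. -/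
theorem exists_restrict_axis (e : MvPolynomial (Fin 3) ℂ) :
    ∃ e₁ e₂, e = aeval ![0, 0, X 2] e + X 0 * e₁ + X 1 * e₂ := by
  induction e using MvPolynomial.induction_on with
  | C a => exact ⟨0, 0, by simp⟩
  | add P Q hP hQ =>
    obtain ⟨a, b, h⟩ := hP
    obtain ⟨a', b', h'⟩ := hQ
    exact ⟨a + a', b + b', by rw [map_add]; linear_combination h + h'⟩
  | mul_X P i hP =>
    obtain ⟨a, b, h⟩ := hP
    rw [map_mul, aeval_X]
    fin_cases i
    · exact ⟨P, 0, by simp; ring⟩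
    · exact ⟨0, P, by simp; ring⟩
    · exact ⟨a * X 2, b * X 2, by
        change P * X 2 = aeval _ P * X 2 + _ + _
        linear_combination X 2 * h⟩

variable {wt : Fin 3 → ℕ} {F : MvPolynomial (Fin 3) ℂ} [hF : Fact (Prime F)]

theorem NiceCurve.aeval_axis_ne_zero (hC : NiceCurve wt F) :
    (aeval ![0, 0, X 2] F : MvPolynomial (Fin 3) ℂ) ≠ 0 := by
  intro h
  have h1 := congrArg (eval ![0, 0, 1]) h
  have h2 : eval ![0, 0, 1] (aeval ![0, 0, X 2] F : MvPolynomial (Fin 3) ℂ) = eval ![0, 0, 1] F := by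
    have : (eval ![0, 0, 1]).comp (aeval ![0, 0, X 2] : MvPolynomial (Fin 3) ℂ →ₐ[ℂ]
        MvPolynomial (Fin 3) ℂ).toRingHom = eval ![0, 0, (1 : ℂ)] := by
      apply MvPolynomial.ringHom_ext
      · intro r; simp
      · intro i; fin_cases i <;> simp
    exact congrArg (fun f => f F) this
  rw [h2, map_zero] at h1
  exact one_ne_zero (hC.eq_zero_of_top 1 h1)

/-- `X 0, X 1` is a regular sequence on the coordinate ring, because `F` does not vanish on the axis
`X 0 = X 1 = 0`. This depth property is what makes fractions without poles polynomials. -/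
theorem NiceCurve.regular_step (hC : NiceCurve wt F) {a b : MvPolynomial (Fin 3) ℂ} {M : ℕ}
    (h : F ∣ a * X 1 ^ M - b * X 0) : ∃ c, F ∣ a - c * X 0 := by
  induction M generalizing b with
  | zero => exact ⟨b, by simpa using h⟩
  | succ M ih =>
    obtain ⟨e, he⟩ := h
    obtain ⟨e₁, e₂, h12⟩ := exists_restrict_axis e
    have h0 := congrArg (aeval ![0, 0, X 2] : MvPolynomial (Fin 3) ℂ →ₐ[ℂ] MvPolynomial (Fin 3) ℂ) he
    simp only [map_sub, map_mul, map_pow, aeval_X, Matrix.cons_val_one, Matrix.cons_val_zero, mul_zero,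
      zero_pow (Nat.succ_ne_zero M), sub_zero] at h0
    -- Restricting to the axis kills the left-hand side, so the cofactor `e` lies in `(X 0, X 1)`.
    -- Absorbing `F * e₂` into `a` then leaves a multiple of `X 0`.
    rw [(mul_eq_zero.1 h0.symm).resolve_left hC.aeval_axis_ne_zero, zero_add] at h12
    have hx : (X 0 : MvPolynomial (Fin 3) ℂ) ∣ (a * X 1 ^ M - F * e₂) * X 1 :=
      ⟨b + F * e₁, by rw [h12] at he; linear_combination he⟩
    have hX : Prime (X 0 : MvPolynomial (Fin 3) ℂ) := X_prime
    rcases hX.dvd_or_dvd hx with ⟨c, hc⟩ | ⟨c, hc⟩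
    · exact ih (b := c) ⟨e₂, by linear_combination hc⟩
    · have := congrArg (eval ![0, 1, 0]) hc
      simp at this

theorem NiceCurve.not_dvd_X_zero (hC : NiceCurve wt F) : ¬ F ∣ X 0 := by
  rw [← toFrac_eq_zero_iff_dvd]
  simpa using hC.linear_ne_zero (a := 1) (b := 0) (by simp)

/-- One factor `X 0` is split off at a time; it can be cancelled because it is nonzero modulo the
prime `F`. -/
theorem NiceCurve.regular_pow (hC : NiceCurve wt F) {a b : MvPolynomial (Fin 3) ℂ} {M N : ℕ}
    (h : F ∣ a * X 1 ^ M - b * X 0 ^ N) : ∃ c, F ∣ a - c * X 0 ^ N := by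
  induction N generalizing a with
  | zero => exact ⟨a, by simp⟩
  | succ N ih =>
    obtain ⟨c, e, he⟩ := hC.regular_step (a := a) (M := M) (b := b * X 0 ^ N) (by
      rw [mul_assoc b, ← pow_succ]; exact h)
    obtain ⟨k, hk⟩ := h
    have h1 : F ∣ X 0 * (c * X 1 ^ M - b * X 0 ^ N) :=
      ⟨k - e * X 1 ^ M, by linear_combination hk - X 1 ^ M * he⟩
    obtain ⟨c', k', h'⟩ := ih ((hF.out.dvd_or_dvd h1).resolve_left hC.not_dvd_X_zero)
    exact ⟨c', e + k' * X 0, by linear_combination he + X 0 * h'⟩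

/-- A homogeneous fraction of degree `n` without poles is a homogeneous polynomial. -/
theorem NiceCurve.exists_polynomial (hC : NiceCurve wt F) {A B : MvPolynomial (Fin 3) ℂ} {b n : ℕ}
    (hA : A.IsWeightedHomogeneous wt (n + b)) (hB : B.IsWeightedHomogeneous wt b)
    (hB0 : toFrac F B ≠ 0)
    (h : ∀ p : Curve wt F, ∃ k : ℤ, 0 ≤ k ∧ HOrd p (toFrac F A / toFrac F B) k) :
    ∃ P : MvPolynomial (Fin 3) ℂ, P.IsWeightedHomogeneous wt n ∧
      toFrac F A / toFrac F B = toFrac F P := by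
  obtain ⟨N, hN⟩ := hC.homogeneous
  set g := toFrac F A / toFrac F B with hg
  -- `J` is the ideal of denominators of `g`. Since `g` has no poles, the only zero of `J` is the
  -- origin, and the Nullstellensatz puts powers of `X 0` and `X 1` in `J`.
  let J : Ideal (MvPolynomial (Fin 3) ℂ) :=
    { carrier := {D | ∃ R, g * toFrac F D = toFrac F R}
      zero_mem' := ⟨0, by simp⟩
      add_mem' := by
        rintro D D' ⟨R, h⟩ ⟨R', h'⟩
        exact ⟨R + R', by rw [map_add, map_add, mul_add, h, h']⟩
      smul_mem' := by
        rintro c D ⟨R, h⟩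
        exact ⟨c * R, by rw [smul_eq_mul, map_mul, map_mul, ← h]; ring⟩ }
  have hzero : ∀ v ∈ zeroLocus ℂ J, v = 0 := by
    intro v hv
    by_contra hv0
    have hFv : eval v F = 0 := by
      have : F ∈ J := ⟨0, by rw [toFrac_eq_zero_iff_dvd.2 dvd_rfl, map_zero, mul_zero]⟩
      simpa [coe_aeval_eq_eval] using hv F this
    obtain ⟨k, hk, hord⟩ := h (Curve.mk v ⟨hv0, hFv⟩)
    set p : Curve wt F := Curve.mk v ⟨hv0, hFv⟩
    obtain ⟨j, -, hw, hj⟩ := hC.exists_chart p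
    have hX : (X j ^ n : MvPolynomial (Fin 3) ℂ).IsWeightedHomogeneous wt n := by
      simpa [hw] using (isWeightedHomogeneous_X ℂ wt j).pow n
    have hXp : eval p.rep (X j ^ n) ≠ 0 := by simp [hj]
    have hX0 := toFrac_ne_zero_of_eval p.eval_rep hXp
    have h1 := hord.div hC ((HU.toFrac hX hXp).hOrd hC)
    rw [sub_zero] at h1
    obtain ⟨c, hc⟩ := h1.exists_hasValue hC ⟨A, X j ^ n * B, ⟨n + b, hA, hX.mul hB⟩,
      by rw [map_mul]; exact (mul_ne_zero hX0 hB0).isUnit, by rw [map_mul, hg]; field_simp⟩ hk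
    obtain ⟨d, P, Q, hP, hQ, hQp, e, -⟩ := hc.exists_div
    have hQJ : Q ∈ J := ⟨P * X j ^ n, by
      rw [div_eq_div_iff hX0 (toFrac_ne_zero_of_eval p.eval_rep hQp)] at e
      rw [e, map_mul]⟩
    refine hQp ?_
    rw [Curve.eval_rep_mk hQ]
    simpa [coe_aeval_eq_eval] using hv Q hQJ
  have hrad : ∀ i : Fin 3, X i ∈ J.radical := by
    intro i
    rw [← vanishingIdeal_zeroLocus_eq_radical (K := ℂ)]
    intro v hv
    rw [hzero v hv]
    simp
  obtain ⟨m₀, α, hα⟩ := hrad 0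
  obtain ⟨m₁, β, hβ⟩ := hrad 1
  have hx0 : toFrac F (X 0) ≠ 0 := fun h => hC.not_dvd_X_zero (toFrac_eq_zero_iff_dvd.1 h)
  -- `g = α / X 0 ^ m₀ = β / X 1 ^ m₁` on the curve, and the regular sequence lets `X 0 ^ m₀` be
  -- divided out of `α`.
  obtain ⟨γ, hγ⟩ := hC.regular_pow (a := α) (b := β) (M := m₁) (N := m₀) (by
    rw [← toFrac_eq_iff_dvd, map_mul, map_mul, ← hα, ← hβ]; ring)
  have hgγ : g = toFrac F γ := by
    rw [← toFrac_eq_iff_dvd, ← hα, map_mul, map_pow] at hγ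
    exact mul_right_cancel₀ (pow_ne_zero _ hx0) hγ
  -- `γ` need not be homogeneous; its component of degree `n` represents the same function because
  -- `A` and `B` are homogeneous.
  refine ⟨weightedHomogeneousComponent wt n γ, weightedHomogeneousComponent_isWeightedHomogeneous _ _, ?_⟩
  rw [hg, div_eq_iff hB0, ← map_mul] at hgγ
  have := dvd_weightedHomogeneousComponent hN (toFrac_eq_iff_dvd.1 hgγ) (n + b)
  rw [map_sub, weightedHomogeneousComponent_mul_right hB, hA.weightedHomogeneousComponent_same,
    ← toFrac_eq_iff_dvd, map_mul] at this
  rw [hg, div_eq_iff hB0, this]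

end Hartogs

/-! ### Maps between curves -/

theorem isWeightedHomogeneous_aeval {σ τ : Type*} {wt : σ → ℕ} {wt' : τ → ℕ}
    {ψ : τ → MvPolynomial σ ℂ} (hψ : ∀ i, (ψ i).IsWeightedHomogeneous wt (wt' i))
    {P : MvPolynomial τ ℂ} {d : ℕ} (hP : P.IsWeightedHomogeneous wt' d) :
    (aeval ψ P).IsWeightedHomogeneous wt d := by
  induction hP using IsWeightedHomogeneous.induction_on with
  | zero => simpa using isWeightedHomogeneous_zero ℂ wt d
  | add p q _ _ hp hq => rw [map_add]; exact hp.add hq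
  | monomial n r h =>
    rw [aeval_monomial, MvPolynomial.algebraMap_eq]
    refine IsWeightedHomogeneous.C_mul ?_ r
    rw [← h, Finsupp.weight_apply, Finsupp.sum, Finsupp.prod]
    exact IsWeightedHomogeneous.prod _ _ _ fun i _ => (hψ i).pow (n i)

/-- A map of curves given by homogeneous polynomials. -/
structure CurveMap (wt : Fin 3 → ℕ) (F : MvPolynomial (Fin 3) ℂ) (wt' : Fin 3 → ℕ)
    (F' : MvPolynomial (Fin 3) ℂ) where
  /-- the polynomials -/
  poly : Fin 3 → MvPolynomial (Fin 3) ℂ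
  /-- the map on points -/
  toFun : Curve wt F → Curve wt' F'
  homogeneous : ∀ i, (poly i).IsWeightedHomogeneous wt (wt' i)
  rep : ∀ q, ∃ c : ℂ, c ≠ 0 ∧ ∀ i, eval q.rep (poly i) = c ^ wt' i * (toFun q).rep i
  dvd_iff : ∀ P, F' ∣ P ↔ F ∣ aeval poly P

namespace CurveMap

variable {wt wt' : Fin 3 → ℕ} {F F' : MvPolynomial (Fin 3) ℂ}

theorem eval_rep (m : CurveMap wt F wt' F') (q : Curve wt F) : ∃ c : ℂ, c ≠ 0 ∧
    ∀ (P : MvPolynomial (Fin 3) ℂ) (d : ℕ), P.IsWeightedHomogeneous wt' d →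
      eval q.rep (aeval m.poly P) = c ^ d * eval (m.toFun q).rep P := by
  obtain ⟨c, hc, h⟩ := m.rep q
  refine ⟨c, hc, fun P d hP => ?_⟩
  rw [← eval_smul_of_isWeightedHomogeneous hP, ← funext h]
  have : (eval q.rep).comp (aeval m.poly : MvPolynomial (Fin 3) ℂ →ₐ[ℂ]
      MvPolynomial (Fin 3) ℂ).toRingHom = eval (fun i => eval q.rep (m.poly i)) := by
    apply MvPolynomial.ringHom_ext
    · intro r; simp
    · intro i; simp
  exact congrArg (fun f => f P) this

/-- The induced map of homogeneous coordinate rings. -/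
def quotientMap (m : CurveMap wt F wt' F') :
    MvPolynomial (Fin 3) ℂ ⧸ Ideal.span {F'} →+* MvPolynomial (Fin 3) ℂ ⧸ Ideal.span {F} :=
  Ideal.quotientMap _ (aeval m.poly : MvPolynomial (Fin 3) ℂ →ₐ[ℂ] MvPolynomial (Fin 3) ℂ).toRingHom
    (by
      rw [Ideal.span_le, Set.singleton_subset_iff]
      exact Ideal.mem_span_singleton.2 ((m.dvd_iff F').1 dvd_rfl))

theorem quotientMap_injective (m : CurveMap wt F wt' F') : Function.Injective m.quotientMap := by
  refine Ideal.quotientMap_injective' fun P hP => ?_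
  rw [Ideal.mem_comap, Ideal.mem_span_singleton] at hP
  exact Ideal.mem_span_singleton.2 ((m.dvd_iff P).2 hP)

variable [hF : Fact (Prime F)] [hF' : Fact (Prime F')]

/-- The pull-back of rational functions. -/
def pull (m : CurveMap wt F wt' F') : CoordFrac F' →+* CoordFrac F :=
  IsFractionRing.map m.quotientMap_injective

theorem pull_toFrac (m : CurveMap wt F wt' F') (P : MvPolynomial (Fin 3) ℂ) :
    m.pull (toFrac F' P) = toFrac F (aeval m.poly P) :=
  IsLocalization.map_eq (S := CoordFrac F') (Q := CoordFrac F)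
    (M := nonZeroDivisors (MvPolynomial (Fin 3) ℂ ⧸ Ideal.span {F'}))
    (T := nonZeroDivisors (MvPolynomial (Fin 3) ℂ ⧸ Ideal.span {F}))
    (nonZeroDivisors_le_comap_nonZeroDivisors_of_injective _ m.quotientMap_injective)
    (Ideal.Quotient.mk _ P)

theorem pull_algebraMap (m : CurveMap wt F wt' F') (c : ℂ) :
    m.pull (algebraMap ℂ _ c) = algebraMap ℂ _ c := by
  have : ∀ F, algebraMap ℂ (CoordFrac F) c = toFrac F (C c) := fun F => by
    rw [← MvPolynomial.algebraMap_eq, AlgHom.commutes]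
  rw [this, this, pull_toFrac]
  simp

theorem hasValue_pull (m : CurveMap wt F wt' F') {q : Curve wt F} {g : CoordFrac F'} {c : ℂ}
    (h : HasValue (m.toFun q) g c) : HasValue q (m.pull g) c := by
  obtain ⟨d, P, Q, hP, hQ, hQp, rfl, hv⟩ := h.exists_div
  obtain ⟨a, ha, he⟩ := m.eval_rep q
  have hQ' : eval q.rep (aeval m.poly Q) ≠ 0 := by
    rw [he Q d hQ]; exact mul_ne_zero (pow_ne_zero _ ha) hQp
  convert hasValue_div (isWeightedHomogeneous_aeval m.homogeneous hP)
    (isWeightedHomogeneous_aeval m.homogeneous hQ) hQ' using 1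
  · rw [map_div₀, pull_toFrac, pull_toFrac]
  · rw [eq_div_iff hQ', he Q d hQ, he P d hP, hv]; ring

theorem hU_pull (m : CurveMap wt F wt' F') {q : Curve wt F} {g : CoordFrac F'}
    (h : HU (m.toFun q) g) : HU q (m.pull g) := by
  obtain ⟨P, Q, a, b, hP, hQ, hPp, hQp, rfl⟩ := h
  obtain ⟨c, hc, he⟩ := m.eval_rep q
  exact ⟨_, _, a, b, isWeightedHomogeneous_aeval m.homogeneous hP,
    isWeightedHomogeneous_aeval m.homogeneous hQ,
    by rw [he P a hP]; exact mul_ne_zero (pow_ne_zero _ hc) hPp,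
    by rw [he Q b hQ]; exact mul_ne_zero (pow_ne_zero _ hc) hQp,
    by rw [map_div₀, pull_toFrac, pull_toFrac]⟩

/-- Writing `g` as a unit times `t ^ n`, the order is multiplied by the order `e` of the pulled-back
uniformizer, the ramification index. -/
theorem hOrd_pull (m : CurveMap wt F wt' F') (hC : NiceCurve wt F) (hC' : NiceCurve wt' F')
    {q : Curve wt F} {t : CoordFrac F'}
    (ht : Unif (m.toFun q) t) {e : ℤ} (he : HOrd q (m.pull t) e) {g : CoordFrac F'} {n : ℤ}
    (h : HOrd (m.toFun q) g n) : HOrd q (m.pull g) (e * n) := by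
  have h1 := (m.hU_pull (h.of_unif hC' ht)).hOrd hC
  have h2 := h1.mul hC (he.zpow hC n)
  rw [map_div₀, map_zpow₀, div_mul_cancel₀ _ (zpow_ne_zero _ he.ne_zero)] at h2
  convert h2 using 1
  ring

theorem pull_mem (m : CurveMap wt F wt' F') {g : CoordFrac F'} (h : g ∈ functionField wt' F') :
    m.pull g ∈ functionField wt F := by
  obtain ⟨P, Q, ⟨d, hP, hQ⟩, hu, e⟩ := h
  refine ⟨aeval m.poly P, aeval m.poly Q, ⟨d, isWeightedHomogeneous_aeval m.homogeneous hP,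
    isWeightedHomogeneous_aeval m.homogeneous hQ⟩, ?_, ?_⟩
  · rw [← pull_toFrac]; exact hu.map _
  · rw [← pull_toFrac, ← pull_toFrac, ← e, map_mul]

end CurveMap

/-! ### The quartic and its quotient are nice curves -/

section Algebra

/-- The binary form `G` has no multiple root. -/
def NoDoubleRoot (G : MvPolynomial (Fin 2) ℂ) : Prop :=
  ∀ v : Fin 2 → ℂ, v ≠ 0 → eval v G = 0 → ∃ i, eval v (pderiv i G) ≠ 0

theorem pderiv_two_inXY (S : MvPolynomial (Fin 2) ℂ) : pderiv 2 (inXY S) = 0 := by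
  rw [inXY]
  refine pderiv_eq_zero_of_notMem_vars fun h => ?_
  obtain ⟨i, -, hi⟩ := Finset.mem_image.1 (vars_rename _ _ h)
  fin_cases i <;> simp at hi

theorem pderiv_inXY (S : MvPolynomial (Fin 2) ℂ) (i : Fin 2) :
    pderiv (![0, 1] i : Fin 3) (inXY S) = inXY (pderiv i S) := by
  rw [inXY, pderiv_rename]
  · rfl
  · intro i j h; fin_cases i <;> fin_cases j <;> simp_all

theorem inXY_eq_aeval (S : MvPolynomial (Fin 2) ℂ) : inXY S = aeval ![X 0, X 1] S := by
  rw [inXY, rename_eq_aeval]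
  congr 2
  funext i
  fin_cases i <;> rfl

theorem isWeightedHomogeneous_inXY {S : MvPolynomial (Fin 2) ℂ} {d : ℕ} (hS : S.IsHomogeneous d)
    {wt : Fin 3 → ℕ} (h0 : wt 0 = 1) (h1 : wt 1 = 1) : (inXY S).IsWeightedHomogeneous wt d := by
  rw [inXY_eq_aeval]
  refine isWeightedHomogeneous_aeval (wt' := 1) (fun i => ?_) hS
  fin_cases i
  · simpa [h0] using isWeightedHomogeneous_X ℂ wt 0
  · simpa [h1] using isWeightedHomogeneous_X ℂ wt 1

theorem eval_smul_of_isHomogeneous {σ : Type*} {S : MvPolynomial σ ℂ} {d : ℕ}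
    (hS : S.IsHomogeneous d) (c : ℂ) (v : σ → ℂ) : eval (fun i => c * v i) S = c ^ d * eval v S := by
  simpa using eval_smul_of_isWeightedHomogeneous hS c v

theorem eval_zero_of_isHomogeneous {S : MvPolynomial (Fin 2) ℂ} {d : ℕ}
    (hS : S.IsHomogeneous d) (hd : d ≠ 0) : eval ![0, 0] S = 0 := by
  have := eval_smul_of_isHomogeneous hS 0 ![0, 0]
  have e : (fun i => 0 * (![0, 0] : Fin 2 → ℂ) i) = ![0, 0] := by
    funext i; fin_cases i <;> simp
  rwa [zero_pow hd, zero_mul, e] at this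

/-- If `G` had no nontrivial zero, its restrictions to the lines `(t, 1)` and `(1, t)` would be
polynomials without roots, hence constant. Then `G(1/2, 1) = G(1, 1) = G(1, 2)`, whereas homogeneity
gives `G(1, 2) = 2 ^ d G(1/2, 1)`. -/
theorem exists_binary_root {G : MvPolynomial (Fin 2) ℂ} {d : ℕ} (hG : G.IsHomogeneous d)
    (hd : d ≠ 0) : ∃ v : Fin 2 → ℂ, v ≠ 0 ∧ eval v G = 0 := by
  by_contra! h
  have key : ∀ w : Fin 2 → Polynomial ℂ, (∀ t, (fun i => (w i).eval t) ≠ 0) →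
      ∀ s t, eval (fun i => (w i).eval s) G = eval (fun i => (w i).eval t) G := by
    intro w hw
    have he : ∀ t, (aeval w G).eval t = eval (fun i => (w i).eval t) G := by
      intro t
      have : (Polynomial.evalRingHom t).comp (aeval w : MvPolynomial (Fin 2) ℂ →ₐ[ℂ]
          Polynomial ℂ).toRingHom = eval (fun i => (w i).eval t) := by
        apply MvPolynomial.ringHom_ext
        · intro r; simp
        · intro i; simp
      exact congrArg (fun f => f G) this
    have hdeg : (aeval w G).degree ≤ 0 := by
      by_contra hdeg
      obtain ⟨t, ht⟩ := IsAlgClosed.exists_root (aeval w G) (ne_of_gt (not_le.1 hdeg))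
      exact h _ (hw t) ((he t).symm.trans ht)
    intro s t
    rw [← he, ← he, Polynomial.eq_C_of_degree_le_zero hdeg]
    simp
  have h1 := key ![Polynomial.X, 1] (fun t h => by simpa using congrFun h 1) 1 (1 / 2)
  have h2 := key ![1, Polynomial.X] (fun t h => by simpa using congrFun h 0) 1 2
  have h3 := eval_smul_of_isHomogeneous hG 2 ![(1 / 2 : ℂ), 1]
  have e1 : (fun i => ((![Polynomial.X, 1] : Fin 2 → Polynomial ℂ) i).eval 1) = ![1, 1] := by
    funext i; fin_cases i <;> simp
  have e2 : (fun i => ((![Polynomial.X, 1] : Fin 2 → Polynomial ℂ) i).eval (1 / 2)) = ![1 / 2, 1] := by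
    funext i; fin_cases i <;> simp
  have e3 : (fun i => ((![1, Polynomial.X] : Fin 2 → Polynomial ℂ) i).eval 1) = ![1, 1] := by
    funext i; fin_cases i <;> simp
  have e4 : (fun i => ((![1, Polynomial.X] : Fin 2 → Polynomial ℂ) i).eval 2) = ![1, 2] := by
    funext i; fin_cases i <;> simp
  have e5 : (fun i => (2 : ℂ) * (![1 / 2, 1] : Fin 2 → ℂ) i) = ![1, 2] := by
    funext i; fin_cases i <;> simp
  rw [e1, e2] at h1
  rw [e3, e4] at h2
  rw [e5, ← h2, ← h1] at h3
  have h4 : ((2 : ℂ) ^ d - 1) * eval ![1, 1] G = 0 := by linear_combination -h3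
  rcases mul_eq_zero.1 h4 with h5 | h5
  · have : (2 ^ d : ℕ) = 1 := by exact_mod_cast (sub_eq_zero.1 h5)
    simp [hd] at this
  · exact h _ (fun h => by simpa using congrFun h 0) h5

/-- Every root of a square is multiple, and a form of positive degree has a root. -/
theorem NoDoubleRoot.not_sq {G : MvPolynomial (Fin 2) ℂ} {d : ℕ} (hG : G.IsHomogeneous d)
    (hd : d ≠ 0) (h : NoDoubleRoot G) (a : MvPolynomial (Fin 2) ℂ) : a ^ 2 ≠ G := by
  rintro rfl
  obtain ⟨v, hv, h0⟩ := exists_binary_root hG hd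
  obtain ⟨i, hi⟩ := h v hv h0
  rw [map_pow] at h0
  simp [pow_eq_zero_iff two_ne_zero |>.1 h0, Derivation.leibniz_pow] at hi

/-- A bielliptic quartic: the forms `T` and `S² - T` have no multiple roots. -/
structure Biell (S T : MvPolynomial (Fin 2) ℂ) : Prop where
  homS : S.IsHomogeneous 2
  homT : T.IsHomogeneous 4
  ndrT : NoDoubleRoot T
  ndrD : NoDoubleRoot (S ^ 2 - T)

variable {S T : MvPolynomial (Fin 2) ℂ}

theorem Biell.homD (h : Biell S T) : (S ^ 2 - T).IsHomogeneous 4 :=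
  (h.homS.pow 2).sub h.homT

/-- The duality `T ↦ S² - T` is an involution that exchanges the two conditions on multiple roots.
Everything proved for `C` therefore applies to the dual quartic. -/
theorem Biell.swap (h : Biell S T) : Biell S (S ^ 2 - T) :=
  ⟨h.homS, h.homD, h.ndrD, by rw [sub_sub_cancel]; exact h.ndrT⟩

theorem eval_quartic (v : Fin 3 → ℂ) : eval v (quartic S T) =
    (v 2 ^ 2 + eval ![v 0, v 1] S) ^ 2 - eval ![v 0, v 1] T := by
  simp [quartic, eval_inXY]

theorem eval_ellEq (v : Fin 3 → ℂ) : eval v (ellEq S T) =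
    (v 2 + eval ![v 0, v 1] S) ^ 2 - eval ![v 0, v 1] T := by
  simp [ellEq, eval_inXY]

theorem pderiv_two_quartic : pderiv 2 (quartic S T) = 4 * X 2 * (X 2 ^ 2 + inXY S) := by
  simp [quartic, Derivation.leibniz_pow, pderiv_two_inXY]
  ring

theorem pderiv_quartic (i : Fin 2) : pderiv (![0, 1] i : Fin 3) (quartic S T) =
    2 * (X 2 ^ 2 + inXY S) * inXY (pderiv i S) - inXY (pderiv i T) := by
  rw [quartic, map_sub, Derivation.leibniz_pow, map_add, Derivation.leibniz_pow, pderiv_inXY,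
    pderiv_inXY, pderiv_X_of_ne (by fin_cases i <;> simp)]
  simp
  ring

theorem pderiv_two_ellEq : pderiv 2 (ellEq S T) = 2 * (X 2 + inXY S) := by
  simp [ellEq, Derivation.leibniz_pow, pderiv_two_inXY]
  ring

theorem pderiv_ellEq (i : Fin 2) : pderiv (![0, 1] i : Fin 3) (ellEq S T) =
    2 * (X 2 + inXY S) * inXY (pderiv i S) - inXY (pderiv i T) := by
  rw [ellEq, map_sub, Derivation.leibniz_pow, map_add, pderiv_inXY,
    pderiv_inXY, pderiv_X_of_ne (by fin_cases i <;> simp)]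
  simp
  ring

theorem exists_sq (a : ℂ) : ∃ z : ℂ, z ^ 2 = a := IsAlgClosed.exists_pow_nat_eq a two_pos

theorem fin_two_eta (v : Fin 2 → ℂ) : ![v 0, v 1] = v := by
  funext i; fin_cases i <;> rfl

/-- The derivative `F_z = 4z(z² + S)` vanishes at two kinds of points: `z² = -S` over a root of `T`,
and `z = 0` over a root of `S² - T`. At these points nonsingularity is a statement about the
derivatives of the binary forms. -/
theorem Biell.of_isNonsingular (hS : S.IsHomogeneous 2) (hT : T.IsHomogeneous 4)
    (h : IsNonsingular (quartic S T)) : Biell S T := by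
  have key : ∀ (v : Fin 2 → ℂ) (z : ℂ), v ≠ 0 → (z ^ 2 + eval v S) ^ 2 = eval v T →
      z * (z ^ 2 + eval v S) = 0 →
      ∃ i, 2 * (z ^ 2 + eval v S) * eval v (pderiv i S) - eval v (pderiv i T) ≠ 0 := by
    intro v z hv hz h0
    obtain ⟨i, hi⟩ := h ![v 0, v 1, z] (fun e => hv (by
      funext i; fin_cases i
      · exact congrFun e 0
      · exact congrFun e 1)) (by
        rw [eval_quartic]
        simpa [fin_two_eta, sub_eq_zero] using hz)
    have hlast : eval ![v 0, v 1, z] (pderiv 2 (quartic S T)) = 0 := by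
      rw [pderiv_two_quartic]
      simp only [map_mul, map_add, map_pow, eval_X, eval_inXY]
      simp only [Matrix.cons_val, fin_two_eta]
      linear_combination (eval ![v 0, v 1, z] 4) * h0
    have hk : ∀ k : Fin 2, eval ![v 0, v 1, z] (pderiv (![0, 1] k : Fin 3) (quartic S T)) =
        2 * (z ^ 2 + eval v S) * eval v (pderiv k S) - eval v (pderiv k T) := by
      intro k
      rw [pderiv_quartic]
      simp only [map_sub, map_mul, map_add, map_pow, eval_X, eval_inXY]
      simp [fin_two_eta]
    fin_cases i
    · exact ⟨0, by rw [← hk]; exact hi⟩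
    · exact ⟨1, by rw [← hk]; exact hi⟩
    · exact absurd hlast hi
  refine ⟨hS, hT, fun v hv h0 => ?_, fun v hv h0 => ?_⟩
  · obtain ⟨z, hz⟩ := exists_sq (-eval v S)
    obtain ⟨i, hi⟩ := key v z hv (by rw [hz, h0]; ring) (by rw [hz]; ring)
    exact ⟨i, by simpa [hz] using hi⟩
  · obtain ⟨i, hi⟩ := key v 0 hv (by
      rw [map_sub, map_pow] at h0; linear_combination h0) (by ring)
    refine ⟨i, ?_⟩
    rw [map_sub, Derivation.leibniz_pow]
    simpa [mul_assoc] using hi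

theorem Biell.top_ne (h : Biell S T) : eval ![0, 0] S = 0 ∧ eval ![0, 0] T = 0 :=
  ⟨eval_zero_of_isHomogeneous h.homS two_ne_zero, eval_zero_of_isHomogeneous h.homT four_ne_zero⟩

/-- A singular point has `z = 0` or `z² + S = 0`. It then lies over a multiple root of `S² - T` or
of `T` respectively. -/
theorem Biell.isNonsingular_quartic (h : Biell S T) : IsNonsingular (quartic S T) := by
  intro v hv hF
  rw [eval_quartic] at hF
  have hxy : ![v 0, v 1] ≠ 0 := by
    intro e
    have e0 : v 0 = 0 := congrFun e 0
    have e1 : v 1 = 0 := congrFun e 1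
    rw [e0, e1, h.top_ne.1, h.top_ne.2] at hF
    refine hv (by funext i; fin_cases i; exacts [e0, e1, by simpa using hF])
  by_contra! hne
  have h2 := hne 2
  rw [pderiv_two_quartic] at h2
  have hk : ∀ k : Fin 2, eval v (pderiv (![0, 1] k : Fin 3) (quartic S T)) =
      2 * (v 2 ^ 2 + eval ![v 0, v 1] S) * eval ![v 0, v 1] (pderiv k S) -
        eval ![v 0, v 1] (pderiv k T) := by
    intro k
    rw [pderiv_quartic]
    simp [eval_inXY]
  simp only [map_mul, map_add, map_pow, eval_X, eval_inXY] at h2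
  have h3 : v 2 = 0 ∨ v 2 ^ 2 + eval ![v 0, v 1] S = 0 := by simpa using h2
  rcases h3 with h3 | h3
  · obtain ⟨i, hi⟩ := h.ndrD _ hxy (by rw [map_sub, map_pow]; rw [h3] at hF; linear_combination hF)
    have := hk i
    rw [hne, h3] at this
    apply hi
    rw [map_sub, Derivation.leibniz_pow]
    simp
    linear_combination -this
  · obtain ⟨i, hi⟩ := h.ndrT _ hxy (by rw [h3] at hF; linear_combination -hF)
    have := hk i
    rw [hne, h3] at this
    apply hi
    linear_combination this

theorem Biell.isNonsingular_ellEq (h : Biell S T) : IsNonsingular (ellEq S T) := by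
  intro v hv hF
  rw [eval_ellEq] at hF
  have hxy : ![v 0, v 1] ≠ 0 := by
    intro e
    have e0 : v 0 = 0 := congrFun e 0
    have e1 : v 1 = 0 := congrFun e 1
    rw [e0, e1, h.top_ne.1, h.top_ne.2] at hF
    refine hv (by funext i; fin_cases i; exacts [e0, e1, by simpa using hF])
  by_contra! hne
  have h2 := hne 2
  rw [pderiv_two_ellEq] at h2
  have hk : ∀ k : Fin 2, eval v (pderiv (![0, 1] k : Fin 3) (ellEq S T)) =
      2 * (v 2 + eval ![v 0, v 1] S) * eval ![v 0, v 1] (pderiv k S) -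
        eval ![v 0, v 1] (pderiv k T) := by
    intro k
    rw [pderiv_ellEq]
    simp [eval_inXY]
  simp only [map_mul, map_add, eval_X, eval_inXY] at h2
  have h3 : v 2 + eval ![v 0, v 1] S = 0 := by simpa using h2
  obtain ⟨i, hi⟩ := h.ndrT _ hxy (by rw [h3] at hF; linear_combination -hF)
  have := hk i
  rw [hne, h3] at this
  apply hi
  linear_combination this

/-- Polynomials in `X 0, X 1, X 2` as polynomials in `X 2`. -/
def lastEquiv : MvPolynomial (Fin 3) ℂ ≃ₐ[ℂ] Polynomial (MvPolynomial (Fin 2) ℂ) :=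
  (renameEquiv ℂ (finRotate 3)).trans (finSuccEquiv ℂ 2)

theorem lastEquiv_X : lastEquiv (X 2) = Polynomial.X := by
  have : finRotate 3 2 = 0 := by decide
  simp [lastEquiv, this, finSuccEquiv_X_zero]

theorem lastEquiv_inXY (S : MvPolynomial (Fin 2) ℂ) : lastEquiv (inXY S) = Polynomial.C S := by
  have h0 : finRotate 3 0 = Fin.succ 0 := by decide
  have h1 : finRotate 3 1 = Fin.succ 1 := by decide
  have : lastEquiv.toAlgHom.comp (rename ![0, 1]) =
      (Algebra.ofId (MvPolynomial (Fin 2) ℂ) (Polynomial (MvPolynomial (Fin 2) ℂ))).restrictScalars ℂ := by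
    apply MvPolynomial.algHom_ext
    intro i
    fin_cases i
    · change lastEquiv (rename ![0, 1] (X 0)) = Polynomial.C (X 0)
      rw [← finSuccEquiv_X_succ, ← h0]
      simp [lastEquiv]
    · change lastEquiv (rename ![0, 1] (X 1)) = Polynomial.C (X 1)
      rw [← finSuccEquiv_X_succ, ← h1]
      simp [lastEquiv]
  exact congrArg (fun f => f S) this

/-- As a monic quadratic in `w`, a proper factorization has a linear factor `w + a`. This gives `(S
- a)² = T`, which is impossible. -/
theorem Biell.prime_ellEq (h : Biell S T) : Prime (ellEq S T) := by
  rw [← MulEquiv.prime_iff lastEquiv]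
  refine Irreducible.prime ?_
  have e : lastEquiv (ellEq S T) = (Polynomial.X ^ 2 + (Polynomial.C (2 * S) * Polynomial.X + Polynomial.C (S ^ 2 - T)) :
      Polynomial (MvPolynomial (Fin 2) ℂ)) := by
    simp only [ellEq, map_sub, map_pow, map_add, lastEquiv_X, lastEquiv_inXY, map_mul]
    simp only [map_ofNat]
    ring
  rw [e]
  have hd : (Polynomial.C (2 * S) * Polynomial.X + Polynomial.C (S ^ 2 - T) : Polynomial (MvPolynomial (Fin 2) ℂ)).degree < 2 :=
    lt_of_le_of_lt Polynomial.degree_linear_le (by norm_num)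
  have hm := Polynomial.monic_X_pow_add (n := 2) hd
  have hn : (Polynomial.X ^ 2 + (Polynomial.C (2 * S) * Polynomial.X + Polynomial.C (S ^ 2 - T)) :
      Polynomial (MvPolynomial (Fin 2) ℂ)).natDegree = 2 := by
    rw [Polynomial.natDegree_add_eq_left_of_degree_lt (by rwa [Polynomial.degree_X_pow]), Polynomial.natDegree_X_pow]
  rw [hm.irreducible_iff_natDegree']
  refine ⟨fun h1 => by rw [h1] at hn; simp at hn, ?_⟩
  intro f g hf hg hfg hmem
  rw [hn, Finset.mem_Ioc] at hmem
  have hg1 : g.natDegree = 1 := by omega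
  obtain ⟨a, ha⟩ : ∃ a, g = Polynomial.X + Polynomial.C a := ⟨_, hg.eq_X_add_C hg1⟩
  have h1 := congrArg (Polynomial.eval (-a)) hfg
  rw [ha] at h1
  simp only [Polynomial.eval_mul, Polynomial.eval_add, Polynomial.eval_X, Polynomial.eval_C, neg_add_cancel, mul_zero, Polynomial.eval_pow] at h1
  exact h.ndrT.not_sq h.homT four_ne_zero (S - a) (by linear_combination -h1)

/-- As a monic quartic in `z`, the polynomial is `z⁴ + 2Sz² + (S² - T)`. A linear factor makes `T` a
square. Two quadratic factors have the form `z² ± az + …`; if `a = 0`, then `T` is a square, and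
otherwise the constant terms agree and `S² - T` is a square. -/
theorem Biell.prime_quartic (h : Biell S T) : Prime (quartic S T) := by
  rw [← MulEquiv.prime_iff lastEquiv]
  refine Irreducible.prime ?_
  have e : lastEquiv (quartic S T) = (Polynomial.X ^ 4 + (Polynomial.C (2 * S) * Polynomial.X ^ 2 + Polynomial.C (S ^ 2 - T)) :
      Polynomial (MvPolynomial (Fin 2) ℂ)) := by
    simp only [quartic, map_sub, map_pow, map_add, lastEquiv_X, lastEquiv_inXY, map_mul]
    simp only [map_ofNat]
    ring
  rw [e]
  have hd : (Polynomial.C (2 * S) * Polynomial.X ^ 2 + Polynomial.C (S ^ 2 - T) : Polynomial (MvPolynomial (Fin 2) ℂ)).degree < 4 := by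
    have : (Polynomial.C (2 * S) * Polynomial.X ^ 2 + Polynomial.C (S ^ 2 - T) : Polynomial (MvPolynomial (Fin 2) ℂ)).natDegree ≤ 2 := by
      compute_degree
    exact lt_of_le_of_lt (Polynomial.degree_le_of_natDegree_le this) (by norm_num)
  have hm := Polynomial.monic_X_pow_add (n := 4) hd
  have hn : (Polynomial.X ^ 4 + (Polynomial.C (2 * S) * Polynomial.X ^ 2 + Polynomial.C (S ^ 2 - T)) :
      Polynomial (MvPolynomial (Fin 2) ℂ)).natDegree = 4 := by
    rw [Polynomial.natDegree_add_eq_left_of_degree_lt (by rwa [Polynomial.degree_X_pow]), Polynomial.natDegree_X_pow]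
  rw [hm.irreducible_iff_natDegree']
  refine ⟨fun h1 => by rw [h1] at hn; simp at hn, ?_⟩
  intro f g hf hg hfg hmem
  rw [hn, Finset.mem_Ioc] at hmem
  have hsum : f.natDegree + g.natDegree = 4 := by rw [← hf.natDegree_mul hg, hfg, hn]
  obtain hg1 | hg2 : g.natDegree = 1 ∨ g.natDegree = 2 := by omega
  · obtain ⟨a, ha⟩ : ∃ a, g = Polynomial.X + Polynomial.C a := ⟨_, hg.eq_X_add_C hg1⟩
    have h1 := congrArg (Polynomial.eval (-a)) hfg
    rw [ha] at h1
    simp only [Polynomial.eval_mul, Polynomial.eval_add, Polynomial.eval_X, Polynomial.eval_C, neg_add_cancel, mul_zero, Polynomial.eval_pow] at h1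
    exact h.ndrT.not_sq h.homT four_ne_zero (a ^ 2 + S) (by linear_combination -h1)
  · have hq : ∀ p : Polynomial (MvPolynomial (Fin 2) ℂ), p.Monic → p.natDegree = 2 →
        ∃ a b, p = Polynomial.X ^ 2 + Polynomial.C a * Polynomial.X + Polynomial.C b := by
      intro p hp h2
      refine ⟨p.coeff 1, p.coeff 0, ?_⟩
      conv_lhs => rw [hp.as_sum, h2]
      simp [Finset.sum_range_succ]
      ring
    obtain ⟨a, b, rfl⟩ := hq g hg hg2
    obtain ⟨c, d, rfl⟩ := hq f hf (by omega)
    have h1 : (Polynomial.C (c + a) * Polynomial.X ^ 3 + Polynomial.C (b + d + a * c - 2 * S) * Polynomial.X ^ 2 + Polynomial.C (a * d + b * c) * Polynomial.X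
        + Polynomial.C (b * d - (S ^ 2 - T)) : Polynomial (MvPolynomial (Fin 2) ℂ)) = 0 := by
      simp only [map_add, map_sub, map_mul] at hfg ⊢
      linear_combination hfg
    have hc : ∀ n, (Polynomial.C (c + a) * Polynomial.X ^ 3 + Polynomial.C (b + d + a * c - 2 * S) * Polynomial.X ^ 2 + Polynomial.C (a * d + b * c) * Polynomial.X
        + Polynomial.C (b * d - (S ^ 2 - T)) : Polynomial (MvPolynomial (Fin 2) ℂ)).coeff n = 0 := by
      rw [h1]; simp
    have c3 := hc 3
    have c2 := hc 2
    have c1 := hc 1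
    have c0 := hc 0
    simp only [Polynomial.coeff_add, Polynomial.coeff_C_mul, Polynomial.coeff_X_pow, Polynomial.coeff_X, Polynomial.coeff_C] at c0 c1 c2 c3
    norm_num at c0 c1 c2 c3
    have hca : c = -a := by linear_combination c3
    subst hca
    have h5 : a * (d - b) = 0 := by linear_combination c1
    rcases mul_eq_zero.1 h5 with h6 | h6
    · subst h6
      exact h.ndrT.not_sq h.homT four_ne_zero (b - S) (by linear_combination b * c2 - c0)
    · exact h.ndrD.not_sq h.homD four_ne_zero b (by linear_combination c0 - b * h6)

theorem Biell.niceC (h : Biell S T) : NiceCurve planeWt (quartic S T) where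
  wt_zero := rfl
  wt_one := rfl
  homogeneous := by
    refine ⟨4, ?_⟩
    have hX := isWeightedHomogeneous_X ℂ planeWt 2
    have h1 : (X 2 ^ 2 + inXY S).IsWeightedHomogeneous planeWt 2 :=
      (hX.pow 2).add (isWeightedHomogeneous_inXY h.homS rfl rfl)
    exact (h1.pow 2).sub (isWeightedHomogeneous_inXY h.homT rfl rfl)
  eq_zero_of_top z hz := by
    rw [eval_quartic] at hz
    simpa [h.top_ne.1, h.top_ne.2] using hz
  exists_root x y := by
    obtain ⟨r, hr⟩ := exists_sq (eval ![x, y] T)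
    obtain ⟨z, hz⟩ := exists_sq (r - eval ![x, y] S)
    exact ⟨z, by rw [eval_quartic]; simp [hz, hr]⟩
  nonsingular := h.isNonsingular_quartic

theorem Biell.niceE (h : Biell S T) : NiceCurve ellWt (ellEq S T) where
  wt_zero := rfl
  wt_one := rfl
  homogeneous := by
    refine ⟨4, ?_⟩
    have hX := isWeightedHomogeneous_X ℂ ellWt 2
    have h1 : (X 2 + inXY S).IsWeightedHomogeneous ellWt 2 :=
      hX.add (isWeightedHomogeneous_inXY h.homS rfl rfl)
    exact (h1.pow 2).sub (isWeightedHomogeneous_inXY h.homT rfl rfl)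
  eq_zero_of_top z hz := by
    rw [eval_ellEq] at hz
    simpa [h.top_ne.1, h.top_ne.2] using hz
  exists_root x y := by
    obtain ⟨r, hr⟩ := exists_sq (eval ![x, y] T)
    exact ⟨r - eval ![x, y] S, by rw [eval_ellEq]; simp [hr]⟩
  nonsingular := h.isNonsingular_ellEq

end Algebra

/-! ### The involution and the double covering -/

section Covering

variable {S T : MvPolynomial (Fin 2) ℂ}

theorem Curve.exists_scale {wt : Fin 3 → ℕ} {F : MvPolynomial (Fin 3) ℂ} {q : Curve wt F}
    {v : Fin 3 → ℂ} {hv : v ≠ 0 ∧ eval v F = 0} (h : q = Curve.mk v hv) :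
    ∃ c : ℂ, c ≠ 0 ∧ ∀ i, v i = c ^ wt i * q.rep i :=
  (Curve.mk_eq_mk_iff _ hv).1 (q.mk_rep.trans h)

theorem invol_rep (q : CurveC S T) : ∃ c : ℂ, c ≠ 0 ∧ q.rep 0 = c * (invol S T q).rep 0 ∧
    q.rep 1 = c * (invol S T q).rep 1 ∧ -q.rep 2 = c * (invol S T q).rep 2 := by
  have h : invol S T q = invol S T (Curve.mk q.rep ⟨q.rep_ne_zero, q.eval_rep⟩) := by rw [q.mk_rep]
  obtain ⟨c, hc, e⟩ := Curve.exists_scale (wt := planeWt) h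
  have e0 := e 0
  have e1 := e 1
  have e2 := e 2
  simp at e0 e1 e2
  exact ⟨c, hc, e0, e1, by rw [← e2]⟩

theorem proj_rep (q : CurveC S T) : ∃ c : ℂ, c ≠ 0 ∧ q.rep 0 = c * (proj S T q).rep 0 ∧
    q.rep 1 = c * (proj S T q).rep 1 ∧ q.rep 2 ^ 2 = c ^ 2 * (proj S T q).rep 2 := by
  have h : proj S T q = proj S T (Curve.mk q.rep ⟨q.rep_ne_zero, q.eval_rep⟩) := by rw [q.mk_rep]
  obtain ⟨c, hc, e⟩ := Curve.exists_scale (wt := ellWt) h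
  have e0 := e 0
  have e1 := e 1
  have e2 := e 2
  simp at e0 e1 e2
  exact ⟨c, hc, e0, e1, e2⟩

theorem Curve.eq_of_scale {q q' : CurveC S T} {c : ℂ} (hc : c ≠ 0) (h0 : q'.rep 0 = c * q.rep 0)
    (h1 : q'.rep 1 = c * q.rep 1) (h2 : q'.rep 2 = c * q.rep 2) : q = q' :=
  Curve.eq_of_rep hc (fun i => by fin_cases i <;> simpa)

theorem CurveE.eq_of_scale {q q' : CurveE S T} {c : ℂ} (hc : c ≠ 0) (h0 : q'.rep 0 = c * q.rep 0)
    (h1 : q'.rep 1 = c * q.rep 1) (h2 : q'.rep 2 = c ^ 2 * q.rep 2) : q = q' :=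
  Curve.eq_of_rep hc (fun i => by fin_cases i <;> simpa)

theorem invol_invol (q : CurveC S T) : invol S T (invol S T q) = q := by
  obtain ⟨c, hc, h0, h1, h2⟩ := invol_rep q
  obtain ⟨d, hd, k0, k1, k2⟩ := invol_rep (invol S T q)
  exact Curve.eq_of_scale (mul_ne_zero hc hd) (by rw [h0, k0]; ring) (by rw [h1, k1]; ring)
    (by linear_combination -h2 + c * k2)

theorem proj_invol (q : CurveC S T) : proj S T (invol S T q) = proj S T q := by
  obtain ⟨c, hc, h0, h1, h2⟩ := invol_rep q
  obtain ⟨d, hd, k0, k1, k2⟩ := proj_rep q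
  obtain ⟨e, he, l0, l1, l2⟩ := proj_rep (invol S T q)
  refine CurveE.eq_of_scale (c := c * e / d) (by positivity) ?_ ?_ ?_
  · rw [h0, l0] at k0; field_simp; linear_combination -k0
  · rw [h1, l1] at k1; field_simp; linear_combination -k1
  · have : q.rep 2 ^ 2 = (-q.rep 2) ^ 2 := by ring
    rw [this, h2, mul_pow, l2] at k2
    field_simp
    linear_combination -k2

theorem Biell.xy_ne_zero (h : Biell S T) (q : CurveC S T) : ¬ (q.rep 0 = 0 ∧ q.rep 1 = 0) := by
  obtain ⟨j, hj2, -, hj⟩ := h.niceC.exists_chart q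
  rintro ⟨h0, h1⟩
  fin_cases j
  exacts [hj h0, hj h1, hj2 rfl]

theorem Biell.xy_ne_zeroE (h : Biell S T) (q : CurveE S T) : ¬ (q.rep 0 = 0 ∧ q.rep 1 = 0) := by
  obtain ⟨j, hj2, -, hj⟩ := h.niceE.exists_chart q
  rintro ⟨h0, h1⟩
  fin_cases j
  exacts [hj h0, hj h1, hj2 rfl]

theorem Biell.invol_eq_iff (h : Biell S T) (q : CurveC S T) : invol S T q = q ↔ q.rep 2 = 0 := by
  obtain ⟨c, hc, h0, h1, h2⟩ := invol_rep q
  constructor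
  · intro e
    rw [e] at h0 h1 h2
    have hc1 : c = 1 := by
      by_contra hc1
      apply h.xy_ne_zero q
      have : ∀ x : ℂ, x = c * x → x = 0 := fun x hx => by
        have : (c - 1) * x = 0 := by linear_combination -hx
        exact (mul_eq_zero.1 this).resolve_left (sub_ne_zero.2 hc1)
      exact ⟨this _ h0, this _ h1⟩
    rw [hc1] at h2
    linear_combination -h2 / 2
  · intro e
    refine Curve.eq_of_scale hc h0 h1 ?_
    linear_combination h2 + 2 * e

theorem proj_eq_iff (q q' : CurveC S T) :
    proj S T q' = proj S T q ↔ q' = q ∨ q' = invol S T q := by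
  constructor
  · intro e
    obtain ⟨d, hd, k0, k1, k2⟩ := proj_rep q
    obtain ⟨d', hd', l0, l1, l2⟩ := proj_rep q'
    rw [e] at l0 l1 l2
    have h0 : q'.rep 0 = d' / d * q.rep 0 := by rw [k0, l0]; field_simp
    have h1 : q'.rep 1 = d' / d * q.rep 1 := by rw [k1, l1]; field_simp
    have h2 : q'.rep 2 ^ 2 = (d' / d * q.rep 2) ^ 2 := by rw [l2, mul_pow, k2]; field_simp
    rcases sq_eq_sq_iff_eq_or_eq_neg.1 h2 with h2 | h2
    · exact Or.inl (Curve.eq_of_scale (div_ne_zero hd' hd) h0 h1 h2).symm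
    · right
      obtain ⟨c, hc, m0, m1, m2⟩ := invol_rep q
      refine (Curve.eq_of_scale (mul_ne_zero (div_ne_zero hd' hd) hc) ?_ ?_ ?_).symm
      · rw [h0, m0]; ring
      · rw [h1, m1]; ring
      · rw [mul_assoc, ← m2, h2]; ring
  · rintro (rfl | rfl)
    · rfl
    · exact proj_invol q

theorem proj_surjective (e : CurveE S T) : ∃ q, proj S T q = e := by
  obtain ⟨z, hz⟩ := exists_sq (e.rep 2)
  have hv : ![e.rep 0, e.rep 1, z] ≠ 0 ∧ eval ![e.rep 0, e.rep 1, z] (quartic S T) = 0 := by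
    constructor
    · intro h
      have h0 : e.rep 0 = 0 := congrFun h 0
      have h1 : e.rep 1 = 0 := congrFun h 1
      have h2 : z = 0 := congrFun h 2
      refine e.rep_ne_zero ?_
      funext i
      fin_cases i
      exacts [h0, h1, by rw [h2] at hz; simpa using hz.symm]
    · have := e.eval_rep
      rw [eval_ellEq] at this
      rw [eval_quartic]
      simpa [hz] using this
  refine ⟨Curve.mk _ hv, Eq.trans (Quotient.sound (s := coneSetoid ellWt (ellEq S T))
    ⟨1, one_ne_zero, fun i => ?_⟩) e.mk_rep⟩
  fin_cases i <;> simp [hz]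

/-- The involution as a map of curves. -/
def sigmaMap (h : Biell S T) : CurveMap planeWt (quartic S T) planeWt (quartic S T) where
  poly := ![X 0, X 1, -X 2]
  toFun := invol S T
  homogeneous i := by
    fin_cases i
    · exact isWeightedHomogeneous_X ℂ planeWt 0
    · exact isWeightedHomogeneous_X ℂ planeWt 1
    · exact (isWeightedHomogeneous_X ℂ planeWt 2).neg
  rep q := by
    obtain ⟨c, hc, h0, h1, h2⟩ := invol_rep q
    refine ⟨c, hc, fun i => ?_⟩
    fin_cases i <;> simpa
  dvd_iff P := by
    have he : ∀ v : Fin 3 → ℂ, eval v (aeval ![X 0, X 1, -X 2] P) = eval ![v 0, v 1, -v 2] P := by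
      intro v
      have : (eval v).comp (aeval ![X 0, X 1, -X 2] : MvPolynomial (Fin 3) ℂ →ₐ[ℂ]
          MvPolynomial (Fin 3) ℂ).toRingHom = eval ![v 0, v 1, -v 2] := by
        apply MvPolynomial.ringHom_ext
        · intro r; simp
        · intro i; fin_cases i <;> simp
      exact congrArg (fun f => f P) this
    rw [dvd_iff_eval h.prime_quartic, dvd_iff_eval h.prime_quartic]
    constructor
    · intro hP v hv
      rw [he]
      refine hP _ ?_
      rw [eval_quartic] at hv ⊢
      simpa using hv
    · intro hP v hv
      have := hP ![v 0, v 1, -v 2] (by rw [eval_quartic] at hv ⊢; simpa using hv)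
      rw [he] at this
      convert this using 2
      congr 1
      funext i
      fin_cases i <;> simp

/-- The double covering as a map of curves. -/
def projMap (h : Biell S T) : CurveMap planeWt (quartic S T) ellWt (ellEq S T) where
  poly := ![X 0, X 1, X 2 ^ 2]
  toFun := proj S T
  homogeneous i := by
    fin_cases i
    · exact isWeightedHomogeneous_X ℂ planeWt 0
    · exact isWeightedHomogeneous_X ℂ planeWt 1
    · exact (isWeightedHomogeneous_X ℂ planeWt 2).pow 2
  rep q := by
    obtain ⟨c, hc, h0, h1, h2⟩ := proj_rep q
    refine ⟨c, hc, fun i => ?_⟩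
    fin_cases i <;> simpa
  dvd_iff P := by
    have he : ∀ v : Fin 3 → ℂ, eval v (aeval ![X 0, X 1, X 2 ^ 2] P) = eval ![v 0, v 1, v 2 ^ 2] P := by
      intro v
      have : (eval v).comp (aeval ![X 0, X 1, X 2 ^ 2] : MvPolynomial (Fin 3) ℂ →ₐ[ℂ]
          MvPolynomial (Fin 3) ℂ).toRingHom = eval ![v 0, v 1, v 2 ^ 2] := by
        apply MvPolynomial.ringHom_ext
        · intro r; simp
        · intro i; fin_cases i <;> simp
      exact congrArg (fun f => f P) this
    rw [dvd_iff_eval h.prime_quartic, dvd_iff_eval h.prime_ellEq]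
    constructor
    · intro hP v hv
      rw [he]
      refine hP _ ?_
      rw [eval_quartic] at hv
      rw [eval_ellEq]
      simpa using hv
    · intro hP v hv
      obtain ⟨z, hz⟩ := exists_sq (v 2)
      have := hP ![v 0, v 1, z] (by
        rw [eval_ellEq] at hv; rw [eval_quartic]; simpa [hz] using hv)
      rw [he] at this
      convert this using 2
      congr 1
      funext i
      fin_cases i <;> simp [hz]

/-! ### Ramification of the double covering. -/

section Pull

variable [hF : Fact (Prime (quartic S T))] [hF' : Fact (Prime (ellEq S T))]

theorem sigmaMap_pull_pull (h : Biell S T) (g : CoordFrac (quartic S T)) :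
    (sigmaMap h).pull ((sigmaMap h).pull g) = g := by
  obtain ⟨a, b, hb, rfl⟩ := IsFractionRing.div_surjective
    (A := MvPolynomial (Fin 3) ℂ ⧸ Ideal.span {quartic S T}) g
  obtain ⟨P, rfl⟩ := Ideal.Quotient.mk_surjective a
  obtain ⟨Q, rfl⟩ := Ideal.Quotient.mk_surjective b
  have key : ∀ P, (sigmaMap h).pull ((sigmaMap h).pull (toFrac (quartic S T) P)) =
      toFrac (quartic S T) P := by
    intro P
    rw [CurveMap.pull_toFrac, CurveMap.pull_toFrac]
    congr 1
    have : (aeval (sigmaMap h).poly : MvPolynomial (Fin 3) ℂ →ₐ[ℂ] MvPolynomial (Fin 3) ℂ).comp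
        (aeval (sigmaMap h).poly) = AlgHom.id ℂ _ := by
      apply MvPolynomial.algHom_ext
      intro i
      fin_cases i <;> simp [sigmaMap]
    exact congrArg (fun f => f P) this
  have hP := key P
  have hQ := key Q
  rw [map_div₀, map_div₀]
  exact congrArg₂ (· / ·) hP hQ

theorem unif_sigmaMap_pull (h : Biell S T) {q : CurveC S T} {t : CoordFrac (quartic S T)}
    (ht : Unif (invol S T q) t) : Unif q ((sigmaMap h).pull t) := by
  refine ⟨(sigmaMap h).hasValue_pull ht.1, fun g hg => ?_⟩
  rw [← invol_invol q] at hg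
  obtain ⟨k, c, hk, e⟩ := ht.2 _ ((sigmaMap h).hasValue_pull hg)
  refine ⟨_, c, (sigmaMap h).hasValue_pull hk, ?_⟩
  rw [← map_mul, ← e, sigmaMap_pull_pull]

theorem hOrd_sigmaMap_pull (h : Biell S T) {q : CurveC S T} {g : CoordFrac (quartic S T)} {n : ℤ}
    (hg : HOrd (invol S T q) g n) : HOrd q ((sigmaMap h).pull g) n := by
  obtain ⟨t, ht⟩ := h.niceC.exists_unif (invol S T q)
  simpa using (sigmaMap h).hOrd_pull h.niceC h.niceC ht
    ((unif_sigmaMap_pull h ht).hOrd h.niceC) hg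

theorem localCoord_eq {wt : Fin 3 → ℕ} {F : MvPolynomial (Fin 3) ℂ} [Fact (Prime F)] (p : Curve wt F)
    (j i : Fin 3) : localCoord p j i =
      toFrac F (X i) / toFrac F (X j) ^ wt i - algebraMap ℂ _ (p.affine j i) := by
  rw [localCoord, map_sub, dehom, aeval_X, ← MvPolynomial.algebraMap_eq, AlgHom.commutes]

theorem HasValue.exists_localCoord {wt : Fin 3 → ℕ} {F : MvPolynomial (Fin 3) ℂ} [Fact (Prime F)]
    {p : Curve wt F} {i j k : Fin 3} (hj : p.rep j ≠ 0) (hw : wt j = 1) (hij : i ≠ j) (hkj : k ≠ j)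
    (hik : i ≠ k) {g : CoordFrac F} (hg : HasValue p g 0) : ∃ a b c d, HasValue p a c ∧ HasValue p b d ∧
      g = a * localCoord p j i + b * localCoord p j k := by
  obtain ⟨P, Q, rfl, hQ, hP⟩ := hg.exists_dehom hj
  obtain ⟨B, hB⟩ := exists_taylor (p.affine j) P
  have h2 := dehom_taylor hj hw hij hkj hik hB
  rw [hP, zero_mul, map_zero, zero_add] at h2
  have hd : ∀ R, HasValue p (dehom wt F j R) (eval (p.affine j) R) := hasValue_dehom hj hw
  exact ⟨_, _, _, _, (hd (B i)).mul ((hd Q).inv hQ), (hd (B k)).mul ((hd Q).inv hQ), by rw [h2]; ring⟩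

theorem fin_three_eq {i j k : Fin 3} (hij : i ≠ j) (hi : i ≠ 2) (hj : j ≠ 2) (hk : k ≠ 2)
    (hkj : k ≠ j) : i = k := by
  revert i j k; decide

/-- The two indices of the affine coordinates on the projective line. -/
theorem Biell.exists_indices (h : Biell S T) (q : CurveC S T) : ∃ j k : Fin 3, j ≠ 2 ∧ k ≠ 2 ∧ k ≠ j ∧
    planeWt j = 1 ∧ planeWt k = 1 ∧ ellWt j = 1 ∧ ellWt k = 1 ∧ q.rep j ≠ 0 ∧
    (proj S T q).rep j ≠ 0 ∧ (proj S T q).affine j k = q.affine j k ∧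
    (proj S T q).affine j 2 = q.affine j 2 ^ 2 ∧
    (projMap h).poly j = X j ∧ (projMap h).poly k = X k := by
  obtain ⟨j, hj2, hw, hj⟩ := h.niceC.exists_chart q
  obtain ⟨c, hc, h0, h1, h2⟩ := proj_rep q
  obtain ⟨k, hk2, hjk⟩ := exists_third hj2
  have hkj := hjk.symm
  have hwE : ∀ i : Fin 3, i ≠ 2 → planeWt i = 1 ∧ ellWt i = 1 ∧ (projMap h).poly i = X i ∧
      q.rep i = c * (proj S T q).rep i := by
    intro i hi
    fin_cases i
    · exact ⟨rfl, rfl, rfl, h0⟩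
    · exact ⟨rfl, rfl, rfl, h1⟩
    · exact absurd rfl hi
  obtain ⟨wj, wj', pj, ej⟩ := hwE j hj2
  obtain ⟨wk, wk', pk, ek⟩ := hwE k hk2
  refine ⟨j, k, hj2, hk2, hkj, wj, wk, wj', wk', hj, ?_, ?_, ?_, pj, pk⟩
  · rw [ej] at hj; exact right_ne_zero_of_mul hj
  · rw [Curve.affine, Curve.affine, wk, wk', pow_one, pow_one, ej, ek, mul_div_mul_left _ _ hc]
  · rw [Curve.affine, Curve.affine]
    change _ / _ ^ 2 = (_ / _ ^ 1) ^ 2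
    rw [pow_one, div_pow, h2, ej, mul_pow, mul_div_mul_left _ _ (pow_ne_zero _ hc)]

/-- At a ramification point `F_z` vanishes, so the derivative in the other affine coordinate does
not. This makes `z` a local uniformizer there. -/
theorem Biell.pderiv_ne_zero (h : Biell S T) {q : CurveC S T} (hz : q.rep 2 = 0) {j k : Fin 3}
    (hj2 : j ≠ 2) (hk2 : k ≠ 2) (hkj : k ≠ j) (wj : planeWt j = 1) (hj : q.rep j ≠ 0) :
    eval (q.affine j) (pderiv k (quartic S T)) ≠ 0 := by
  obtain ⟨i, hij, hi⟩ := h.niceC.exists_pderiv hj wj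
  have hi2 : i ≠ 2 := by
    rintro rfl
    apply hi
    rw [pderiv_two_quartic]
    simp [Curve.affine, hz]
  rwa [← fin_three_eq hij hi2 hj2 hk2 hkj]

/-- In affine coordinates `w - z₀²` pulls back to `(z - z₀)(z + z₀)`. If `z₀ = 0`, then `w` and `z`
are uniformizers and `w = z²` has order two. If `z₀ ≠ 0`, the factor `z + z₀` is a unit, so the
pulled-back maximal ideal generates the maximal ideal at `q`, and any uniformizer below stays one.
-/
theorem exists_unif_projMap (h : Biell S T) (q : CurveC S T) : ∃ t : CoordFrac (ellEq S T),
    Unif (proj S T q) t ∧ HOrd q ((projMap h).pull t) (ramIndex S T q) := by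
  obtain ⟨j, k, hj2, hk2, hkj, wj, wk, wj', wk', hj, hj', ek, e2, pj, pk⟩ := h.exists_indices q
  have l2 : (projMap h).pull (localCoord (proj S T q) j 2) =
      localCoord q j 2 * (localCoord q j 2 + 2 * algebraMap ℂ _ (q.affine j 2)) := by
    rw [localCoord_eq, localCoord_eq, map_sub, map_div₀, map_pow, CurveMap.pull_toFrac,
      CurveMap.pull_toFrac, aeval_X, aeval_X, pj, CurveMap.pull_algebraMap, e2]
    have hw2 : planeWt 2 = 1 := rfl
    change toFrac _ (X 2 ^ 2) / _ ^ 2 - _ = _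
    rw [map_pow, map_pow, hw2]
    ring
  have lk : (projMap h).pull (localCoord (proj S T q) j k) = localCoord q j k := by
    rw [localCoord_eq, localCoord_eq, map_sub, map_div₀, map_pow, CurveMap.pull_toFrac,
      CurveMap.pull_toFrac, aeval_X, aeval_X, pj, pk, CurveMap.pull_algebraMap, ek, wk, wk']
  by_cases hz : q.rep 2 = 0
  · have haff : q.affine j 2 = 0 := by rw [Curve.affine, hz, zero_div]
    have hram : ramIndex S T q = 2 := by rw [ramIndex, if_pos ((h.invol_eq_iff q).2 hz)]
    have hk := h.pderiv_ne_zero hz hj2 hk2 hkj wj hj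
    have hk' : eval ((proj S T q).affine j) (pderiv k (ellEq S T)) ≠ 0 := by
      have hxy : ∀ i : Fin 3, i ≠ 2 → (proj S T q).affine j i = q.affine j i := by
        intro i hi
        by_cases hij : i = j
        · rw [hij, Curve.affine_self _ hj' wj', Curve.affine_self _ hj wj]
        · have : i = k := fin_three_eq hij hi hj2 hk2 hkj
          rw [this, ek]
      obtain ⟨i, rfl⟩ : ∃ i : Fin 2, k = ![0, 1] i := by
        clear * - hk2
        fin_cases k
        exacts [⟨0, rfl⟩, ⟨1, rfl⟩, absurd rfl hk2]
      rw [pderiv_quartic] at hk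
      rw [pderiv_ellEq]
      simpa [eval_inXY, hxy, e2] using hk
    refine ⟨_, unif_localCoord h.niceE hj' wj' hkj (Ne.symm hj2) hk2 hk', ?_⟩
    rw [l2, hram, haff, map_zero, mul_zero, add_zero]
    have := (unif_localCoord h.niceC hj wj hkj (Ne.symm hj2) hk2 hk).hOrd h.niceC
    exact this.mul h.niceC this
  · have hram : ramIndex S T q = 1 := by rw [ramIndex, if_neg (fun e => hz ((h.invol_eq_iff q).1 e))]
    obtain ⟨t, ht⟩ := h.niceE.exists_unif (proj S T q)
    refine ⟨t, ht, ?_⟩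
    rw [hram]
    refine Unif.hOrd h.niceC ⟨(projMap h).hasValue_pull ht.1, fun g hg => ?_⟩
    obtain ⟨a, b, c, d, ha, hb, rfl⟩ := hg.exists_localCoord hj wj (Ne.symm hj2) hkj hk2.symm
    obtain ⟨a', c', ha', ea⟩ := ht.2 _ (hasValue_localCoord hj' wj' 2)
    obtain ⟨b', d', hb', eb⟩ := ht.2 _ (hasValue_localCoord hj' wj' k)
    have h2 := (hasValue_localCoord hj wj 2).add
      ((hasValue_algebraMap q 2).mul (hasValue_algebraMap q (q.affine j 2)))
    have hne : 0 + 2 * q.affine j 2 ≠ 0 := by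
      rw [zero_add, Curve.affine]
      exact mul_ne_zero two_ne_zero (div_ne_zero hz (pow_ne_zero _ hj))
    rw [map_ofNat] at h2
    refine ⟨_, _, (ha.mul (((projMap h).hasValue_pull ha').mul (h2.inv hne))).add
      (hb.mul ((projMap h).hasValue_pull hb')), ?_⟩
    have h2' := h2.ne_zero hne
    rw [ea, map_mul] at l2
    rw [eb, map_mul] at lk
    rw [← lk]
    have l3 := (eq_div_iff h2').2 l2.symm
    linear_combination a * l3

theorem hOrd_projMap_pull (h : Biell S T) {q : CurveC S T} {g : CoordFrac (ellEq S T)} {n : ℤ}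
    (hg : HOrd (proj S T q) g n) : HOrd q ((projMap h).pull g) (ramIndex S T q * n) := by
  obtain ⟨t, ht, he⟩ := exists_unif_projMap h q
  exact (projMap h).hOrd_pull h.niceC h.niceE ht he hg

end Pull

end Covering

/-! ### Principal divisors -/

section Principal

variable {wt : Fin 3 → ℕ} {F : MvPolynomial (Fin 3) ℂ} [hF : Fact (Prime F)]

theorem NiceCurve.isPrincipal_iff (hC : NiceCurve wt F) {D : Divisor wt F} :
    IsPrincipal D ↔ ∃ f ∈ functionField wt F, ∀ p, HOrd p f (D p) := by
  simp only [IsPrincipal, hasOrder_iff hC]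
  exact ⟨fun ⟨f, h⟩ => ⟨f, f.2, h⟩, fun ⟨f, hf, h⟩ => ⟨⟨f, hf⟩, h⟩⟩

theorem inv_mem_functionField {f : CoordFrac F} (hf : f ∈ functionField wt F) :
    f⁻¹ ∈ functionField wt F := by
  by_cases h0 : f = 0
  · rw [h0, inv_zero]; exact zero_mem _
  · obtain ⟨P, Q, ⟨d, hP, hQ⟩, hu, e⟩ := hf
    refine ⟨Q, P, ⟨d, hQ, hP⟩, ?_, ?_⟩
    · rw [← e]; exact (mul_ne_zero h0 hu.ne_zero).isUnit
    · rw [← e]; field_simp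

theorem div_mem_functionField {A B : MvPolynomial (Fin 3) ℂ} {d : ℕ}
    (hA : A.IsWeightedHomogeneous wt d) (hB : B.IsWeightedHomogeneous wt d) (hB0 : toFrac F B ≠ 0) :
    toFrac F A / toFrac F B ∈ functionField wt F :=
  ⟨A, B, ⟨d, hA, hB⟩, hB0.isUnit, div_mul_cancel₀ _ hB0⟩

theorem exists_div_of_mem {f : CoordFrac F} (hf : f ∈ functionField wt F) :
    ∃ (d : ℕ) (A B : MvPolynomial (Fin 3) ℂ), A.IsWeightedHomogeneous wt d ∧
      B.IsWeightedHomogeneous wt d ∧ toFrac F B ≠ 0 ∧ f = toFrac F A / toFrac F B := by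
  obtain ⟨P, Q, ⟨d, hP, hQ⟩, hu, e⟩ := hf
  exact ⟨d, P, Q, hP, hQ, hu.ne_zero, by rw [eq_div_iff hu.ne_zero, e]⟩

theorem NiceCurve.isPrincipal_add (hC : NiceCurve wt F) {D D' : Divisor wt F} (h : IsPrincipal D)
    (h' : IsPrincipal D') : IsPrincipal (D + D') := by
  rw [hC.isPrincipal_iff] at *
  obtain ⟨f, hf, h⟩ := h
  obtain ⟨g, hg, h'⟩ := h'
  exact ⟨f * g, mul_mem hf hg, fun p => (h p).mul hC (h' p)⟩

theorem NiceCurve.isPrincipal_neg (hC : NiceCurve wt F) {D : Divisor wt F} (h : IsPrincipal D) :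
    IsPrincipal (-D) := by
  rw [hC.isPrincipal_iff] at *
  obtain ⟨f, hf, h⟩ := h
  exact ⟨f⁻¹, inv_mem_functionField hf, fun p => (h p).inv⟩

theorem NiceCurve.isPrincipal_zero (hC : NiceCurve wt F) : IsPrincipal (0 : Divisor wt F) :=
  hC.isPrincipal_iff.2 ⟨1, one_mem _, fun p => ((hasValue_one p).hU one_ne_zero).hOrd hC⟩

/-- Principal divisors already form a subgroup, so the closure in the definition of `Pic` adds
nothing. -/
theorem NiceCurve.divClass_eq_iff (hC : NiceCurve wt F) {D D' : Divisor wt F} :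
    divClass D = divClass D' ↔ IsPrincipal (D' - D) := by
  rw [divClass, divClass, QuotientAddGroup.eq, neg_add_eq_sub]
  refine ⟨fun h => ?_, fun h => AddSubgroup.subset_closure h⟩
  generalize D' - D = E at h ⊢
  induction h using AddSubgroup.closure_induction with
  | mem x hx => exact hx
  | zero => exact hC.isPrincipal_zero
  | add x y _ _ hx hy => exact hC.isPrincipal_add hx hy
  | neg x _ hx => exact hC.isPrincipal_neg hx

theorem exists_hOrd_of_mem (hC : NiceCurve wt F) (p : Curve wt F) {f : CoordFrac F}
    (hf : f ∈ functionField wt F) (h0 : f ≠ 0) : ∃ n, HOrd p f n := by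
  obtain ⟨d, A, B, hA, hB, hB0, rfl⟩ := exists_div_of_mem hf
  obtain ⟨m, hm⟩ := exists_hOrd_toFrac hC p hA (fun h => h0 (by rw [h, zero_div]))
  obtain ⟨n, hn⟩ := exists_hOrd_toFrac hC p hB hB0
  exact ⟨_, hm.div hC hn⟩

end Principal

/-! ### Divisors of linear forms on the elliptic curve -/

section Elliptic

variable {S T : MvPolynomial (Fin 2) ℂ}

theorem Biell.conj_aux (h : Biell S T) (e : CurveE S T) :
    ![e.rep 0, e.rep 1, -e.rep 2 - 2 * eval ![e.rep 0, e.rep 1] S] ≠ 0 ∧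
      eval ![e.rep 0, e.rep 1, -e.rep 2 - 2 * eval ![e.rep 0, e.rep 1] S] (ellEq S T) = 0 := by
  refine ⟨fun k => h.xy_ne_zeroE e ⟨congrFun k 0, congrFun k 1⟩, ?_⟩
  have := e.eval_rep
  rw [eval_ellEq] at this ⊢
  simp only [Matrix.cons_val]
  linear_combination this

/-- The involution of `E` over the projective line. -/
def Biell.conj (h : Biell S T) (e : CurveE S T) : CurveE S T := Curve.mk _ (h.conj_aux e)

theorem Biell.conj_rep (h : Biell S T) (e : CurveE S T) : ∃ c : ℂ, c ≠ 0 ∧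
    e.rep 0 = c * (h.conj e).rep 0 ∧ e.rep 1 = c * (h.conj e).rep 1 ∧
    -e.rep 2 - 2 * eval ![e.rep 0, e.rep 1] S = c ^ 2 * (h.conj e).rep 2 := by
  obtain ⟨c, hc, k⟩ := Curve.exists_scale (wt := ellWt) (q := h.conj e) rfl
  have e0 := k 0
  have e1 := k 1
  have e2 := k 2
  simp at e0 e1 e2
  exact ⟨c, hc, e0, e1, e2⟩

theorem eval_pair_smul {G : MvPolynomial (Fin 2) ℂ} {d : ℕ} (hG : G.IsHomogeneous d) (c x y : ℂ) :
    eval ![c * x, c * y] G = c ^ d * eval ![x, y] G := by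
  rw [← eval_smul_of_isHomogeneous hG]
  congr 2
  funext i
  fin_cases i <;> simp

/-- Two points of `E` over the same point of the projective line are equal or conjugate. -/
theorem Biell.eq_or_eq_conj (h : Biell S T) {e e' : CurveE S T} {c : ℂ} (hc : c ≠ 0)
    (h0 : e'.rep 0 = c * e.rep 0) (h1 : e'.rep 1 = c * e.rep 1) : e' = e ∨ e' = h.conj e := by
  have k := e.eval_rep
  have k' := e'.eval_rep
  rw [eval_ellEq] at k k'
  rw [h0, h1, eval_pair_smul h.homS, eval_pair_smul h.homT] at k'
  have h2 : (e'.rep 2 + c ^ 2 * eval ![e.rep 0, e.rep 1] S) ^ 2 =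
      (c ^ 2 * (e.rep 2 + eval ![e.rep 0, e.rep 1] S)) ^ 2 := by
    linear_combination k' - c ^ 4 * k
  rcases sq_eq_sq_iff_eq_or_eq_neg.1 h2 with h2 | h2
  · exact Or.inl (CurveE.eq_of_scale hc h0 h1 (by linear_combination h2)).symm
  · right
    obtain ⟨d, hd, l0, l1, l2⟩ := h.conj_rep e
    refine (CurveE.eq_of_scale (mul_ne_zero hc hd) ?_ ?_ ?_).symm
    · rw [h0, l0]; ring
    · rw [h1, l1]; ring
    · rw [mul_pow, mul_assoc, ← l2]; linear_combination h2

theorem Biell.conj_conj (h : Biell S T) (e : CurveE S T) : h.conj (h.conj e) = e := by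
  obtain ⟨c, hc, h0, h1, h2⟩ := h.conj_rep e
  obtain ⟨d, hd, k0, k1, k2⟩ := h.conj_rep (h.conj e)
  refine CurveE.eq_of_scale (mul_ne_zero hc hd) ?_ ?_ ?_
  · rw [h0, k0]; ring
  · rw [h1, k1]; ring
  · rw [mul_pow, mul_assoc, ← k2]
    have := eval_pair_smul h.homS c ((h.conj e).rep 0) ((h.conj e).rep 1)
    rw [← h0, ← h1] at this
    linear_combination -h2 - 2 * this

/-- The linear form vanishing at `(a, b)`. -/
def linForm (a b : ℂ) : MvPolynomial (Fin 3) ℂ := C b * X 0 - C a * X 1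

theorem isWeightedHomogeneous_linForm (a b : ℂ) {wt : Fin 3 → ℕ} (h0 : wt 0 = 1) (h1 : wt 1 = 1) :
    (linForm a b).IsWeightedHomogeneous wt 1 := by
  refine IsWeightedHomogeneous.sub (IsWeightedHomogeneous.C_mul ?_ b) (IsWeightedHomogeneous.C_mul ?_ a)
  · simpa [h0] using isWeightedHomogeneous_X ℂ wt 0
  · simpa [h1] using isWeightedHomogeneous_X ℂ wt 1

theorem eval_linForm (a b : ℂ) (v : Fin 3 → ℂ) : eval v (linForm a b) = b * v 0 - a * v 1 := by
  simp [linForm]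

theorem NiceCurve.linForm_ne_zero {wt : Fin 3 → ℕ} {F : MvPolynomial (Fin 3) ℂ} [Fact (Prime F)]
    (hC : NiceCurve wt F) {a b : ℂ} (h : ¬ (a = 0 ∧ b = 0)) : toFrac F (linForm a b) ≠ 0 := by
  have := hC.linear_ne_zero (a := b) (b := -a) (by rw [neg_eq_zero, and_comm]; exact h)
  rwa [map_neg, neg_mul, ← sub_eq_add_neg] at this

/-- The divisor `e + e'` where `e'` is the conjugate of `e`. -/
def Biell.fib (h : Biell S T) (e : CurveE S T) : Divisor ellWt (ellEq S T) :=
  Finsupp.single e 1 + Finsupp.single (h.conj e) 1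

/-! ### Orders of linear forms and of `w` on the elliptic curve. -/

section Orders

variable [hF : Fact (Prime (quartic S T))] [hF' : Fact (Prime (ellEq S T))]

theorem toFrac_C {F : MvPolynomial (Fin 3) ℂ} (c : ℂ) : toFrac F (C c) = algebraMap ℂ _ c := by
  rw [← MvPolynomial.algebraMap_eq, AlgHom.commutes]

theorem Biell.exists_indicesE (h : Biell S T) (e : CurveE S T) {a b : ℂ} (hab : ¬ (a = 0 ∧ b = 0))
    (hm : eval e.rep (linForm a b) = 0) : ∃ j k : Fin 3, j ≠ 2 ∧ k ≠ 2 ∧ k ≠ j ∧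
    ellWt j = 1 ∧ ellWt k = 1 ∧ e.rep j ≠ 0 ∧ ∃ c : ℂ, c ≠ 0 ∧
      toFrac (ellEq S T) (linForm a b) = algebraMap ℂ _ c * toFrac _ (X j) * localCoord e j k := by
  obtain ⟨j, hj2, hw, hj⟩ := h.niceE.exists_chart e
  have hX : toFrac (ellEq S T) (X j) ≠ 0 := toFrac_ne_zero_of_eval e.eval_rep (by simpa)
  rw [eval_linForm] at hm
  fin_cases j
  · refine ⟨0, 1, by decide, by decide, by decide, rfl, rfl, hj, -a, ?_, ?_⟩
    · rw [neg_ne_zero]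
      rintro rfl
      exact hab ⟨rfl, by simpa [show e.rep 0 ≠ 0 from hj] using hm⟩
    · have hj' : e.rep 0 ≠ 0 := hj
      have hb : b = a * e.affine 0 1 := by
        rw [Curve.affine]
        change b = a * (_ / _ ^ 1)
        field_simp
        linear_combination hm
      rw [localCoord_eq, linForm, map_sub, map_mul, map_mul, toFrac_C, toFrac_C]
      change _ = _ * _ * (_ / _ ^ 1 - _)
      simp at hX
      rw [hb]
      simp only [map_mul, map_neg]
      field_simp
      ring
  · refine ⟨1, 0, by decide, by decide, by decide, rfl, rfl, hj, b, ?_, ?_⟩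
    · rintro rfl
      exact hab ⟨by simpa [show e.rep 1 ≠ 0 from hj] using hm, rfl⟩
    · have hj' : e.rep 1 ≠ 0 := hj
      have hb : a = b * e.affine 1 0 := by
        rw [Curve.affine]
        change a = b * (_ / _ ^ 1)
        field_simp
        linear_combination -hm
      rw [localCoord_eq, linForm, map_sub, map_mul, map_mul, toFrac_C, toFrac_C]
      change _ = _ * _ * (_ / _ ^ 1 - _)
      simp at hX
      rw [hb]
      simp only [map_mul]
      field_simp
  · exact absurd rfl hj2

theorem exists_taylor_inXY (v : Fin 3 → ℂ) (P : MvPolynomial (Fin 2) ℂ) :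
    ∃ A : Fin 3 → MvPolynomial (Fin 3) ℂ, A 2 = 0 ∧
      inXY P = C (eval v (inXY P)) + ∑ i, (X i - C (v i)) * A i := by
  obtain ⟨A, hA⟩ := exists_taylor ![v 0, v 1] P
  refine ⟨![inXY (A 0), inXY (A 1), 0], rfl, ?_⟩
  have := congrArg inXY hA
  rw [eval_inXY]
  rw [this]
  simp [inXY, Fin.sum_univ_three]

theorem pderiv_ellEq_eq (k : Fin 3) : pderiv k (ellEq S T) =
    2 * (X 2 + inXY S) * pderiv k (X 2 + inXY S) - pderiv k (inXY T) := by
  rw [ellEq, map_sub, Derivation.leibniz_pow]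
  simp
  ring

/-- The roots of `T` are the branch points of `E → ℙ¹`; there a line in the pencil is tangent to the
fibre structure and vanishes doubly, elsewhere simply. -/
theorem hOrd_linForm_aux (h : Biell S T) (e : CurveE S T) {a b : ℂ} (hab : ¬ (a = 0 ∧ b = 0))
    (hm : eval e.rep (linForm a b) = 0) : HOrd e (toFrac (ellEq S T) (linForm a b))
      (if eval ![e.rep 0, e.rep 1] T = 0 then 2 else 1) := by
  obtain ⟨j, k, hj2, hk2, hkj, wj, wk, hj, c, hc, hlin⟩ := h.exists_indicesE e hab hm
  have hnice := h.niceE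
  have key : ∀ n, HOrd e (localCoord e j k) n → HOrd e (toFrac (ellEq S T) (linForm a b)) n := by
    intro n hn
    rw [hlin]
    have h1 := ((hasValue_algebraMap e c).hU hc).hOrd hnice
    have h2 := (HU.toFrac (isWeightedHomogeneous_X ℂ ellWt j) (p := e) (by simpa)).hOrd hnice
    simpa using (h1.mul hnice h2).mul hnice hn
  apply key
  have hTaff : eval (e.affine j) (inXY T) = 0 ↔ eval ![e.rep 0, e.rep 1] T = 0 := by
    rw [Curve.eval_affine (isWeightedHomogeneous_inXY h.homT rfl rfl), eval_inXY]
    simp [hj]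
  obtain ⟨N, hN⟩ := hnice.homogeneous
  have hFaff : eval (e.affine j) (ellEq S T) = 0 := by
    rw [Curve.eval_affine hN, e.eval_rep, zero_div]
  rw [eval_ellEq, ← eval_inXY, ← eval_inXY] at hFaff
  split_ifs with hT
  · rw [← hTaff] at hT
    have hr0 : e.affine j 2 + eval (e.affine j) (inXY S) = 0 := by
      rw [hT, sub_zero] at hFaff
      exact pow_eq_zero_iff two_ne_zero |>.1 hFaff
    have hk : eval (e.affine j) (pderiv k (ellEq S T)) ≠ 0 := by
      obtain ⟨i, hij, hi⟩ := hnice.exists_pderiv hj wj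
      have hi2 : i ≠ 2 := by
        rintro rfl
        apply hi
        rw [pderiv_two_ellEq]
        simp [hr0]
      rwa [← fin_three_eq hij hi2 hj2 hk2 hkj]
    have hkT : eval (e.affine j) (pderiv k (inXY T)) ≠ 0 := by
      intro h0
      apply hk
      rw [pderiv_ellEq_eq, map_sub, h0]
      simp [hr0]
    have ht := unif_localCoord hnice hj wj hkj (Ne.symm hj2) hk2 hk
    obtain ⟨A, hA2, hA⟩ := exists_taylor_inXY (e.affine j) S
    obtain ⟨B, hB2, hB⟩ := exists_taylor_inXY (e.affine j) T
    rw [eval_taylor hB] at hkT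
    have dS := dehom_taylor hj wj (Ne.symm hj2) hkj hk2.symm hA
    have dT := dehom_taylor hj wj (Ne.symm hj2) hkj hk2.symm hB
    rw [hA2, map_zero, mul_zero, zero_add] at dS
    rw [hB2, map_zero, mul_zero, zero_add, hT, map_zero, zero_add] at dT
    have dX : dehom ellWt (ellEq S T) j (X 2) =
        localCoord e j 2 + algebraMap ℂ _ (e.affine j 2) := by
      rw [localCoord, map_sub, ← MvPolynomial.algebraMap_eq, AlgHom.commutes, sub_add_cancel]
    set u := localCoord e j k
    set t := localCoord e j 2
    -- At a branch point of `E → ℙ¹` take `r = w + S`. The equation gives `r² = T = u B`, with `B` a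
    -- unit because the root of `T` is simple. Moreover `t = r - u A = r (1 - r A / B)`, so `r` has
    -- order one like `t`, and `u = r² / B` has order two.
    set r := dehom ellWt (ellEq S T) j (X 2 + inXY S) with hr
    have hrt : r = t + u * dehom ellWt (ellEq S T) j (A k) := by
      rw [hr, map_add, dS, dX]
      have : algebraMap ℂ (CoordFrac (ellEq S T)) (e.affine j 2) +
          algebraMap ℂ _ (eval (e.affine j) (inXY S)) = 0 := by rw [← map_add, hr0, map_zero]
      linear_combination this
    have hr2 : r ^ 2 = u * dehom ellWt (ellEq S T) j (B k) := by
      have : dehom ellWt (ellEq S T) j ((X 2 + inXY S) ^ 2 - inXY T) = 0 := dehom_self hnice j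
      rw [map_sub, map_pow] at this
      rw [← dT]
      linear_combination this
    have vB := hasValue_dehom hj wj (B k)
    have vA := hasValue_dehom hj wj (A k)
    have vr := hasValue_dehom hj wj (X 2 + inXY S)
    rw [map_add (eval _), eval_X, hr0, ← hr] at vr
    have hB0 := vB.ne_zero hkT
    have v1 := (hasValue_one e).sub ((vr.mul vA).mul (vB.inv hkT))
    simp only [zero_mul, sub_zero] at v1
    have hu : u = r ^ 2 / dehom ellWt (ellEq S T) j (B k) := by rw [hr2]; field_simp
    have htr : t = r * (1 - r * dehom ellWt (ellEq S T) j (A k) *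
        (dehom ellWt (ellEq S T) j (B k))⁻¹) := by
      rw [hu] at hrt
      linear_combination -hrt
    have ord1 := (v1.hU one_ne_zero).hOrd hnice
    have hr1 : HOrd e r 1 := by
      have := (ht.hOrd hnice).div hnice ord1
      rw [htr, mul_div_cancel_right₀ _ (v1.ne_zero one_ne_zero)] at this
      simpa using this
    have := (hr1.pow hnice 2).div hnice ((vB.hU hkT).hOrd hnice)
    rw [← hu] at this
    simpa using this
  · refine (unif_localCoord hnice hj wj (Ne.symm hj2) hkj hk2.symm ?_).hOrd hnice
    rw [← hTaff] at hT
    rw [pderiv_two_ellEq]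
    intro h0
    apply hT
    simp only [map_mul, map_add, eval_X] at h0
    have : e.affine j 2 + eval (e.affine j) (inXY S) = 0 := by simpa using h0
    rw [this] at hFaff
    linear_combination -hFaff

theorem Biell.conj_eq_iff (h : Biell S T) (e : CurveE S T) :
    h.conj e = e ↔ eval ![e.rep 0, e.rep 1] T = 0 := by
  obtain ⟨c, hc, h0, h1, h2⟩ := h.conj_rep e
  have k := e.eval_rep
  rw [eval_ellEq] at k
  constructor
  · intro heq
    rw [heq] at h0 h1 h2
    have hc1 : c = 1 := by
      by_contra hc1
      apply h.xy_ne_zeroE e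
      have : ∀ x : ℂ, x = c * x → x = 0 := fun x hx => by
        have : (c - 1) * x = 0 := by linear_combination -hx
        exact (mul_eq_zero.1 this).resolve_left (sub_ne_zero.2 hc1)
      exact ⟨this _ h0, this _ h1⟩
    rw [hc1] at h2
    have : e.rep 2 + eval ![e.rep 0, e.rep 1] S = 0 := by linear_combination -h2 / 2
    rw [this] at k
    linear_combination -k
  · intro hT
    rw [hT, sub_zero] at k
    have : e.rep 2 + eval ![e.rep 0, e.rep 1] S = 0 := pow_eq_zero_iff two_ne_zero |>.1 k
    exact CurveE.eq_of_scale hc h0 h1 (by linear_combination h2 + 2 * this)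

theorem Biell.fib_conj (h : Biell S T) (e : CurveE S T) : h.fib (h.conj e) = h.fib e := by
  rw [Biell.fib, Biell.fib, h.conj_conj, add_comm]

/-- Points where a linear form vanishes. -/
theorem Biell.eval_linForm_eq_zero_iff (h : Biell S T) (e e' : CurveE S T) :
    eval e'.rep (linForm (e.rep 0) (e.rep 1)) = 0 ↔ e' = e ∨ e' = h.conj e := by
  rw [eval_linForm]
  constructor
  · intro hm
    have hex : ∃ c, e'.rep 0 = c * e.rep 0 ∧ e'.rep 1 = c * e.rep 1 := by
      by_cases h0 : e.rep 0 = 0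
      · have h1 : e.rep 1 ≠ 0 := fun h1 => h.xy_ne_zeroE e ⟨h0, h1⟩
        refine ⟨e'.rep 1 / e.rep 1, ?_, by field_simp⟩
        rw [h0] at hm ⊢
        simpa [h1] using hm
      · refine ⟨e'.rep 0 / e.rep 0, by field_simp, ?_⟩
        field_simp
        linear_combination -hm
    obtain ⟨c, h0, h1⟩ := hex
    refine h.eq_or_eq_conj ?_ h0 h1
    rintro rfl
    exact h.xy_ne_zeroE e' ⟨by simpa using h0, by simpa using h1⟩
  · rintro (rfl | rfl)
    · ring
    · obtain ⟨c, hc, h0, h1, h2⟩ := h.conj_rep e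
      rw [h0, h1]; ring

theorem hOrd_linForm (h : Biell S T) (e e' : CurveE S T) :
    HOrd e' (toFrac (ellEq S T) (linForm (e.rep 0) (e.rep 1))) (h.fib e e') := by
  classical
  by_cases hm : eval e'.rep (linForm (e.rep 0) (e.rep 1)) = 0
  · have h1 := hOrd_linForm_aux h e' (h.xy_ne_zeroE e) hm
    have hfib : h.fib e = h.fib e' := by
      rcases (h.eval_linForm_eq_zero_iff e e').1 hm with rfl | rfl
      · rfl
      · rw [h.fib_conj]
    convert h1 using 1
    rw [hfib, Biell.fib, Finsupp.add_apply, Finsupp.single_eq_same]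
    simp only [← h.conj_eq_iff, Finsupp.single_apply]
    split_ifs <;> rfl
  · have h1 := (HU.toFrac (isWeightedHomogeneous_linForm _ _ rfl rfl) hm).hOrd h.niceE
    convert h1 using 1
    rw [h.eval_linForm_eq_zero_iff, not_or] at hm
    rw [Biell.fib, Finsupp.add_apply, Finsupp.single_apply, Finsupp.single_apply,
      if_neg (Ne.symm hm.1), if_neg (Ne.symm hm.2), add_zero]

theorem hOrd_X_two (h : Biell S T) {q : CurveC S T} (hz : q.rep 2 = 0) :
    HOrd q (toFrac (quartic S T) (X 2)) 1 := by
  obtain ⟨j, k, hj2, hk2, hkj, wj, wk, -, -, hj, -⟩ := h.exists_indices q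
  have hX : toFrac (quartic S T) (X j) ≠ 0 := toFrac_ne_zero_of_eval q.eval_rep (by simpa)
  have h1 := (unif_localCoord h.niceC hj wj hkj (Ne.symm hj2) hk2
    (h.pderiv_ne_zero hz hj2 hk2 hkj wj hj)).hOrd h.niceC
  have h2 := (HU.toFrac (isWeightedHomogeneous_X ℂ planeWt j) (p := q) (by simpa)).hOrd h.niceC
  have h3 := h1.mul h.niceC h2
  rw [localCoord_eq, Curve.affine, hz, zero_div, map_zero, sub_zero] at h3
  change HOrd q (_ / _ ^ 1 * _) _ at h3
  rw [pow_one, div_mul_cancel₀ _ hX] at h3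
  simpa using h3

/-- At a zero of `w` the order is computed on `C`: there `w` becomes `z²`, of order two, and the
ramification index is two. -/
theorem hOrd_w (h : Biell S T) (e : CurveE S T) [Decidable (e.rep 2 = 0)] :
    HOrd e (toFrac (ellEq S T) (X 2)) (if e.rep 2 = 0 then 1 else 0) := by
  split_ifs with hw
  · obtain ⟨q, rfl⟩ := proj_surjective e
    obtain ⟨c, hc, -, -, h2⟩ := proj_rep q
    rw [hw, mul_zero] at h2
    have hz : q.rep 2 = 0 := pow_eq_zero_iff two_ne_zero |>.1 h2
    have h1 := (hOrd_X_two h hz).pow h.niceC 2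
    have h0 : toFrac (ellEq S T) (X 2) ≠ 0 := by
      intro h0
      have := (projMap h).pull_toFrac (X 2)
      rw [h0, map_zero, aeval_X] at this
      change 0 = toFrac _ (X 2 ^ 2) at this
      rw [map_pow] at this
      exact h1.ne_zero this.symm
    obtain ⟨n, hn⟩ := exists_hOrd_toFrac h.niceE (proj S T q) (isWeightedHomogeneous_X ℂ ellWt 2) h0
    have h3 := hOrd_projMap_pull h hn
    rw [CurveMap.pull_toFrac, aeval_X, ramIndex, if_pos ((h.invol_eq_iff q).2 hz)] at h3
    change HOrd q (toFrac _ (X 2 ^ 2)) _ at h3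
    rw [map_pow] at h3
    have := h3.unique h.niceC h1
    have : n = 1 := by push_cast at this; omega
    rwa [this] at hn
  · exact (HU.toFrac (isWeightedHomogeneous_X ℂ ellWt 2) (p := e) (by simpa)).hOrd h.niceE

end Orders

end Elliptic

/-! ### Pull-back and push-forward of divisors -/

section PushPull

variable {S T : MvPolynomial (Fin 2) ℂ}

theorem pullback_apply (D : Divisor ellWt (ellEq S T)) (q : CurveC S T) :
    pullback S T D q = ramIndex S T q * D (proj S T q) := by
  -- A `finsum` with infinite support would be zero by convention; finiteness of the fibres of `π`
  -- rules this out.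
  have hfin : (Function.support fun q : CurveC S T =>
      Finsupp.single q (ramIndex S T q * D (proj S T q))).Finite := by
    have h1 : ((proj S T) ⁻¹' (D.support : Set (CurveE S T))).Finite := by
      refine Set.Finite.preimage' D.support.finite_toSet fun e _ => ?_
      obtain ⟨q, rfl⟩ := proj_surjective e
      refine (Set.toFinite {q, invol S T q}).subset fun q' hq' => ?_
      exact (proj_eq_iff q q').1 hq'
    refine h1.subset fun q hq => ?_
    rw [Set.mem_preimage, Finset.mem_coe, Finsupp.mem_support_iff]
    intro h0
    exact hq (by simp [h0])
  rw [pullback]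
  change Finsupp.applyAddHom q _ = _
  rw [AddMonoidHom.map_finsum _ hfin, finsum_eq_single _ q]
  · simp
  · intro q' hq'
    simp [hq']

theorem pullback_sub (D D' : Divisor ellWt (ellEq S T)) :
    pullback S T (D - D') = pullback S T D - pullback S T D' := by
  ext q
  rw [Finsupp.sub_apply, pullback_apply, pullback_apply, pullback_apply, Finsupp.sub_apply, mul_sub]

/-- For a point `q`, the degree of `π⁻¹(π q)` is two. -/
theorem ramIndex_mul_pushforward (D : Divisor planeWt (quartic S T)) (q : CurveC S T) :
    ramIndex S T q * pushforward S T D (proj S T q) = D q + D (invol S T q) := by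
  classical
  induction D using Finsupp.induction_linear with
  | zero => simp [pushforward]
  | add f g hf hg =>
    rw [pushforward, Finsupp.mapDomain_add, Finsupp.add_apply]
    rw [pushforward] at hf hg
    rw [mul_add, hf, hg]
    simp only [Finsupp.add_apply]; ring
  | single a n =>
    rw [pushforward, Finsupp.mapDomain_single, Finsupp.single_apply, Finsupp.single_apply,
      Finsupp.single_apply, ramIndex]
    simp only [proj_eq_iff]
    by_cases h1 : a = q
    · subst h1
      by_cases h2 : invol S T a = a
      · simp [h2, two_mul]
      · simp [h2, Ne.symm h2]
    · by_cases h2 : a = invol S T q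
      · by_cases h3 : invol S T q = q
        · exact absurd (h2.trans h3) h1
        · simp [h2, h3]
      · simp [h1, h2]

theorem ramIndex_ne_zero (q : CurveC S T) : ramIndex S T q ≠ 0 := by
  rw [ramIndex]; split_ifs <;> norm_num

theorem ramIndex_invol (q : CurveC S T) : ramIndex S T (invol S T q) = ramIndex S T q := by
  rw [ramIndex, ramIndex, invol_invol]
  by_cases hq : invol S T q = q
  · simp [hq]
  · simp [hq, Ne.symm hq]

/-- A polynomial plus its conjugate is a polynomial in `X 2 ^ 2`. -/
theorem exists_even (h : Biell S T) {P : MvPolynomial (Fin 3) ℂ} {d : ℕ}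
    (hP : P.IsWeightedHomogeneous planeWt d) : ∃ A : MvPolynomial (Fin 3) ℂ,
      A.IsWeightedHomogeneous ellWt d ∧ aeval (projMap h).poly A = P + aeval (sigmaMap h).poly P := by
  induction hP using IsWeightedHomogeneous.induction_on with
  | zero => exact ⟨0, isWeightedHomogeneous_zero ℂ ellWt d, by simp⟩
  | add p q _ _ hp hq =>
    obtain ⟨A, hA, eA⟩ := hp
    obtain ⟨B, hB, eB⟩ := hq
    exact ⟨A + B, hA.add hB, by rw [map_add, map_add, eA, eB]; ring⟩
  | monomial n r hn =>
    have hmon : ∀ n : Fin 3 →₀ ℕ, ∀ r : ℂ, (monomial n r : MvPolynomial (Fin 3) ℂ) =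
        C r * (X 0 ^ n 0 * X 1 ^ n 1 * X 2 ^ n 2) := by
      intro n r
      rw [monomial_eq, Finsupp.prod_fintype _ _ (fun i => by simp), Fin.prod_univ_three]
    have hd : n 0 + n 1 + n 2 = d := by
      rw [← hn, Finsupp.weight_apply, Finsupp.sum_fintype _ _ (fun i => by simp), Fin.sum_univ_three]
      simp
    rcases Nat.even_or_odd' (n 2) with ⟨m, hm | hm⟩
    · refine ⟨C (r + r) * (X 0 ^ n 0 * X 1 ^ n 1 * X 2 ^ m), ?_, ?_⟩
      · refine IsWeightedHomogeneous.C_mul ?_ _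
        have := (((isWeightedHomogeneous_X ℂ ellWt 0).pow (n 0)).mul
          ((isWeightedHomogeneous_X ℂ ellWt 1).pow (n 1))).mul
          ((isWeightedHomogeneous_X ℂ ellWt 2).pow m)
        convert this using 1
        simp
        omega
      · rw [hmon, hm]
        simp [projMap, sigmaMap]
        ring
    · refine ⟨0, isWeightedHomogeneous_zero ℂ ellWt d, ?_⟩
      rw [hmon, hm]
      simp [sigmaMap, Odd.neg_pow (⟨m, rfl⟩ : Odd (2 * m + 1))]

variable [hF : Fact (Prime (quartic S T))] [hF' : Fact (Prime (ellEq S T))]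

/-- An invariant polynomial function on the curve comes from the quotient. -/
theorem exists_pull_of_invariant_poly (h : Biell S T) {P : MvPolynomial (Fin 3) ℂ} {d : ℕ}
    (hP : P.IsWeightedHomogeneous planeWt d)
    (hinv : (sigmaMap h).pull (toFrac (quartic S T) P) = toFrac (quartic S T) P) :
    ∃ A : MvPolynomial (Fin 3) ℂ, A.IsWeightedHomogeneous ellWt d ∧
      (projMap h).pull (toFrac _ A) = toFrac (quartic S T) P := by
  obtain ⟨A, hA, e⟩ := exists_even h hP
  refine ⟨C (1 / 2) * A, hA.C_mul _, ?_⟩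
  rw [CurveMap.pull_toFrac] at hinv ⊢
  have h2 : algebraMap ℂ (CoordFrac (quartic S T)) (1 / 2) * 2 = 1 := by
    rw [← map_ofNat (algebraMap ℂ (CoordFrac (quartic S T))) 2, ← map_mul]
    norm_num
  rw [map_mul, e, algHom_C, MvPolynomial.algebraMap_eq, map_mul, map_add, hinv, toFrac_C]
  linear_combination toFrac (quartic S T) P * h2

/-- An invariant rational function comes from the quotient. -/
theorem exists_pull_of_invariant (h : Biell S T) {f : CoordFrac (quartic S T)}
    (hf : f ∈ functionField planeWt (quartic S T)) (hinv : (sigmaMap h).pull f = f) :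
    ∃ g ∈ functionField ellWt (ellEq S T), (projMap h).pull g = f := by
  obtain ⟨d, A, B, hA, hB, hB0, rfl⟩ := exists_div_of_mem hf
  have hσ : ∀ {P : MvPolynomial (Fin 3) ℂ} {d : ℕ}, P.IsWeightedHomogeneous planeWt d →
      (aeval (sigmaMap h).poly P).IsWeightedHomogeneous planeWt d := fun hP =>
    isWeightedHomogeneous_aeval (sigmaMap h).homogeneous hP
  have hσB0 : toFrac (quartic S T) (aeval (sigmaMap h).poly B) ≠ 0 := by
    rw [← CurveMap.pull_toFrac]
    exact (map_ne_zero _).2 hB0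
  -- Multiplying numerator and denominator by the conjugate of `B` turns the denominator into the
  -- invariant norm `B · σB`; the numerator is then invariant as well.
  obtain ⟨B', hB', eB⟩ := exists_pull_of_invariant_poly h (hB.mul (hσ hB)) (by
    rw [map_mul, map_mul, ← CurveMap.pull_toFrac, sigmaMap_pull_pull, mul_comm])
  have hinv' : (sigmaMap h).pull (toFrac (quartic S T) (A * aeval (sigmaMap h).poly B)) =
      toFrac (quartic S T) (A * aeval (sigmaMap h).poly B) := by
    rw [map_div₀, CurveMap.pull_toFrac, CurveMap.pull_toFrac, div_eq_div_iff hσB0 hB0] at hinv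
    rw [map_mul, map_mul, ← CurveMap.pull_toFrac _ B, sigmaMap_pull_pull, CurveMap.pull_toFrac,
      CurveMap.pull_toFrac, hinv]
  obtain ⟨A', hA', eA⟩ := exists_pull_of_invariant_poly h (hA.mul (hσ hB)) hinv'
  have hB0' : toFrac (ellEq S T) B' ≠ 0 := by
    intro h0
    rw [h0, map_zero, map_mul] at eB
    exact mul_ne_zero hB0 hσB0 eB.symm
  refine ⟨_, div_mem_functionField hA' hB' hB0', ?_⟩
  rw [map_div₀, eA, eB, map_mul, map_mul, mul_div_mul_right _ _ hσB0]

/-- The norm `f · σf` is invariant, hence comes from a function `g` on `E`. Comparing orders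
upstairs through `ramIndex_mul_pushforward` shows that `div g = π_* div f`. Thus the norm map is
well defined on classes. -/
theorem isPrincipal_pushforward (h : Biell S T) {D : Divisor planeWt (quartic S T)}
    (hD : IsPrincipal D) : IsPrincipal (pushforward S T D) := by
  rw [h.niceC.isPrincipal_iff] at hD
  obtain ⟨f, hf, hD⟩ := hD
  have hσ : ∀ q, HOrd q ((sigmaMap h).pull f) (D (invol S T q)) := fun q =>
    hOrd_sigmaMap_pull h (hD _)
  obtain ⟨g, hg, e⟩ := exists_pull_of_invariant h (mul_mem hf ((sigmaMap h).pull_mem hf))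
    (by rw [map_mul, sigmaMap_pull_pull, mul_comm])
  rw [h.niceE.isPrincipal_iff]
  refine ⟨g, hg, fun p => ?_⟩
  obtain ⟨q, rfl⟩ := proj_surjective p
  have h1 := (hD q).mul h.niceC (hσ q)
  have hg0 : g ≠ 0 := by
    rintro rfl
    rw [map_zero] at e
    exact h1.ne_zero e.symm
  obtain ⟨n, hn⟩ := exists_hOrd_of_mem h.niceE (proj S T q) hg hg0
  have h2 := hOrd_projMap_pull h hn
  rw [e] at h2
  have h3 := h2.unique h.niceC h1
  rw [← ramIndex_mul_pushforward] at h3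
  rwa [← mul_left_cancel₀ (ramIndex_ne_zero q) h3]

theorem exists_ramified (h : Biell S T) : ∃ q : CurveC S T, q.rep 2 = 0 := by
  obtain ⟨v, hv, h0⟩ := exists_binary_root h.homD four_ne_zero
  have hv' : (![v 0, v 1, 0] : Fin 3 → ℂ) ≠ 0 ∧ eval ![v 0, v 1, 0] (quartic S T) = 0 := by
    refine ⟨fun e => hv ?_, ?_⟩
    · funext i
      fin_cases i
      exacts [congrFun e 0, congrFun e 1]
    · rw [eval_quartic]
      rw [map_sub, map_pow] at h0
      simp only [Matrix.cons_val, fin_two_eta]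
      linear_combination h0
  refine ⟨Curve.mk _ hv', ?_⟩
  obtain ⟨c, hc, e⟩ := Curve.rep_mk (wt := planeWt) _ hv'
  rw [e 2]
  simp

theorem exists_C_of_degree_zero {P : MvPolynomial (Fin 3) ℂ} (hP : P.IsWeightedHomogeneous planeWt 0) :
    ∃ c, P = C c := by
  have h1 : planeWt = 1 := by funext i; fin_cases i <;> rfl
  rw [h1] at hP
  have h2 : P.IsHomogeneous 0 := hP
  exact ⟨_, totalDegree_eq_zero_iff_eq_C.1 (Nat.le_zero.1 h2.totalDegree_le)⟩

theorem hasValue_eq_const_of_hOrd_zero (h : Biell S T) {f : CoordFrac (quartic S T)}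
    (hf : f ∈ functionField planeWt (quartic S T))
    (h0 : ∀ q : CurveC S T, ∃ n : ℤ, 0 ≤ n ∧ HOrd q f n) : ∃ c, f = algebraMap ℂ _ c := by
  obtain ⟨d, A, B, hA, hB, hB0, rfl⟩ := exists_div_of_mem hf
  obtain ⟨P, hP, e⟩ := h.niceC.exists_polynomial (n := 0) (by rwa [zero_add]) hB hB0 h0
  obtain ⟨c, rfl⟩ := exists_C_of_degree_zero hP
  exact ⟨c, by rw [e, toFrac_C]⟩

/-- If `div f = π^* D`, then `σf / f` has neither zeros nor poles and is a constant `c`. At a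
ramification point `f` has even order, so `σ` preserves its leading coefficient and `c = 1`. Hence
`f` descends to `E`. An unramified double covering would allow `c = -1`. -/
theorem isPrincipal_of_pullback (h : Biell S T) {D : Divisor ellWt (ellEq S T)}
    (hD : IsPrincipal (pullback S T D)) : IsPrincipal D := by
  rw [h.niceC.isPrincipal_iff] at hD
  obtain ⟨f, hf, hD⟩ := hD
  simp only [pullback_apply] at hD
  have hσ : ∀ q, HOrd q ((sigmaMap h).pull f) (ramIndex S T q * D (proj S T q)) := fun q => by
    have := hOrd_sigmaMap_pull h (hD (invol S T q))
    rwa [ramIndex_invol, proj_invol] at this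
  obtain ⟨q, hq⟩ := exists_ramified h
  have hf0 : f ≠ 0 := (hD q).ne_zero
  obtain ⟨c, hc⟩ := hasValue_eq_const_of_hOrd_zero h (f := (sigmaMap h).pull f / f)
    (by rw [div_eq_mul_inv]; exact mul_mem ((sigmaMap h).pull_mem hf) (inv_mem_functionField hf))
    (fun q => ⟨0, le_rfl, by simpa using (hσ q).div h.niceC (hD q)⟩)
  have hc1 : c = 1 := by
    obtain ⟨j, k, hj2, hk2, hkj, wj, wk, -, -, hj, -, -, -, -⟩ := h.exists_indices q
    have ht := unif_localCoord h.niceC hj wj hkj (Ne.symm hj2) hk2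
      (h.pderiv_ne_zero hq hj2 hk2 hkj wj hj)
    obtain ⟨u, a, ha, hu, e⟩ := (hD q).mem_zpow h.niceC hf ht
    -- At a ramification point the uniformizer is `z` divided by a linear coordinate, so it changes
    -- sign under `σ`.
    have hσt : (sigmaMap h).pull (localCoord q j 2) = - localCoord q j 2 := by
      have haff : q.affine j 2 = 0 := by rw [Curve.affine, hq, zero_div]
      have hpj : (sigmaMap h).poly j = X j := by
        clear * - hj2
        fin_cases j
        exacts [rfl, rfl, absurd rfl hj2]
      rw [localCoord_eq, haff, map_zero, sub_zero, map_div₀, map_pow, CurveMap.pull_toFrac,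
        CurveMap.pull_toFrac, aeval_X, aeval_X, hpj]
      change toFrac _ (-X 2) / _ = _
      rw [map_neg, neg_div]
    have hinvq := (h.invol_eq_iff q).2 hq
    have hσu : HasValue q ((sigmaMap h).pull u) a := by
      apply (sigmaMap h).hasValue_pull
      change HasValue (invol S T q) u a
      rwa [hinvq]
    have heven : (ramIndex S T q * D (proj S T q)) = D (proj S T q) + D (proj S T q) := by
      rw [ramIndex, if_pos hinvq]; ring
    have hf' : (sigmaMap h).pull f =
        (sigmaMap h).pull u * localCoord q j 2 ^ (ramIndex S T q * D (proj S T q)) := by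
      conv_lhs => rw [e]
      rw [map_mul, map_zpow₀, hσt, heven, Even.neg_zpow ⟨_, rfl⟩]
    have ht0 := zpow_ne_zero (ramIndex S T q * D (proj S T q)) (ht.ne_zero h.niceC)
    rw [hf'] at hc
    have hcu : (sigmaMap h).pull u = algebraMap ℂ _ c * u := by
      rw [div_eq_iff hf0] at hc
      nth_rewrite 1 [e] at hc
      rw [← mul_assoc] at hc
      exact mul_right_cancel₀ ht0 hc
    have := hσu.unique (hcu ▸ (hasValue_algebraMap q c).mul hu)
    exact mul_right_cancel₀ ha (by linear_combination -this)
  rw [hc1, map_one, div_eq_one_iff_eq hf0] at hc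
  obtain ⟨g, hg, e⟩ := exists_pull_of_invariant h hf hc
  rw [h.niceE.isPrincipal_iff]
  refine ⟨g, hg, fun p => ?_⟩
  obtain ⟨q, rfl⟩ := proj_surjective p
  have hg0 : g ≠ 0 := by
    rintro rfl
    rw [map_zero] at e
    exact hf0 e.symm
  obtain ⟨n, hn⟩ := exists_hOrd_of_mem h.niceE (proj S T q) hg hg0
  have h2 := hOrd_projMap_pull h hn
  rw [e] at h2
  have h3 := h2.unique h.niceC (hD q)
  rwa [← mul_left_cancel₀ (ramIndex_ne_zero q) h3]

theorem Biell.linForm_pull (h : Biell S T) (a b : ℂ) :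
    (projMap h).pull (toFrac (ellEq S T) (linForm a b)) = toFrac (quartic S T) (linForm a b) := by
  rw [CurveMap.pull_toFrac]
  simp [linForm, projMap]

/-- The divisor of a linear form on the quartic. -/
theorem hOrd_linForm_quartic (h : Biell S T) (e : CurveE S T) (q : CurveC S T) :
    HOrd q (toFrac (quartic S T) (linForm (e.rep 0) (e.rep 1))) (pullback S T (h.fib e) q) := by
  rw [← h.linForm_pull, pullback_apply]
  exact hOrd_projMap_pull h (hOrd_linForm h e _)

/-- Points with `w = 0` lie over roots of `S² - T` and are determined by their images in `ℙ¹`.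
Finiteness ensures that the `finsum` in `branchDivisor` is a genuine sum. -/
theorem finite_branch (h : Biell S T) : {e : CurveE S T | e.rep 2 = 0}.Finite := by
  set G := S ^ 2 - T with hG
  set g : Polynomial ℂ := aeval ![1, Polynomial.X] G with hg
  have hev : ∀ t, g.eval t = eval ![1, t] G := by
    intro t
    have : (Polynomial.evalRingHom t).comp (aeval ![1, Polynomial.X] : MvPolynomial (Fin 2) ℂ →ₐ[ℂ]
        Polynomial ℂ).toRingHom = eval ![1, t] := by
      apply MvPolynomial.ringHom_ext
      · intro r; simp
      · intro i; fin_cases i <;> simp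
    exact congrArg (fun f => f G) this
  have hscale : ∀ x y : ℂ, x ≠ 0 → eval ![x, y] G = x ^ 4 * g.eval (y / x) := by
    intro x y hx
    rw [hev, ← eval_pair_smul h.homD]
    congr 3
    · ring
    · field_simp
  have hg0 : g ≠ 0 := by
    intro h0
    have hGX : G * X 0 = 0 := by
      apply MvPolynomial.funext
      intro v
      by_cases hv : v 0 = 0
      · simp [hv]
      · rw [map_mul, ← fin_two_eta v, hscale _ _ hv, h0]; simp
    have hG0 : G = 0 := (mul_eq_zero.1 hGX).resolve_right (X_ne_zero 0)
    obtain ⟨i, hi⟩ := h.ndrD ![1, 0] (fun e => by simpa using congrFun e 0) (by rw [← hG, hG0, map_zero])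
    rw [← hG, hG0] at hi
    simp at hi
  have hroot : ∀ e : CurveE S T, e.rep 2 = 0 → eval ![e.rep 0, e.rep 1] G = 0 := by
    intro e he
    have := e.eval_rep
    rw [eval_ellEq, he] at this
    rw [hG, map_sub, map_pow]
    linear_combination this
  -- The affine coordinate `y / x` on `ℙ¹`, with `none` as the point at infinity.
  let φ : CurveE S T → Option ℂ := fun e => if e.rep 0 = 0 then none else some (e.rep 1 / e.rep 0)
  refine Set.Finite.of_finite_image (f := φ) ?_ ?_
  · refine (((g.rootSet_finite ℂ).image some).insert none).subset ?_
    rintro _ ⟨e, he, rfl⟩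
    by_cases hx : e.rep 0 = 0
    · simp [φ, hx]
    · right
      refine ⟨e.rep 1 / e.rep 0, ?_, by simp [φ, hx]⟩
      rw [Polynomial.mem_rootSet]
      refine ⟨hg0, ?_⟩
      have := hroot e he
      rw [hscale _ _ hx] at this
      simpa [hx] using this
  · intro e he e' he' heq
    have he : e.rep 2 = 0 := he
    have he' : e'.rep 2 = 0 := he'
    by_cases hx : e.rep 0 = 0
    · have hx' : e'.rep 0 = 0 := by
        by_contra hx'
        simp [φ, hx, hx'] at heq
      have hy : e.rep 1 ≠ 0 := fun hy => h.xy_ne_zeroE e ⟨hx, hy⟩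
      have hy' : e'.rep 1 ≠ 0 := fun hy => h.xy_ne_zeroE e' ⟨hx', hy⟩
      exact CurveE.eq_of_scale (div_ne_zero hy' hy) (by rw [hx, hx', mul_zero]) (by field_simp)
        (by rw [he, he', mul_zero])
    · have hx' : e'.rep 0 ≠ 0 := by
        intro hx'
        simp [φ, hx, hx'] at heq
      simp only [φ, if_neg hx, if_neg hx', Option.some.injEq] at heq
      refine CurveE.eq_of_scale (div_ne_zero hx' hx) (by field_simp) ?_ (by rw [he, he', mul_zero])
      rw [div_eq_div_iff hx hx'] at heq
      field_simp
      linear_combination -heq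

open Classical in
theorem branchDivisor_apply (h : Biell S T) (e : CurveE S T) :
    branchDivisor S T e = if e.rep 2 = 0 then 1 else 0 := by
  have hset : {e : CurveE S T | ∃ q, invol S T q = q ∧ proj S T q = e} = {e | e.rep 2 = 0} := by
    ext e
    simp only [Set.mem_ofPred_eq]
    constructor
    · rintro ⟨q, hq, rfl⟩
      rw [h.invol_eq_iff] at hq
      obtain ⟨c, hc, -, -, h2⟩ := proj_rep q
      rw [hq] at h2
      simpa [hc] using h2.symm
    · intro he
      obtain ⟨q, rfl⟩ := proj_surjective e
      obtain ⟨c, hc, -, -, h2⟩ := proj_rep q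
      rw [he, mul_zero] at h2
      exact ⟨q, (h.invol_eq_iff q).2 (pow_eq_zero_iff two_ne_zero |>.1 h2), rfl⟩
  have hfin : {e : CurveE S T | ∃ q, invol S T q = q ∧ proj S T q = e}.Finite := by
    rw [hset]; exact finite_branch h
  rw [branchDivisor, finsum_mem_eq_finite_toFinset_sum _ hfin, Finsupp.finsetSum_apply]
  simp only [Finsupp.single_apply]
  rw [Finset.sum_ite_eq']
  simp [hset]

/-- Twice a fibre of `E` over the projective line is linearly equivalent to the branch divisor. -/
theorem two_nsmul_divClass_fib (h : Biell S T) (e : CurveE S T) :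
    2 • (divClass (h.fib e) : Pic ellWt (ellEq S T)) = divClass (branchDivisor S T) := by
  classical
  have h1 : 2 • (divClass (h.fib e) : Pic ellWt (ellEq S T)) = divClass (2 • h.fib e) := rfl
  rw [h1, eq_comm, h.niceE.divClass_eq_iff, h.niceE.isPrincipal_iff]
  -- The function is `ℓ² / w`, of degree zero since `w` has weight two; `w` vanishes simply at the
  -- branch points.
  have hord : ∀ p : CurveE S T, HOrd p (toFrac (ellEq S T) (linForm (e.rep 0) (e.rep 1)) ^ 2 /
      toFrac (ellEq S T) (X 2)) ((2 • h.fib e - branchDivisor S T) p) := by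
    intro p
    convert ((hOrd_linForm h e p).pow h.niceE 2).div h.niceE (hOrd_w h p) using 1
    rw [Finsupp.sub_apply, branchDivisor_apply h]
    simp
  refine ⟨_, ?_, hord⟩
  rw [← map_pow]
  refine div_mem_functionField (d := 2)
    (by simpa using (isWeightedHomogeneous_linForm (e.rep 0) (e.rep 1) (wt := ellWt) rfl rfl).pow 2)
    (isWeightedHomogeneous_X ℂ ellWt 2) ?_
  exact (hOrd_w h e).ne_zero

/-- All fibres of `E → ℙ¹` are equivalent through quotients of linear forms. -/
theorem divClass_fib_eq (h : Biell S T) (e e' : CurveE S T) :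
    (divClass (h.fib e) : Pic ellWt (ellEq S T)) = divClass (h.fib e') := by
  rw [h.niceE.divClass_eq_iff, h.niceE.isPrincipal_iff]
  refine ⟨_, div_mem_functionField (isWeightedHomogeneous_linForm (e'.rep 0) (e'.rep 1) rfl rfl)
    (isWeightedHomogeneous_linForm (e.rep 0) (e.rep 1) rfl rfl)
    (h.niceE.linForm_ne_zero (h.xy_ne_zeroE e)), fun p => ?_⟩
  exact (hOrd_linForm h e' p).div h.niceE (hOrd_linForm h e p)

end PushPull

/-! ### Differentials -/

section Differentials

theorem derivation_aeval {σ A M : Type*} [Fintype σ] [CommRing A] [Algebra ℂ A] [AddCommGroup M]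
    [Module ℂ M] [Module A M] (d : Derivation ℂ A M) (x : σ → A) (P : MvPolynomial σ ℂ) :
    d (aeval x P) = ∑ i, aeval x (pderiv i P) • d (x i) := by
  classical
  induction P using MvPolynomial.induction_on with
  | C a => simp
  | add P Q hP hQ => simp only [map_add, hP, hQ, add_smul, Finset.sum_add_distrib]
  | mul_X P k hP =>
    rw [map_mul, Derivation.leibniz, aeval_X, hP, Finset.smul_sum]
    simp [Pi.single_apply, add_smul, Finset.sum_add_distrib, smul_smul, apply_ite (aeval x)]

section Module

variable {A M : Type*} [CommRing A] [Algebra ℂ A] [AddCommGroup M] [Module ℂ M] [Module A M]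

theorem eq_neg_mul_smul_of_add_eq_zero {a b y : A} {u v : M} (h : a • u + b • v = 0)
    (hy : y * a = 1) : u = (-(y * b)) • v := by
  have h1 := congrArg (fun m => y • m) h
  simp only [smul_add, smul_smul, hy, one_smul, smul_zero] at h1
  rw [neg_smul]
  exact eq_neg_of_add_eq_zero_left h1

theorem smul_smul_add_smul {a b c : A} {u v : M} (h : u = b • v) :
    a • u + c • v = (a * b + c) • v := by
  rw [h, smul_smul, ← add_smul]

theorem derivation_div (d : Derivation ℂ A M) {f p q z a b : A} {m : M} (h : f * q = p)
    (hz : z * q = 1) (hp : d p = a • m) (hq : d q = b • m) : d f = (z * (a - f * b)) • m := by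
  have h2 := congrArg d h
  rw [Derivation.leibniz, hp, hq] at h2
  have h3 := congrArg (fun m => z • m) h2
  simp only [smul_add, smul_smul, hz, one_smul] at h3
  rw [mul_sub, sub_smul, ← h3, mul_smul, mul_smul, add_sub_cancel_left]

theorem smul_derivation_mul (d : Derivation ℂ A M) {f u t b : A} (h : d u = b • d t) :
    f • d (u * t) = (f * (u + t * b)) • d t := by
  rw [Derivation.leibniz, h, smul_smul, ← add_smul, smul_smul]

theorem eq_zero_of_smul_eq_zero {x y : A} {m : M} (h : x * y = 1) (h0 : y • m = 0) : m = 0 := by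
  rw [← one_smul A m, ← h, mul_smul, h0, smul_zero]

theorem sub_smul_eq_zero {a f f' : A} {m u v : M} (hu : u = f • m) (hv : v = f' • m)
    (h : a • u = v) : (a * f - f') • m = 0 := by
  rw [sub_smul, ← smul_smul, ← hu, ← hv, h, sub_self]

theorem smul_eq_smul_of_mul_eq {a f f' : A} {m u v : M} (hu : u = f • m) (hv : v = f' • m)
    (h : a * f = f') : a • u = v := by
  rw [hu, hv, smul_smul, h]

end Module

variable {wt : Fin 3 → ℕ} {F : MvPolynomial (Fin 3) ℂ} [hF : Fact (Prime F)]

theorem exists_inv_functionField {x : functionField wt F} (hx : x ≠ 0) :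
    ∃ y : functionField wt F, y * x = 1 ∧ (y : CoordFrac F) = (x : CoordFrac F)⁻¹ := by
  refine ⟨⟨_, inv_mem_functionField x.2⟩, Subtype.ext ?_, rfl⟩
  exact inv_mul_cancel₀ fun h => hx (Subtype.ext h)

theorem HasValue.exists_inv {p : Curve wt F} {x : functionField wt F} {c : ℂ}
    (h : HasValue p (x : CoordFrac F) c) (hc : c ≠ 0) :
    ∃ y : functionField wt F, y * x = 1 ∧ HasValue p (y : CoordFrac F) c⁻¹ := by
  obtain ⟨y, hy, e⟩ := exists_inv_functionField (x := x) fun h0 => h.ne_zero hc (by rw [h0]; rfl)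
  exact ⟨y, hy, e ▸ h.inv hc⟩

/-- Dehomogenization at a point as a map to the function field. -/
def dehomK (p : Curve wt F) {j : Fin 3} (hj : p.rep j ≠ 0) (hw : wt j = 1) :
    MvPolynomial (Fin 3) ℂ →ₐ[ℂ] functionField wt F :=
  (dehom wt F j).codRestrict (functionField wt F) fun P => (hasValue_dehom hj hw P).mem

theorem coe_dehomK (p : Curve wt F) {j : Fin 3} (hj : p.rep j ≠ 0) (hw : wt j = 1)
    (P : MvPolynomial (Fin 3) ℂ) : (dehomK p hj hw P : CoordFrac F) = dehom wt F j P := rfl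

variable {M : Type*} [AddCommGroup M] [Module ℂ M] [Module (functionField wt F) M]

theorem D_dehomK (d : Derivation ℂ (functionField wt F) M) (p : Curve wt F) {j : Fin 3} (hj : p.rep j ≠ 0) (hw : wt j = 1)
    {i k : Fin 3} (hij : i ≠ j) (hkj : k ≠ j) (hik : i ≠ k) (P : MvPolynomial (Fin 3) ℂ) :
    d (dehomK p hj hw P) =
      dehomK p hj hw (pderiv i P) • d (dehomK p hj hw (X i)) +
      dehomK p hj hw (pderiv k P) • d (dehomK p hj hw (X k)) := by
  have h1 : dehomK p hj hw = aeval fun i => dehomK p hj hw (X i) := by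
    apply MvPolynomial.algHom_ext; intro i; rw [aeval_X]
  have hX : toFrac F (X j) ≠ 0 := toFrac_ne_zero_of_eval p.eval_rep (by simpa)
  have h2 : dehomK p hj hw (X j) = 1 := by
    apply Subtype.ext
    rw [coe_dehomK, dehom, aeval_X, hw, pow_one, div_self hX]
    rfl
  conv_lhs => rw [h1, derivation_aeval, ← h1, sum_fin_three_eq hij hkj hik, h2]
  simp

/-- In a chart, the relation between the differentials of the coordinates. -/
theorem NiceCurve.D_relation (hC : NiceCurve wt F)
    (d : Derivation ℂ (functionField wt F) M) (p : Curve wt F) {j : Fin 3} (hj : p.rep j ≠ 0)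
    (hw : wt j = 1) {i k : Fin 3} (hij : i ≠ j) (hkj : k ≠ j) (hik : i ≠ k) :
    dehomK p hj hw (pderiv i F) • d (dehomK p hj hw (X i)) +
      dehomK p hj hw (pderiv k F) • d (dehomK p hj hw (X k)) = 0 := by
  rw [← D_dehomK d p hj hw hij hkj hik]
  have : dehomK p hj hw F = 0 := Subtype.ext (dehom_self hC j)
  rw [this, map_zero]

/-- The differentials of regular functions at `p` are regular multiples of that of some
uniformizer. -/
theorem NiceCurve.exists_D_eq_smul (hC : NiceCurve wt F)
    (d : Derivation ℂ (functionField wt F) M) (p : Curve wt F) :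
    ∃ t : functionField wt F, Unif p (t : CoordFrac F) ∧ ∀ f : functionField wt F, ∀ c,
      HasValue p (f : CoordFrac F) c → ∃ h : functionField wt F, ∃ c', HasValue p (h : CoordFrac F) c' ∧
        d f = h • d t := by
  obtain ⟨j, -, hw, hj⟩ := hC.exists_chart p
  obtain ⟨i, hij, hi⟩ := hC.exists_pderiv hj hw
  obtain ⟨k, hkj, hik⟩ := exists_third hij
  have hv : ∀ P, HasValue p (dehomK p hj hw P : CoordFrac F) (eval (p.affine j) P) :=
    hasValue_dehom hj hw
  refine ⟨dehomK p hj hw (X k - C (p.affine j k)), unif_localCoord hC hj hw hij hkj hik hi,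
    fun f c hf => ?_⟩
  have hDt : d (dehomK p hj hw (X k - C (p.affine j k))) =
      d (dehomK p hj hw (X k)) := by
    rw [map_sub, map_sub, ← MvPolynomial.algebraMap_eq, AlgHom.commutes, Derivation.map_algebraMap,
      sub_zero]
  rw [hDt]
  obtain ⟨y, hy, hyv⟩ := (hv (pderiv i F)).exists_inv hi
  let dx := d (dehomK p hj hw (X k))
  -- Differentiating the equation of the curve expresses `dx_i` as a regular multiple of `dx_k`. The
  -- quotient rule then extends this to all regular functions.
  have hrel := hC.D_relation d p hj hw hij hkj hik
  have hDi : d (dehomK p hj hw (X i)) =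
      (-(y * dehomK p hj hw (pderiv k F))) • dx :=
    eq_neg_mul_smul_of_add_eq_zero hrel hy
  have hpoly : ∀ P, ∃ h : functionField wt F, ∃ c', HasValue p (h : CoordFrac F) c' ∧
      d (dehomK p hj hw P) = h • dx := by
    intro P
    refine ⟨dehomK p hj hw (pderiv i P) * (-(y * dehomK p hj hw (pderiv k F))) +
      dehomK p hj hw (pderiv k P), _, ((hv _).mul ((hyv.mul (hv _)).neg)).add (hv _), ?_⟩
    rw [D_dehomK d p hj hw hij hkj hik]
    exact smul_smul_add_smul hDi
  obtain ⟨P, Q, e, hQ, -⟩ := hf.exists_dehom hj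
  obtain ⟨z, hz, hzv⟩ := (hv Q).exists_inv hQ
  obtain ⟨a, a', ha, eP⟩ := hpoly P
  obtain ⟨b, b', hb, eQ⟩ := hpoly Q
  refine ⟨z * (a - f * b), _, hzv.mul (ha.sub (hf.mul hb)), ?_⟩
  have h1 : f * dehomK p hj hw Q = dehomK p hj hw P := by
    apply Subtype.ext
    change (f : CoordFrac F) * dehom wt F j Q = dehom wt F j P
    rw [e, div_mul_cancel₀ _ ((hasValue_dehom hj hw Q).ne_zero hQ)]
  exact derivation_div _ h1 hz eP eQ

theorem NiceCurve.nonempty (hC : NiceCurve wt F) : Nonempty (Curve wt F) := by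
  obtain ⟨z, hz⟩ := hC.exists_root 1 0
  exact ⟨Curve.mk ![1, 0, z] ⟨fun h => by simpa using congrFun h 0, hz⟩⟩

/-- Near each point both differentials are multiples of the same `dt`. The ratio of the coefficients
at one point gives a global function `g` with `gω = ω'`, and the divisor of `g` is read off at every
point. -/
theorem NiceCurve.isPrincipal_of_isCanonicalDivisor (hC : NiceCurve wt F) {D D' : Divisor wt F}
    (hD : IsCanonicalDivisor D) (hD' : IsCanonicalDivisor D') : IsPrincipal (D' - D) := by
  obtain ⟨ω, hω, hD⟩ := hD
  obtain ⟨ω', hω', hD'⟩ := hD'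
  have key : ∀ p : Curve wt F, ∃ t f f' : functionField wt F, HOrd p (f : CoordFrac F) (D p) ∧
      HOrd p (f' : CoordFrac F) (D' p) ∧ ω = f • KaehlerDifferential.D ℂ _ t ∧
      ω' = f' • KaehlerDifferential.D ℂ _ t := by
    intro p
    obtain ⟨t, ht, hreg⟩ := hC.exists_D_eq_smul (KaehlerDifferential.D ℂ (functionField wt F)) p
    have hform : ∀ (ω : Ω[functionField wt F⁄ℂ]) (n : ℤ), HasOrderDiff p ω n →
        ∃ f : functionField wt F, HOrd p (f : CoordFrac F) n ∧
          ω = f • KaehlerDifferential.D ℂ _ t := by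
      rintro ω n ⟨s, f, hs, hf, rfl⟩
      rw [isUniformizer_iff] at hs
      rw [hasOrder_iff hC] at hf
      -- Changing the uniformizer to `s = u t` gives `ds = (u + t b) dt`, whose coefficient has the
      -- nonzero value of `u` at `p`.
      obtain ⟨u, c, hc, hu, e⟩ := ht.exists_mul hC hs
      obtain ⟨b, c', hb, eb⟩ := hreg ⟨u, hu.mem⟩ c hu
      have hst : s = ⟨u, hu.mem⟩ * t := Subtype.ext e
      refine ⟨f * (⟨u, hu.mem⟩ + t * b), ?_, ?_⟩
      · have hv := hu.add (ht.1.mul hb)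
        rw [zero_mul, add_zero] at hv
        simpa using hf.mul hC ((hv.hU hc).hOrd hC)
      · rw [hst]
        exact smul_derivation_mul _ eb
    obtain ⟨f, hf, e⟩ := hform ω _ (hD p)
    obtain ⟨f', hf', e'⟩ := hform ω' _ (hD' p)
    exact ⟨t, f, f', hf, hf', e, e'⟩
  obtain ⟨p₀⟩ := hC.nonempty
  obtain ⟨t₀, f₀, f₀', hf₀, hf₀', e₀, e₀'⟩ := key p₀
  have hne : ∀ {p : Curve wt F} {f : functionField wt F} {n : ℤ}, HOrd p (f : CoordFrac F) n →
      f ≠ 0 := fun h h0 => h.ne_zero (by rw [h0]; rfl)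
  obtain ⟨y, hy, -⟩ := exists_inv_functionField (hne hf₀)
  have hg : (f₀' * y) • ω = ω' :=
    smul_eq_smul_of_mul_eq (a := f₀' * y) e₀ e₀' (by rw [mul_assoc, hy, mul_one])
  rw [hC.isPrincipal_iff]
  refine ⟨(f₀' * y : functionField wt F), (f₀' * y).2, fun p => ?_⟩
  obtain ⟨t, f, f', hf, hf', e, e'⟩ := key p
  -- The difference annihilates `dt`. If it were nonzero it would be invertible, so `dt` and hence
  -- `ω` would vanish.
  have h0 : f₀' * y * f - f' = 0 := by
    by_contra h0
    obtain ⟨x, hx, -⟩ := exists_inv_functionField h0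
    refine hω ?_
    have h1 := eq_zero_of_smul_eq_zero hx (sub_smul_eq_zero e e' hg)
    rw [e, h1]
    exact smul_zero (A := Ω[functionField wt F⁄ℂ]) f
  have h1 : ((f₀' * y : functionField wt F) : CoordFrac F) * f = f' :=
    congrArg Subtype.val (sub_eq_zero.1 h0)
  have := hf'.div hC hf
  rwa [← h1, mul_div_cancel_right₀ _ hf.ne_zero] at this

/-! ### Derivations constructed through dual numbers. -/

section DualNumbers

variable {σ K : Type*} [Fintype σ] [Field K] [Algebra ℂ K]

/-- A derivation is the second component of an algebra map into the dual numbers. In this form it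
passes to quotients and localizations by the universal properties of rings. -/
theorem exists_dualNumber_aeval (x δ : σ → K) :
    ∃ ψ : MvPolynomial σ ℂ →ₐ[ℂ] TrivSqZeroExt K K, ∀ P, (ψ P).fst = aeval x P ∧
      (ψ P).snd = ∑ i, aeval x (pderiv i P) * δ i := by
  classical
  let ψ : MvPolynomial σ ℂ →ₐ[ℂ] TrivSqZeroExt K K :=
    aeval fun i => TrivSqZeroExt.inl (x i) + TrivSqZeroExt.inr (δ i)
  have hfst : ∀ P, (ψ P).fst = aeval x P := by
    intro P
    have : (TrivSqZeroExt.fstHom ℂ K K).comp ψ = aeval x := by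
      apply MvPolynomial.algHom_ext
      intro i
      simp [ψ]
    exact congrArg (fun f => f P) this
  refine ⟨ψ, fun P => ⟨hfst P, ?_⟩⟩
  induction P using MvPolynomial.induction_on with
  | C a =>
    rw [← MvPolynomial.algebraMap_eq, AlgHom.commutes]
    simp [TrivSqZeroExt.algebraMap_eq_inl']
  | add P Q hP hQ =>
    simp only [map_add, TrivSqZeroExt.snd_add, hP, hQ, add_mul, Finset.sum_add_distrib]
  | mul_X P k hP =>
    have hX : ψ (X k) = TrivSqZeroExt.inl (x k) + TrivSqZeroExt.inr (δ k) := aeval_X _ _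
    rw [map_mul, TrivSqZeroExt.snd_mul, hfst, hP, hX]
    simp [Pi.single_apply, add_mul, Finset.sum_add_distrib, apply_ite (aeval x), Finset.sum_mul,
      mul_assoc]
    congr 1
    funext i
    ring

/-- A dual number is invertible as soon as its first component is, so the map extends to the
fraction field. -/
theorem exists_dualNumber_lift {B : Type*} [CommRing B] [IsDomain B] [Algebra B K]
    [IsFractionRing B K] (ψ : B →+* TrivSqZeroExt K K) (hψ : ∀ b, (ψ b).fst = algebraMap B K b) :
    ∃ Ψ : K →+* TrivSqZeroExt K K, (∀ b, Ψ (algebraMap B K b) = ψ b) ∧ ∀ g, (Ψ g).fst = g := by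
  have hunit : ∀ y : nonZeroDivisors B, IsUnit (ψ y) := by
    intro y
    rw [TrivSqZeroExt.isUnit_iff_isUnit_fst, hψ]
    exact IsLocalization.map_units K y
  let Ψ : K →+* TrivSqZeroExt K K := IsLocalization.lift hunit
  have h1 : ∀ b, Ψ (algebraMap B K b) = ψ b := fun b => IsLocalization.lift_eq hunit b
  refine ⟨Ψ, h1, fun g => ?_⟩
  obtain ⟨a, b, hb, rfl⟩ := IsFractionRing.div_surjective (A := B) g
  have hb0 : algebraMap B K b ≠ 0 :=
    (map_ne_zero_iff _ (IsFractionRing.injective B K)).2 (nonZeroDivisors.ne_zero hb)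
  have h2 := congrArg (fun x => (Ψ x).fst) (div_mul_cancel₀ (algebraMap B K a) hb0)
  simp only [map_mul, TrivSqZeroExt.fst_mul, h1, hψ] at h2
  rw [eq_div_iff hb0]
  exact h2

theorem exists_derivation_of_dualNumber (Ψ : K →+* TrivSqZeroExt K K) (h : ∀ g, (Ψ g).fst = g)
    (hc : ∀ c : ℂ, (Ψ (algebraMap ℂ K c)).snd = 0) :
    ∃ d : Derivation ℂ K K, ∀ g, d g = (Ψ g).snd := by
  refine ⟨Derivation.mk'
    { toFun := fun f => (Ψ f).snd
      map_add' := fun f g => by rw [map_add, TrivSqZeroExt.snd_add]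
      map_smul' := fun c f => by
        rw [Algebra.smul_def, map_mul, TrivSqZeroExt.snd_mul, h, h, hc]
        simp [Algebra.smul_def] }
    (fun f g => ?_), fun g => rfl⟩
  change (Ψ (f * g)).snd = f * (Ψ g).snd + g * (Ψ f).snd
  rw [map_mul, TrivSqZeroExt.snd_mul, h, h]
  simp [mul_comm]

end DualNumbers

/-- The derivation of the function field induced by a vector field tangent to the cone. -/
theorem exists_derivation (δ : Fin 3 → CoordFrac F)
    (hδ : ∑ i, toFrac F (pderiv i F) * δ i = 0) :
    ∃ d : Derivation ℂ (CoordFrac F) (CoordFrac F), ∀ P : MvPolynomial (Fin 3) ℂ,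
      d (toFrac F P) = ∑ i, toFrac F (pderiv i P) * δ i := by
  have hx : (aeval fun i => toFrac F (X i)) = toFrac F := by
    apply MvPolynomial.algHom_ext
    intro i
    rw [aeval_X]
  obtain ⟨ψ, hψ⟩ := exists_dualNumber_aeval (fun i => toFrac F (X i)) δ
  rw [hx] at hψ
  have hψF : ψ F = 0 := by
    apply TrivSqZeroExt.ext
    · rw [(hψ F).1, toFrac_eq_zero_iff_dvd.2 dvd_rfl]; rfl
    · rw [(hψ F).2, hδ]; rfl
  let ψ' : MvPolynomial (Fin 3) ℂ ⧸ Ideal.span {F} →+* TrivSqZeroExt (CoordFrac F) (CoordFrac F) :=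
    Ideal.Quotient.lift _ ψ.toRingHom (by
      intro a ha
      obtain ⟨b, rfl⟩ := Ideal.mem_span_singleton.1 ha
      change ψ (F * b) = 0
      rw [map_mul, hψF, zero_mul])
  obtain ⟨Ψ, hΨ, hfst⟩ := exists_dualNumber_lift (K := CoordFrac F) ψ' (by
    intro b
    obtain ⟨P, rfl⟩ := Ideal.Quotient.mk_surjective b
    exact (hψ P).1)
  have hP : ∀ P, Ψ (toFrac F P) = ψ P := fun P => hΨ (Ideal.Quotient.mk _ P)
  obtain ⟨d, hd⟩ := exists_derivation_of_dualNumber Ψ hfst (by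
    intro c
    rw [← toFrac_C, hP, (hψ _).2]
    simp)
  exact ⟨d, fun P => by rw [hd, hP, (hψ P).2]⟩

end Differentials

/-! ### The canonical class of the quartic -/

section Canonical

variable {S T : MvPolynomial (Fin 2) ℂ}

theorem NoDoubleRoot.ne_zero {G : MvPolynomial (Fin 2) ℂ} (h : NoDoubleRoot G) : G ≠ 0 := by
  rintro rfl
  obtain ⟨i, hi⟩ := h ![1, 0] (fun e => by simpa using congrFun e 0) (map_zero _)
  simp at hi

theorem Biell.isHomogeneous_quartic (h : Biell S T) :
    (quartic S T).IsWeightedHomogeneous planeWt 4 := by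
  have hX : (X 2 ^ 2 : MvPolynomial (Fin 3) ℂ).IsWeightedHomogeneous planeWt 2 := by
    simpa using (isWeightedHomogeneous_X ℂ planeWt 2).pow 2
  have := (hX.add (isWeightedHomogeneous_inXY h.homS rfl rfl)).pow 2
  exact (by simpa using this : ((X 2 ^ 2 + inXY S) ^ 2).IsWeightedHomogeneous planeWt 4).sub
    (isWeightedHomogeneous_inXY h.homT rfl rfl)

variable [hF : Fact (Prime (quartic S T))] [hF' : Fact (Prime (ellEq S T))]

theorem Biell.isHomogeneous_pderiv (h : Biell S T) (i : Fin 3) :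
    (pderiv i (quartic S T)).IsWeightedHomogeneous planeWt 3 :=
  h.isHomogeneous_quartic.pderiv (by fin_cases i <;> rfl)

/-- Over a point of the plane where both `T` and `S² - T` are nonzero, neither factor of `F_z =
4z(z² + S)` vanishes on the curve. -/
theorem Biell.pderiv_two_ne_zero (h : Biell S T) :
    toFrac (quartic S T) (pderiv 2 (quartic S T)) ≠ 0 := by
  obtain ⟨v, hv⟩ : ∃ v, eval v (T * (S ^ 2 - T)) ≠ 0 := by
    by_contra! hv
    exact mul_ne_zero h.ndrT.ne_zero h.ndrD.ne_zero (MvPolynomial.funext fun v => by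
      rw [hv v, map_zero])
  rw [map_mul, map_sub, map_pow] at hv
  obtain ⟨r, hr⟩ := exists_sq (eval v T)
  obtain ⟨z, hz⟩ := exists_sq (r - eval v S)
  refine toFrac_ne_zero_of_eval (v := ![v 0, v 1, z]) ?_ ?_
  · rw [eval_quartic]
    simp [fin_two_eta, hz, hr]
  · rw [pderiv_two_quartic]
    have hr0 : r ≠ 0 := by rintro rfl; exact hv (by rw [← hr]; ring)
    have hz0 : z ≠ 0 := by
      rintro rfl
      refine hv ?_
      rw [← hr, show r = eval v S by linear_combination -hz]; ring
    simp [eval_inXY, fin_two_eta, hz, hr0, hz0]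

/-- `x_k` minus its value at `q` is a uniformizer with the same differential as `x_k`, and both `X
j` and `F_i` are nonzero at `q`. Only `l` contributes to the order. -/
theorem hasOrderDiff_of_eq (h : Biell S T) {q : CurveC S T} {j i k : Fin 3} (hj : q.rep j ≠ 0)
    (hij : i ≠ j) (hkj : k ≠ j) (hik : i ≠ k)
    (hw : planeWt j = 1) (hi : eval (q.affine j) (pderiv i (quartic S T)) ≠ 0)
    {ω : Ω[functionField planeWt (quartic S T)⁄ℂ]} {g : functionField planeWt (quartic S T)}
    (e : ω = g • KaehlerDifferential.D ℂ _ (dehomK q hj hw (X k)))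
    {c : ℂ} (hc : c ≠ 0) {l : CoordFrac (quartic S T)} {n : ℤ} (hl : HOrd q l n)
    (hg : (g : CoordFrac (quartic S T)) = algebraMap ℂ _ c * (l * toFrac _ (X j) ^ 2 /
      toFrac _ (pderiv i (quartic S T)))) : HasOrderDiff q ω n := by
  refine ⟨dehomK q hj hw (X k - C (q.affine j k)), g,
    isUniformizer_iff.2 (unif_localCoord h.niceC hj hw hij hkj hik hi), ?_, ?_⟩
  · rw [hasOrder_iff h.niceC, hg]
    have hi' : eval q.rep (pderiv i (quartic S T)) ≠ 0 := by
      rw [Curve.eval_affine (h.isHomogeneous_pderiv i)] at hi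
      exact fun h0 => hi (by rw [h0, zero_div])
    have hX : HU q (toFrac (quartic S T) (X j)) :=
      HU.toFrac (isWeightedHomogeneous_X ℂ planeWt j) (by simpa)
    have := ((hasValue_algebraMap q c).hU hc |>.hOrd h.niceC).mul h.niceC
      ((hl.mul h.niceC ((hX.pow 2).hOrd h.niceC)).div h.niceC
        ((HU.toFrac (h.isHomogeneous_pderiv i) hi').hOrd h.niceC))
    simpa using this
  · rw [e]
    congr 1
    rw [map_sub, map_sub, ← MvPolynomial.algebraMap_eq, AlgHom.commutes, Derivation.map_algebraMap,
      sub_zero]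

theorem smul_eq_mul_smul {A M : Type*} [CommRing A] [AddCommGroup M] [Module A M] {a b : A}
    {u v : M} (h : u = b • v) : a • u = (a * b) • v := by
  rw [h, smul_smul]

/-- The order of the differential `(l x² / F_z) d(y / x)`, in one chart. -/
theorem hasOrderDiff_chart (h : Biell S T) {q : CurveC S T} {j k : Fin 3} (hj : q.rep j ≠ 0)
    (hkj : k ≠ j) (hj2 : j ≠ 2) (hk2 : k ≠ 2) (hw : planeWt j = 1)
    {ω : Ω[functionField planeWt (quartic S T)⁄ℂ]} {g u : functionField planeWt (quartic S T)}
    (e : ω = g • KaehlerDifferential.D ℂ _ u) {c : ℂ} (hc : c ≠ 0)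
    (hu : (u : CoordFrac (quartic S T)) = toFrac _ (X k) / toFrac _ (X j))
    {l : CoordFrac (quartic S T)} {n : ℤ} (hl : HOrd q l n)
    (hg : (g : CoordFrac (quartic S T)) = algebraMap ℂ _ c * (l * toFrac _ (X j) ^ 2 /
      toFrac _ (pderiv 2 (quartic S T)))) : HasOrderDiff q ω n := by
  have hwk : planeWt k = 1 := by clear * -; fin_cases k <;> rfl
  have huk : u = dehomK q hj hw (X k) := by
    apply Subtype.ext
    rw [hu, coe_dehomK, dehom, aeval_X, hwk, pow_one]
  rw [huk] at e
  by_cases hz : eval (q.affine j) (pderiv 2 (quartic S T)) = 0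
  · have hk : eval (q.affine j) (pderiv k (quartic S T)) ≠ 0 := by
      obtain ⟨i, hij, hi⟩ := h.niceC.exists_pderiv hj hw
      have hi2 : i ≠ 2 := by
        rintro rfl
        exact hi hz
      rwa [← fin_three_eq hij hi2 hj2 hk2 hkj]
    obtain ⟨y, hy, -⟩ := (hasValue_dehom hj hw (pderiv k (quartic S T))).exists_inv
      (x := dehomK q hj hw (pderiv k (quartic S T))) hk
    have h1 := eq_neg_mul_smul_of_add_eq_zero (h.niceC.D_relation (KaehlerDifferential.D ℂ _) q hj hw
      hkj hj2.symm hk2) hy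
    have h2 := e.trans (smul_eq_mul_smul (a := g) h1)
    refine hasOrderDiff_of_eq h hj hkj hj2.symm hk2 hw hk h2 (neg_ne_zero.2 hc) hl ?_
    have hX : toFrac (quartic S T) (X j) ≠ 0 := toFrac_ne_zero_of_eval q.eval_rep (by simpa)
    have hFk : toFrac (quartic S T) (pderiv k (quartic S T)) ≠ 0 := toFrac_ne_zero_of_eval q.eval_rep (by
      rw [Curve.eval_affine (h.isHomogeneous_pderiv k)] at hk
      exact fun h0 => hk (by rw [h0, zero_div]))
    have hFz := h.pderiv_two_ne_zero
    have hy' : (y : CoordFrac (quartic S T)) * (toFrac (quartic S T) (pderiv k (quartic S T)) /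
        toFrac (quartic S T) (X j) ^ 3) = 1 := by
      rw [← dehom_eq_div (h.isHomogeneous_pderiv k)]
      exact congrArg Subtype.val hy
    have hy2 := eq_div_of_mul_eq (div_ne_zero hFk (pow_ne_zero _ hX)) hy'
    change (g : CoordFrac (quartic S T)) * -((y : CoordFrac (quartic S T)) *
      dehom planeWt _ j (pderiv 2 (quartic S T))) = _
    rw [hg, hy2, dehom_eq_div (h.isHomogeneous_pderiv 2), map_neg]
    field_simp
  · exact hasOrderDiff_of_eq h hj hj2.symm hkj hk2.symm hw hz e hc hl hg

theorem derivation_inv {A M : Type*} [CommRing A] [Algebra ℂ A] [AddCommGroup M] [Module ℂ M]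
    [Module A M] (d : Derivation ℂ A M) {u v : A} (h : u * v = 1) : d u = -(u ^ 2) • d v := by
  have h1 := congrArg d h
  rw [Derivation.leibniz, Derivation.map_one_eq_zero] at h1
  have h2 := congrArg (fun m => u • m) h1
  simp only [smul_add, smul_smul, h, one_smul, smul_zero] at h2
  rw [neg_smul, sq]
  exact eq_neg_of_add_eq_zero_right h2

/-- Adjunction for a plane quartic: `(x² / F_z) d(y / x)` times a linear form is a regular
differential whose divisor is cut out by that form. Here the form is pulled back from `ℙ¹`, and its
divisor on `C` is the pull-back of a fibre of `E`. -/
theorem isCanonicalDivisor_pullback_fib (h : Biell S T) (e : CurveE S T) :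
    IsCanonicalDivisor (pullback S T (h.fib e)) := by
  have hX : ∀ i : Fin 3, i ≠ 2 → toFrac (quartic S T) (X i) ≠ 0 := by
    intro i hi
    fin_cases i
    · simpa [linForm] using h.niceC.linear_ne_zero (a := 1) (b := 0) (by simp)
    · simpa [linForm] using h.niceC.linear_ne_zero (a := 0) (b := 1) (by simp)
    · exact absurd rfl hi
  have hFz := h.pderiv_two_ne_zero
  set l := toFrac (quartic S T) (linForm (e.rep 0) (e.rep 1)) with hl
  have hl0 : l ≠ 0 := h.niceC.linForm_ne_zero (h.xy_ne_zeroE e)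
  have hmem : ∀ i : Fin 3, l * toFrac _ (X i) ^ 2 / toFrac _ (pderiv 2 (quartic S T)) ∈
      functionField planeWt (quartic S T) := by
    intro i
    have hwi : planeWt i = 1 := by clear * -; fin_cases i <;> rfl
    rw [hl, ← map_pow, ← map_mul]
    refine div_mem_functionField (d := 3) ?_ (h.isHomogeneous_pderiv 2) hFz
    have := (isWeightedHomogeneous_linForm (e.rep 0) (e.rep 1) (wt := planeWt) rfl rfl).mul
      ((isWeightedHomogeneous_X ℂ planeWt i).pow 2)
    rw [hwi] at this
    exact this
  have hmem' : ∀ i k : Fin 3, i ≠ 2 → toFrac (quartic S T) (X k) / toFrac (quartic S T) (X i) ∈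
      functionField planeWt (quartic S T) := by
    intro i k hi
    have hwi : ∀ i, planeWt i = 1 := by intro i; fin_cases i <;> rfl
    have h1 := isWeightedHomogeneous_X ℂ planeWt k
    have h2 := isWeightedHomogeneous_X ℂ planeWt i
    rw [hwi] at h1 h2
    exact div_mem_functionField h1 h2 (hX i hi)
  let g : Fin 3 → functionField planeWt (quartic S T) := fun i => ⟨_, hmem i⟩
  let u : functionField planeWt (quartic S T) := ⟨_, hmem' 0 1 (by decide)⟩
  let v : functionField planeWt (quartic S T) := ⟨_, hmem' 1 0 (by decide)⟩
  have huv : u * v = 1 := by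
    apply Subtype.ext
    change toFrac (quartic S T) (X 1) / toFrac (quartic S T) (X 0) *
      (toFrac (quartic S T) (X 0) / toFrac (quartic S T) (X 1)) = 1
    have := hX 0 (by decide)
    have := hX 1 (by decide)
    field_simp
  refine ⟨g 0 • KaehlerDifferential.D ℂ _ u, ?_, fun q => ?_⟩
  · intro h0
    have hg0 : g 0 ≠ 0 := by
      intro h0
      have : l * toFrac _ (X 0) ^ 2 / toFrac _ (pderiv 2 (quartic S T)) = 0 := congrArg Subtype.val h0
      exact div_ne_zero (mul_ne_zero hl0 (pow_ne_zero _ (hX 0 (by decide)))) hFz this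
    obtain ⟨y, hy, -⟩ := exists_inv_functionField hg0
    have hDu := eq_zero_of_smul_eq_zero hy h0
    -- To see that `d(y / x) ≠ 0`, use the vector field `(0, F_z, -F_y)`, tangent to the cone. It
    -- annihilates `x` and sends `y` to `F_z ≠ 0`.
    obtain ⟨d, hd⟩ := exists_derivation (F := quartic S T)
      ![0, toFrac _ (pderiv 2 (quartic S T)), - toFrac _ (pderiv 1 (quartic S T))] (by
        rw [Fin.sum_univ_three]; simp; ring)
    let d' := d.compAlgebraMap (functionField planeWt (quartic S T))
    have h1 := d'.liftKaehlerDifferential_comp_D u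
    rw [hDu, map_zero] at h1
    have h2 : d (toFrac (quartic S T) (X 1) / toFrac (quartic S T) (X 0)) = 0 := h1.symm
    have h3 := congrArg d (div_mul_cancel₀ (toFrac (quartic S T) (X 1)) (hX 0 (by decide)))
    rw [Derivation.leibniz, h2, hd, hd] at h3
    simp [Fin.sum_univ_three, pderiv_X, Pi.single_apply] at h3
    exact hFz h3.symm
  · have hlo : HOrd q l (pullback S T (h.fib e) q) := hOrd_linForm_quartic h e q
    obtain ⟨j, hj2, hw, hj⟩ := h.niceC.exists_chart q
    obtain rfl | rfl : j = 0 ∨ j = 1 := by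
      clear * - hj2
      revert hj2; revert j; decide
    · exact hasOrderDiff_chart h hj (k := 1) (by decide) (by decide) (by decide) hw rfl one_ne_zero rfl
        hlo (by rw [map_one, one_mul])
    -- In the other chart `v = x / y` satisfies `du = -u² dv`, which turns the coefficient `ℓ x² /
    -- F_z` into `-ℓ y² / F_z`.
    · refine hasOrderDiff_chart h hj (k := 0) (g := g 0 * -(u ^ 2)) (u := v) (by decide) (by decide)
        (by decide) hw (smul_eq_mul_smul (derivation_inv _ huv)) (c := -1) (by simp) rfl hlo ?_
      change (l * toFrac _ (X 0) ^ 2 / toFrac _ (pderiv 2 (quartic S T))) *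
        -((toFrac (quartic S T) (X 1) / toFrac (quartic S T) (X 0)) ^ 2) = _
      have := hX 0 (by decide)
      rw [map_neg, map_one]
      field_simp

theorem isCanonicalPoint_fib (h : Biell S T) (e : CurveE S T) :
    IsCanonicalPoint S T (divClass (h.fib e)) := by
  refine ⟨⟨h.fib e, rfl, ?_, isCanonicalDivisor_pullback_fib h e⟩, two_nsmul_divClass_fib h e⟩
  rw [Biell.fib, map_add, Finsupp.degree_single, Finsupp.degree_single]
  rfl

/-- All canonical divisors of `C` are equivalent, and pull-back is injective on classes. -/
theorem eq_of_isCanonicalPoint (h : Biell S T) (e : CurveE S T) {η : Pic ellWt (ellEq S T)}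
    (hη : IsCanonicalPoint S T η) : η = divClass (h.fib e) := by
  obtain ⟨⟨D, rfl, -, hD⟩, -⟩ := hη
  rw [h.niceE.divClass_eq_iff]
  apply isPrincipal_of_pullback h
  rw [pullback_sub]
  exact h.niceC.isPrincipal_of_isCanonicalDivisor hD (isCanonicalDivisor_pullback_fib h e)

theorem existsUnique_isCanonicalPoint (h : Biell S T) :
    ∃! η : Pic ellWt (ellEq S T), IsCanonicalPoint S T η := by
  obtain ⟨e⟩ := h.niceE.nonempty
  exact ⟨_, isCanonicalPoint_fib h e, fun η hη => eq_of_isCanonicalPoint h e hη⟩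

end Canonical

/-! ### Plane quartics and lines -/

section Lines

/-- The increment is a multiple of `l`. With `l` the equation of a line, the linear term governs how
the curve leaves that line. -/
theorem exists_taylor_two {R : Type*} [CommRing R] [Algebra ℂ R] {σ : Type*} [Fintype σ]
    (y : σ → R) (l : R) (e : σ → R) (P : MvPolynomial σ ℂ) :
    ∃ B, aeval (fun i => y i + l * e i) P =
      aeval y P + l * ∑ j, e j * aeval y (pderiv j P) + l ^ 2 * B := by
  classical
  induction P using MvPolynomial.induction_on with
  | C a => exact ⟨0, by simp⟩
  | add P Q hP hQ =>
    obtain ⟨B, hB⟩ := hP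
    obtain ⟨B', hB'⟩ := hQ
    refine ⟨B + B', ?_⟩
    simp only [map_add, hB, hB', mul_add, Finset.sum_add_distrib]
    ring
  | mul_X P k hP =>
    obtain ⟨B, hB⟩ := hP
    refine ⟨B * (y k + l * e k) + e k * ∑ j, e j * aeval y (pderiv j P), ?_⟩
    have h1 : ∑ j, e j * aeval y (pderiv j (P * X k)) =
        e k * aeval y P + y k * ∑ j, e j * aeval y (pderiv j P) := by
      simp only [Derivation.leibniz, smul_eq_mul, map_add, map_mul, aeval_X, mul_add,
        Finset.sum_add_distrib, pderiv_X, Pi.single_apply, apply_ite (aeval y), map_zero,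
        Finset.mul_sum, mul_ite, mul_one, mul_zero, Finset.sum_ite_eq, Finset.mem_univ, if_true]
      congr 1
      exact Finset.sum_congr rfl fun i _ => by ring
    rw [map_mul, aeval_X, hB, map_mul, aeval_X, h1]
    ring

/-- Three linear forms and the dual basis. -/
structure LineFrame (α β l : MvPolynomial (Fin 3) ℂ) (u w e : Fin 3 → ℂ) : Prop where
  hα : α.IsWeightedHomogeneous planeWt 1
  hβ : β.IsWeightedHomogeneous planeWt 1
  hl : l.IsWeightedHomogeneous planeWt 1
  eq : ∀ i, X i = α * C (u i) + β * C (w i) + l * C (e i)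
  uα : eval u α = 1
  uβ : eval u β = 0
  ul : eval u l = 0
  wα : eval w α = 0
  wβ : eval w β = 1
  wl : eval w l = 0
  el : eval e l = 1

theorem LineFrame.swap {α β l : MvPolynomial (Fin 3) ℂ} {u w e : Fin 3 → ℂ}
    (h : LineFrame α β l u w e) : LineFrame β α l w u e :=
  ⟨h.hβ, h.hα, h.hl, fun i => by rw [h.eq i]; ring, h.wβ, h.wα, h.wl, h.uβ, h.uα, h.ul, h.el⟩

theorem planeWt_eq_one (i : Fin 3) : planeWt i = 1 := by fin_cases i <;> rfl

theorem exists_eq_linear {α : MvPolynomial (Fin 3) ℂ} (hα : α.IsWeightedHomogeneous planeWt 1) :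
    ∃ a : Fin 3 → ℂ, α = ∑ i, C (a i) * X i := by
  have h : ∀ i, ∃ c, pderiv i α = C c := fun i =>
    exists_C_of_degree_zero (hα.pderiv (by rw [planeWt_eq_one]))
  choose a ha using h
  refine ⟨a, ?_⟩
  have := hα.sum_weight_X_mul_pderiv
  simp only [planeWt_eq_one, one_smul, ha] at this
  rw [← this]
  exact Finset.sum_congr rfl fun i _ => mul_comm _ _

theorem eval_linear {α : MvPolynomial (Fin 3) ℂ} (hα : α.IsWeightedHomogeneous planeWt 1) (a b : ℂ)
    (v w : Fin 3 → ℂ) : eval (fun i => a * v i + b * w i) α = a * eval v α + b * eval w α := by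
  obtain ⟨c, rfl⟩ := exists_eq_linear hα
  simp only [map_sum, map_mul, eval_C, eval_X, Finset.mul_sum, ← Finset.sum_add_distrib]
  exact Finset.sum_congr rfl fun i _ => by ring

/-- The restriction of `F` to the line through `u` and `w`. -/
def lineRestrict (F : MvPolynomial (Fin 3) ℂ) (u w : Fin 3 → ℂ) : Polynomial ℂ :=
  aeval (fun i => Polynomial.C (u i) + Polynomial.X * Polynomial.C (w i)) F

theorem eval_lineRestrict (F : MvPolynomial (Fin 3) ℂ) (u w : Fin 3 → ℂ) (t : ℂ) :
    (lineRestrict F u w).eval t = eval (fun i => u i + t * w i) F := by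
  have : (Polynomial.evalRingHom t).comp (aeval (fun i => Polynomial.C (u i) + Polynomial.X *
      Polynomial.C (w i)) : MvPolynomial (Fin 3) ℂ →ₐ[ℂ] Polynomial ℂ).toRingHom =
      eval (fun i => u i + t * w i) := by
    apply MvPolynomial.ringHom_ext
    · intro r; simp
    · intro i
      simp only [RingHom.comp_apply, AlgHom.toRingHom_eq_coe, RingHom.coe_coe, aeval_X, eval_X,
        Polynomial.coe_evalRingHom, Polynomial.eval_add, Polynomial.eval_mul, Polynomial.eval_C,
        Polynomial.eval_X]
  exact congrArg (fun f => f F) this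

theorem derivative_lineRestrict (F : MvPolynomial (Fin 3) ℂ) (u w : Fin 3 → ℂ) :
    (lineRestrict F u w).derivative = ∑ j, lineRestrict (pderiv j F) u w * Polynomial.C (w j) := by
  have := derivation_aeval (Polynomial.derivative' (R := ℂ))
    (fun i => Polynomial.C (u i) + Polynomial.X * Polynomial.C (w i)) F
  refine this.trans (Finset.sum_congr rfl fun j _ => ?_)
  have h1 : Polynomial.derivative' (R := ℂ) (Polynomial.C (u j) + Polynomial.X * Polynomial.C (w j)) =
      Polynomial.C (w j) := by
    change Polynomial.derivative _ = _
    rw [Polynomial.derivative_add, Polynomial.derivative_C, Polynomial.derivative_mul,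
      Polynomial.derivative_C, Polynomial.derivative_X, zero_add, one_mul, mul_zero, add_zero]
  rw [h1]
  rfl

variable {F : MvPolynomial (Fin 3) ℂ} [hF : Fact (Prime F)]

theorem HasValue.aeval {wt : Fin 3 → ℕ} {p : Curve wt F} {f : CoordFrac F} {c : ℂ} (hf : HasValue p f c)
    (g : Polynomial ℂ) : HasValue p (Polynomial.aeval f g) (g.eval c) := by
  induction g using Polynomial.induction_on' with
  | add g g' h h' => simpa using h.add h'
  | monomial n a => simpa using (hasValue_algebraMap p a).mul (hf.pow n)

theorem LineFrame.rep_eq {α β l : MvPolynomial (Fin 3) ℂ} {u w e : Fin 3 → ℂ}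
    (h : LineFrame α β l u w e) {v : Fin 3 → ℂ} (hv : eval v l = 0) (i : Fin 3) :
    v i = eval v α * u i + eval v β * w i := by
  have := congrArg (eval v) (h.eq i)
  simpa [hv] using this

/-- The order of contact of a line with a nonsingular plane curve. -/
theorem LineFrame.mul_le_of_dvd {α β l : MvPolynomial (Fin 3) ℂ} {u w e : Fin 3 → ℂ}
    (h : LineFrame α β l u w e) (hC : NiceCurve planeWt F) {N : ℕ}
    (hN : F.IsWeightedHomogeneous planeWt (N + 1)) {r : Curve planeWt F} (hα : eval r.rep α ≠ 0)
    (hl : eval r.rep l = 0) {t : ℂ} (ht : eval r.rep β = t * eval r.rep α) {k : ℕ} (hk : 2 ≤ k)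
    (hg : (Polynomial.X - Polynomial.C t) ^ k ∣ lineRestrict F u w) {m n : ℤ}
    (hm : HOrd r (toFrac F β / toFrac F α - algebraMap ℂ _ t) m) (hn : HOrd r (toFrac F l) n) :
    k * m ≤ n := by
  have hα0 : toFrac F α ≠ 0 := toFrac_ne_zero_of_eval r.eval_rep hα
  have hpd : ∀ j, (pderiv j F).IsWeightedHomogeneous planeWt N := fun j =>
    hN.pderiv (by rw [planeWt_eq_one])
  have hrep := h.rep_eq hl
  set s := eval r.rep α
  have hrep' : ∀ i, r.rep i = s * (u i + t * w i) := fun i => by rw [hrep i, ht]; ring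
  have hpe : ∀ j, eval r.rep (pderiv j F) = s ^ N * eval (fun i => u i + t * w i) (pderiv j F) := by
    intro j
    rw [← eval_smul_of_isWeightedHomogeneous (hpd j)]
    congr 2
    funext i
    rw [planeWt_eq_one, pow_one, hrep' i]
  -- A multiple root of the restriction is also a root of its derivative, so the derivative of `F`
  -- at `r` in the direction of the line vanishes. Euler's relation then kills the direction `u`,
  -- and nonsingularity leaves a nonzero derivative in the transverse direction `e`.
  have hw : ∑ j, w j * eval r.rep (pderiv j F) = 0 := by
    have h1 : Polynomial.X - Polynomial.C t ∣ (lineRestrict F u w).derivative := by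
      obtain ⟨g, hg⟩ := hg
      obtain ⟨k, rfl⟩ : ∃ k', k = k' + 2 := ⟨k - 2, by omega⟩
      rw [hg, Polynomial.derivative_mul, Polynomial.derivative_pow]
      refine dvd_add (Dvd.dvd.mul_right (Dvd.dvd.mul_right (Dvd.dvd.mul_left (dvd_pow_self _ ?_) _) _) _)
        (Dvd.dvd.mul_right (dvd_pow_self _ ?_) _)
      · omega
      · omega
    have h2 := (Polynomial.dvd_iff_isRoot.1 h1).eq_zero
    rw [derivative_lineRestrict, Polynomial.eval_finsetSum] at h2
    simp only [Polynomial.eval_mul, Polynomial.eval_C, eval_lineRestrict] at h2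
    simp only [hpe]
    calc _ = s ^ N * ∑ j, eval (fun i => u i + t * w i) (pderiv j F) * w j := by
          rw [Finset.mul_sum]; exact Finset.sum_congr rfl fun _ _ => by ring
      _ = 0 := by rw [h2, mul_zero]
  have hu : ∑ j, u j * eval r.rep (pderiv j F) = 0 := by
    have h1 := congrArg (eval r.rep) hN.sum_weight_X_mul_pderiv
    simp only [map_sum, planeWt_eq_one, one_smul, map_mul, eval_X, map_nsmul, r.eval_rep,
      smul_zero] at h1
    have h2 : ∑ j, r.rep j * eval r.rep (pderiv j F) =
        s * (∑ j, u j * eval r.rep (pderiv j F) + t * ∑ j, w j * eval r.rep (pderiv j F)) := by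
      rw [Finset.mul_sum, ← Finset.sum_add_distrib, Finset.mul_sum]
      exact Finset.sum_congr rfl fun j _ => by rw [hrep' j]; ring
    rw [h1, hw, mul_zero, add_zero] at h2
    exact (mul_eq_zero.1 h2.symm).resolve_left hα
  have he : ∑ j, e j * eval r.rep (pderiv j F) ≠ 0 := by
    intro he
    obtain ⟨i, hi⟩ := hC.nonsingular r.rep r.rep_ne_zero r.eval_rep
    refine hi ?_
    have h1 : ∀ j, (if j = i then 1 else 0 : ℂ) = eval (Pi.single i 1) α * u j +
        eval (Pi.single i 1) β * w j + eval (Pi.single i 1) l * e j := by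
      intro j
      have := congrArg (eval (Pi.single i (1 : ℂ))) (h.eq j)
      simpa [Pi.single_apply] using this
    calc eval r.rep (pderiv i F) = ∑ j, (if j = i then 1 else 0 : ℂ) * eval r.rep (pderiv j F) := by simp
      _ = eval (Pi.single i 1) α * ∑ j, u j * eval r.rep (pderiv j F) +
          eval (Pi.single i 1) β * ∑ j, w j * eval r.rep (pderiv j F) +
          eval (Pi.single i 1) l * ∑ j, e j * eval r.rep (pderiv j F) := by
        simp only [Finset.mul_sum, ← Finset.sum_add_distrib]
        exact Finset.sum_congr rfl fun j _ => by rw [h1]; ring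
      _ = 0 := by rw [hu, hw, he]; ring
  set y : Fin 3 → MvPolynomial (Fin 3) ℂ := fun i => α * C (u i) + β * C (w i) with hy
  -- Expanding around the projection to the line gives `F = F(αu + βw) + l A`, where `A` takes the
  -- nonzero transverse derivative as its value at `r`. On the curve this reads `l A = -α ^ (N + 1)
  -- g(β / α)`, with `g` the restriction of `F` to the line. So the order of `l` is at least `k`
  -- times that of `β / α - t`.
  obtain ⟨B, hB⟩ := exists_taylor_two y l (fun i => C (e i)) F
  have hX : (fun i => y i + l * C (e i)) = X := by
    funext i
    rw [h.eq i]
  rw [hX, aeval_X_left, AlgHom.id_apply] at hB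
  set A := ∑ j, C (e j) * aeval y (pderiv j F) + l * B with hA
  have hyr : ∀ P, eval r.rep (aeval y P) = eval r.rep P := by
    intro P
    have : (eval r.rep).comp (aeval y : MvPolynomial (Fin 3) ℂ →ₐ[ℂ] MvPolynomial (Fin 3) ℂ).toRingHom =
        eval r.rep := by
      apply MvPolynomial.ringHom_ext
      · intro r; simp
      · intro i; simpa [hy] using (hrep i).symm
    exact congrArg (fun f => f P) this
  have hAr : eval r.rep A ≠ 0 := by
    rw [hA, map_add, map_mul, hl, zero_mul, add_zero, map_sum]
    simp only [map_mul, eval_C, hyr]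
    exact he
  have hlA : A * l = F - aeval y F := by rw [hA]; linear_combination -hB
  have hl0 : l ≠ 0 := by
    rintro rfl
    exact hn.ne_zero (map_zero _)
  have hAhom : A.IsWeightedHomogeneous planeWt N := by
    have hG : (aeval y F).IsWeightedHomogeneous planeWt (N + 1) := isWeightedHomogeneous_aeval (fun i => by
      have h1 := (h.hα.mul (isWeightedHomogeneous_C planeWt (u i))).add
        (h.hβ.mul (isWeightedHomogeneous_C planeWt (w i)))
      rw [planeWt_eq_one]
      exact h1) hN
    have h1 := weightedHomogeneousComponent_mul_right h.hl A N
    rw [hlA, (hN.sub hG).weightedHomogeneousComponent_same, ← hlA] at h1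
    rw [mul_right_cancel₀ hl0 h1]
    exact weightedHomogeneousComponent_isWeightedHomogeneous _ _
  have hrel : toFrac F l * toFrac F A =
      - (toFrac F α ^ (N + 1) * Polynomial.aeval (toFrac F β / toFrac F α) (lineRestrict F u w)) := by
    have h1 : toFrac F (aeval y F) = toFrac F α ^ (N + 1) *
        Polynomial.aeval (toFrac F β / toFrac F α) (lineRestrict F u w) := by
      have e1 : toFrac F (aeval y F) = aeval (fun i => toFrac F (y i)) F :=
        congrArg (fun f => f F) (comp_aeval y (toFrac F))
      have e2 : Polynomial.aeval (toFrac F β / toFrac F α) (lineRestrict F u w) =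
          aeval (fun i => algebraMap ℂ (CoordFrac F) (u i) +
            toFrac F β / toFrac F α * algebraMap ℂ (CoordFrac F) (w i)) F := by
        have := congrArg (fun f => f F) (comp_aeval (fun i => Polynomial.C (u i) + Polynomial.X *
          Polynomial.C (w i)) (Polynomial.aeval (R := ℂ) (toFrac F β / toFrac F α)))
        simp only [map_add, map_mul, Polynomial.aeval_C, Polynomial.aeval_X] at this
        exact this
      rw [e1, e2, ← aeval_smul_of_isWeightedHomogeneous hN]
      congr 2
      funext i
      simp only [hy, map_add, map_mul, toFrac_C, planeWt_eq_one, pow_one]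
      field_simp
    have h2 := congrArg (toFrac F) hB
    rw [toFrac_eq_zero_iff_dvd.2 dvd_rfl] at h2
    rw [← h1, hA]
    simp only [map_add, map_mul, map_pow] at h2 ⊢
    linear_combination -h2
  obtain ⟨g, hg⟩ := hg
  have hval : HasValue r (toFrac F β / toFrac F α) t := by
    have := hasValue_div h.hβ h.hα hα
    rwa [ht, mul_div_assoc, div_self hα, mul_one] at this
  have hA1 : HU r (toFrac F A) := HU.toFrac hAhom hAr
  have hne : toFrac F l * toFrac F A ≠ 0 := mul_ne_zero hn.ne_zero hA1.ne_zero
  rw [hrel, hg] at hne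
  simp only [map_mul, map_pow, map_sub, Polynomial.aeval_X, Polynomial.aeval_C] at hne
  obtain ⟨n', hn'⟩ := (hval.aeval g).exists_hOrd hC (by rintro h0; exact hne (by rw [h0]; ring))
  have h3 := (hn.mul hC (hA1.hOrd hC))
  have h4 := (((HU.toFrac h.hα hα).pow (N + 1)).hOrd hC).mul hC ((hm.pow hC k).mul hC hn')
  have h5 := ((hasValue_algebraMap r (-1)).hU (by simp)).hOrd hC |>.mul hC h4
  rw [hrel, hg] at h3
  have h6 := h3.unique hC (n := 0 + (0 + (k * m + n'))) (by
    convert h5 using 1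
    simp)
  have h7 := hn'.nonneg_of_hasValue (hval.aeval g)
  linarith

end Lines

/-! ### Plane quartics are not hyperelliptic -/

section NonHyperelliptic

/-- The linear form with given coefficients. -/
def lin (a : Fin 3 → ℂ) : MvPolynomial (Fin 3) ℂ := ∑ i, C (a i) * X i

theorem isWeightedHomogeneous_lin (a : Fin 3 → ℂ) : (lin a).IsWeightedHomogeneous planeWt 1 := by
  refine IsWeightedHomogeneous.sum _ _ _ fun i _ => ?_
  have := (isWeightedHomogeneous_C planeWt (a i)).mul (isWeightedHomogeneous_X ℂ planeWt i)
  rwa [planeWt_eq_one] at this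

theorem eval_lin (a v : Fin 3 → ℂ) : eval v (lin a) = a ⬝ᵥ v := by
  simp [lin, dotProduct]

theorem lin_ne_zero {a : Fin 3 → ℂ} (ha : a ≠ 0) : lin a ≠ 0 := by
  intro h
  apply ha
  funext i
  have := congrArg (eval (Pi.single i (1 : ℂ))) h
  simpa [eval_lin] using this

/-- The independent forms `a, b` are completed by the coordinate form `X j` for some `j` at which `a
× b` is nonzero. The determinant of the three rows is that coordinate up to sign, and the columns of
the inverse matrix form the dual basis. -/
theorem exists_lineFrame {a b : Fin 3 → ℂ} (ha : a ≠ 0) (hb : ∀ c : ℂ, b ≠ c • a) :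
    ∃ (β : MvPolynomial (Fin 3) ℂ) (u w e : Fin 3 → ℂ), LineFrame (lin b) β (lin a) u w e := by
  have hcross : crossProduct a b ≠ 0 := by
    rw [crossProduct_ne_zero_iff_linearIndependent, LinearIndependent.pair_iff' ha]
    exact fun c hc => hb c hc.symm
  obtain ⟨j, hj⟩ := Function.ne_iff.1 hcross
  set M : Matrix (Fin 3) (Fin 3) ℂ := Matrix.of ![b, Pi.single j 1, a] with hM
  have hdet : IsUnit M.det := by
    rw [isUnit_iff_ne_zero, hM, Matrix.det_fin_three]
    rw [cross_apply] at hj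
    intro h0
    apply hj
    fin_cases j
    all_goals
      simp at h0 ⊢
      linear_combination h0
  have h1 : M⁻¹ * M = 1 := Matrix.nonsing_inv_mul M hdet
  have h2 : M * M⁻¹ = 1 := Matrix.mul_nonsing_inv M hdet
  have hrow : ∀ k l : Fin 3, eval (fun i => M⁻¹ i l) (lin (M k)) = if k = l then 1 else 0 := by
    intro k l
    have := congrFun (congrFun h2 k) l
    rw [Matrix.mul_apply, Matrix.one_apply] at this
    rw [eval_lin, dotProduct, this]
  refine ⟨lin (M 1), fun i => M⁻¹ i 0, fun i => M⁻¹ i 1, fun i => M⁻¹ i 2,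
    ⟨isWeightedHomogeneous_lin _, isWeightedHomogeneous_lin _, isWeightedHomogeneous_lin _, fun i => ?_,
      hrow 0 0, hrow 1 0, hrow 2 0, hrow 0 1, hrow 1 1, hrow 2 1, hrow 2 2⟩⟩
  apply MvPolynomial.funext
  intro v
  have h3 : v = M⁻¹.mulVec (M.mulVec v) := by rw [Matrix.mulVec_mulVec, h1, Matrix.one_mulVec]
  have h4 := congrFun h3 i
  rw [Matrix.mulVec, dotProduct, Fin.sum_univ_three] at h4
  have h5 : ∀ k, M.mulVec v k = eval v (lin (M k)) := fun k => by rw [eval_lin]; rfl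
  rw [h5, h5, h5] at h4
  have e0 : M 0 = b := rfl
  have e2 : M 2 = a := rfl
  rw [e0, e2] at h4
  simp only [map_add, map_mul, eval_C, eval_X]
  rw [h4]
  ring

variable {F : MvPolynomial (Fin 3) ℂ} [hF : Fact (Prime F)]

theorem toFrac_linear_ne_zero {N : ℕ} (hN : F.IsWeightedHomogeneous planeWt N) (h2 : 2 ≤ N)
    {l : MvPolynomial (Fin 3) ℂ} (hl : l.IsWeightedHomogeneous planeWt 1) (hl0 : l ≠ 0) :
    toFrac F l ≠ 0 := by
  intro h0
  rw [toFrac_eq_zero_iff_dvd] at h0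
  have h1 : planeWt = 1 := funext planeWt_eq_one
  rw [h1] at hN hl
  have hN' : F.IsHomogeneous N := hN
  have hl' : l.IsHomogeneous 1 := hl
  have := totalDegree_le_of_dvd_of_isDomain h0 hl0
  rw [hN'.totalDegree hF.out.ne_zero, hl'.totalDegree hl0] at this
  omega

/-- For `k ≥ 2` this is the contact estimate, where `β / α - t` vanishes at `r` and hence has order
at least one. For `k = 1` only the vanishing of `l` is needed. -/
theorem LineFrame.le_contact {α β l : MvPolynomial (Fin 3) ℂ} {u w e : Fin 3 → ℂ}
    (h : LineFrame α β l u w e) (hC : NiceCurve planeWt F) {N : ℕ}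
    (hN : F.IsWeightedHomogeneous planeWt (N + 1)) (hN1 : 1 ≤ N) {r : Curve planeWt F} {s t : ℂ}
    (hs : s ≠ 0) (hr : ∀ i, r.rep i = s * (u i + t * w i)) {k : ℕ} (hk : 1 ≤ k)
    (hg : (Polynomial.X - Polynomial.C t) ^ k ∣ lineRestrict F u w) {n : ℤ}
    (hn : HOrd r (toFrac F l) n) : k ≤ n := by
  have hev : ∀ {γ : MvPolynomial (Fin 3) ℂ}, γ.IsWeightedHomogeneous planeWt 1 →
      eval r.rep γ = s * eval u γ + s * t * eval w γ := by
    intro γ hγ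
    rw [← eval_linear hγ]
    congr 2
    funext i
    rw [hr]
    ring
  have hα := hev h.hα
  have hβ := hev h.hβ
  have hl := hev h.hl
  rw [h.uα, h.wα] at hα
  rw [h.uβ, h.wβ] at hβ
  rw [h.ul, h.wl] at hl
  simp only [mul_one, mul_zero, add_zero, zero_add] at hα hβ hl
  rcases hk.eq_or_lt with rfl | hk
  · have := (hn.toFrac_nonneg hC h.hl).2 hl
    push_cast
    linarith
  · have hα0 : toFrac F α ≠ 0 := toFrac_ne_zero_of_eval r.eval_rep (by rw [hα]; exact hs)
    have hval : HasValue r (toFrac F β / toFrac F α - algebraMap ℂ _ t) 0 := by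
      have := (hasValue_div (p := r) h.hβ h.hα (by rw [hα]; exact hs)).sub (hasValue_algebraMap r t)
      rwa [hα, hβ, mul_div_cancel_left₀ _ hs, sub_self] at this
    have hγ : (β - C t * α).IsWeightedHomogeneous planeWt 1 := by
      have := (isWeightedHomogeneous_C planeWt t).mul h.hα
      rw [zero_add] at this
      exact h.hβ.sub this
    have hne : toFrac F β / toFrac F α - algebraMap ℂ _ t ≠ 0 := by
      have := toFrac_linear_ne_zero hN (by omega) hγ (fun h0 => by
        have := congrArg (eval w) h0
        simp [h.wβ, h.wα] at this)
      intro h0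
      apply this
      rw [map_sub, map_mul, toFrac_C]
      rw [sub_eq_zero, div_eq_iff hα0] at h0
      rw [h0, sub_self]
    obtain ⟨m, hm⟩ := hval.exists_hOrd hC hne
    have h1 := h.mul_le_of_dvd hC hN (by rw [hα]; exact hs) hl (t := t) (by rw [hα, hβ]; ring) hk hg hm hn
    have h2 := hm.pos_of_hasValue hC hval
    nlinarith

end NonHyperelliptic

/-! ### Counting the intersections of a line with a quartic. -/

section NonHyperelliptic

variable {F : MvPolynomial (Fin 3) ℂ} [hF : Fact (Prime F)]

/-- The drop in degree of the restriction to a line is the multiplicity of its root at infinity.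
Reversing coefficients gives `F(w + s u) = s ^ N g(1 / s)` for `s ≠ 0`, with `g` the restriction. -/
theorem X_pow_dvd_lineRestrict {N : ℕ} (hN : F.IsWeightedHomogeneous planeWt N) (u w : Fin 3 → ℂ)
    (h : (lineRestrict F u w).natDegree ≤ N) :
    Polynomial.X ^ (N - (lineRestrict F u w).natDegree) ∣ lineRestrict F w u := by
  set g := lineRestrict F u w
  refine ⟨g.reverse, Polynomial.eq_of_infinite_eval_eq _ _ ?_⟩
  refine (Set.finite_singleton (0 : ℂ)).infinite_compl.mono fun s hs => ?_
  have hs0 : s ≠ 0 := hs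
  change _ = _
  rw [Polynomial.eval_mul, Polynomial.eval_pow, Polynomial.eval_X, eval_lineRestrict]
  let _ : Invertible s⁻¹ := invertibleOfNonzero (inv_ne_zero hs0)
  have h1 := Polynomial.eval₂_reverse_mul_pow (RingHom.id ℂ) s⁻¹ g
  rw [invOf_eq_inv, inv_inv] at h1
  change Polynomial.eval s g.reverse * _ = Polynomial.eval s⁻¹ g at h1
  rw [eval_lineRestrict] at h1
  have h2 := eval_smul_of_isWeightedHomogeneous hN s (fun i => u i + s⁻¹ * w i)
  have h3 : (fun i => s ^ planeWt i * (u i + s⁻¹ * w i)) = fun i => w i + s * u i := by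
    funext i
    rw [planeWt_eq_one]
    field_simp
    ring
  rw [h3, ← h1] at h2
  rw [h2, ← Nat.sub_add_cancel h, pow_add, Nat.add_sub_cancel, inv_pow]
  field_simp

theorem exists_rep_eq {u : Fin 3 → ℂ} (hu : u ≠ 0) (h : eval u F = 0) :
    ∃ (r : Curve planeWt F) (s : ℂ), s ≠ 0 ∧ ∀ i, r.rep i = s * u i := by
  obtain ⟨c, hc, e⟩ := Curve.exists_scale (q := (Curve.mk u ⟨hu, h⟩ : Curve planeWt F)) rfl
  refine ⟨Curve.mk u ⟨hu, h⟩, c⁻¹, inv_ne_zero hc, fun i => ?_⟩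
  rw [e i, planeWt_eq_one]
  field_simp

/-- Bézout for the line `l = 0`, where `E` bounds the excess of the order of `l` over that of `α`.
On the part of the line with `α ≠ 0`, contact of order `k` forces `E ≥ k`, so the restriction `g`
has degree at most two. The remaining `k = 4 - deg g ≥ 2` intersections fall at the single point `w`
where `α = 0`. There the order of `l` is at least `k` times that of `α`, so `E ≥ k - 1`. The total
is at least three, against the bound two. -/
theorem LineFrame.false_of_contact_le {α β l : MvPolynomial (Fin 3) ℂ} {u w e : Fin 3 → ℂ}
    (h : LineFrame α β l u w e) (hC : NiceCurve planeWt F) (hN : F.IsWeightedHomogeneous planeWt 4)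
    {E : Curve planeWt F → ℤ} (hE : ∀ s : Finset (Curve planeWt F), ∑ r ∈ s, E r ≤ 2)
    (hlE : ∀ r m n, HOrd r (toFrac F l) m → HOrd r (toFrac F α) n → m - n ≤ E r) : False := by
  classical
  have hne : ∀ {γ : MvPolynomial (Fin 3) ℂ}, γ.IsWeightedHomogeneous planeWt 1 → ∀ v, eval v γ = 1 →
      v ≠ 0 ∧ toFrac F γ ≠ 0 := by
    intro γ hγ v hv
    refine ⟨?_, toFrac_linear_ne_zero hN (by norm_num) hγ (by rintro rfl; simp at hv)⟩
    rintro rfl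
    have := eval_linear hγ 0 0 0 0
    simp at this hv
    simp [this] at hv
  have hl0 := (hne h.hl e h.el).2
  have huw : ∀ t, eval (fun i => u i + t * w i) α = 1 := by
    intro t
    have := eval_linear h.hα 1 t u w
    simpa [h.uα, h.wα] using this
  set g := lineRestrict F u w with hg
  have hpt : ∀ t, ∃ r : Curve planeWt F, g.IsRoot t → ∃ s, s ≠ 0 ∧ ∀ i, r.rep i = s * (u i + t * w i) := by
    intro t
    by_cases ht : g.IsRoot t
    · rw [Polynomial.IsRoot.def, hg, eval_lineRestrict] at ht
      obtain ⟨r, s, hs, hr⟩ := exists_rep_eq (hne h.hα _ (huw t)).1 ht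
      exact ⟨r, fun _ => ⟨s, hs, hr⟩⟩
    · obtain ⟨r⟩ := hC.nonempty
      exact ⟨r, fun h => absurd h ht⟩
  choose pt hpt using hpt
  have hval : ∀ t, g.IsRoot t → eval (pt t).rep α ≠ 0 ∧
      eval (pt t).rep β = t * eval (pt t).rep α := by
    intro t ht
    obtain ⟨s, hs, hr⟩ := hpt t ht
    have hr' : (pt t).rep = fun i => s * u i + (s * t) * w i := by
      funext i
      rw [hr i]
      ring
    rw [hr', eval_linear h.hα, eval_linear h.hβ, h.uα, h.wα, h.uβ, h.wβ]
    exact ⟨by simpa using hs, by ring⟩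
  have hcontact : ∀ t, g.IsRoot t → ∀ k : ℕ, 1 ≤ k → (Polynomial.X - Polynomial.C t) ^ k ∣ g →
      (k : ℤ) ≤ E (pt t) := by
    intro t ht k hk hdvd
    obtain ⟨s, hs, hr⟩ := hpt t ht
    obtain ⟨n, hn⟩ := exists_hOrd_toFrac hC (pt t) h.hl hl0
    have h1 := h.le_contact hC (N := 3) hN (by norm_num) hs hr hk hdvd hn
    have h2 := hlE _ _ _ hn ((HU.toFrac h.hα (hval t ht).1).hOrd hC)
    linarith
  have hE2 : ∀ r, E r ≤ 2 := fun r => by simpa using hE {r}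
  have hg0 : g ≠ 0 := by
    intro h0
    have := hcontact 0 (by rw [h0]; simp) 3 (by norm_num) (by rw [h0]; exact dvd_zero _)
    have := hE2 (pt 0)
    norm_num at *
    linarith
  set R := g.roots.toFinset with hR
  have hroot : ∀ t ∈ R, g.IsRoot t := fun t ht => Polynomial.isRoot_of_mem_roots (Multiset.mem_toFinset.1 ht)
  have hinj : Set.InjOn pt R := by
    intro t ht t' ht' e
    have h1 := hval t (hroot t ht)
    have h2 := hval t' (hroot t' ht')
    rw [← e] at h2
    exact mul_right_cancel₀ h1.1 (h1.2.symm.trans h2.2)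
  have hsum : (g.natDegree : ℤ) ≤ ∑ r ∈ R.image pt, E r := by
    rw [Finset.sum_image hinj, (IsAlgClosed.splits g).natDegree_eq_card_roots,
      ← Multiset.toFinset_sum_count_eq, Nat.cast_sum]
    refine Finset.sum_le_sum fun t ht => hcontact t (hroot t ht) _ ?_ ?_
    · exact Multiset.one_le_count_iff_mem.2 (Multiset.mem_toFinset.1 ht)
    · rw [Polynomial.count_roots]
      exact Polynomial.pow_rootMultiplicity_dvd g t
  have hdeg : g.natDegree ≤ 2 := by exact_mod_cast hsum.trans (hE _)
  obtain ⟨k, hk⟩ : ∃ k, k + g.natDegree = 4 := ⟨4 - g.natDegree, by omega⟩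
  have hdvd := X_pow_dvd_lineRestrict hN u w (by change g.natDegree ≤ 4; omega)
  rw [← hg, show 4 - g.natDegree = k by omega] at hdvd
  have hFw : eval w F = 0 := by
    obtain ⟨g', hg'⟩ := hdvd
    have := congrArg (Polynomial.eval 0) hg'
    rw [eval_lineRestrict, Polynomial.eval_mul, Polynomial.eval_pow, Polynomial.eval_X,
      zero_pow (by omega), zero_mul] at this
    simpa using this
  obtain ⟨o, s, hs, ho⟩ := exists_rep_eq (hne h.hβ w h.wβ).1 hFw
  have ho' : o.rep = fun i => s * w i + 0 * u i := by
    funext i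
    rw [ho i]
    ring
  have hoα : eval o.rep α = 0 := by rw [ho', eval_linear h.hα, h.wα]; ring
  have hoβ : eval o.rep β ≠ 0 := by rw [ho', eval_linear h.hβ, h.wβ]; simpa using hs
  have hol : eval o.rep l = 0 := by rw [ho', eval_linear h.hl, h.wl, h.ul]; ring
  obtain ⟨m, hm⟩ := exists_hOrd_toFrac hC o h.hα (hne h.hα u h.uα).2
  obtain ⟨n, hn⟩ := exists_hOrd_toFrac hC o h.hl hl0
  have hm1 := (hm.toFrac_nonneg hC h.hα).2 hoα
  have h1 := h.swap.mul_le_of_dvd hC (N := 3) hN hoβ hol (t := 0) (by rw [hoα, zero_mul]) (k := k)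
    (by omega) (by simpa using hdvd) (m := m) (by
      have := hm.div hC ((HU.toFrac h.hβ hoβ).hOrd hC)
      simpa using this) hn
  have h2 := hlE o _ _ hn hm
  have hnot : o ∉ R.image pt := by
    intro hmem
    obtain ⟨t, ht, rfl⟩ := Finset.mem_image.1 hmem
    exact (hval t (hroot t ht)).1 hoα
  have h3 := hE (insert o (R.image pt))
  rw [Finset.sum_insert hnot] at h3
  have hk' : (k : ℤ) + g.natDegree = 4 := by exact_mod_cast hk
  have hd0 : (0 : ℤ) ≤ g.natDegree := by positivity
  nlinarith

/-- A line through two points, or tangent at a point. -/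
theorem exists_line (hC : NiceCurve planeWt F)
    (p q : Curve planeWt F) : ∃ a : Fin 3 → ℂ, a ≠ 0 ∧ ∀ r n, HOrd r (toFrac F (lin a)) n →
      (Finsupp.single p 1 + Finsupp.single q 1 : Divisor planeWt F) r ≤ n := by
  classical
  obtain ⟨j, -, hw, hj⟩ := hC.exists_chart p
  obtain ⟨i, hij⟩ : ∃ i : Fin 3, i ≠ j := ⟨j + 1, by clear * -; revert j; decide⟩
  obtain ⟨k, hkj, hik⟩ := exists_third hij
  have key : ∀ c d : ℂ, ∃ a b : ℂ, ¬ (a = 0 ∧ b = 0) ∧ a * c + b * d = 0 := by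
    intro c d
    by_cases h : c = 0 ∧ d = 0
    · exact ⟨1, 0, by simp, by simp [h.1]⟩
    · exact ⟨d, -c, fun h' => h ⟨by simpa using h'.2, h'.1⟩, by ring⟩
  -- `v a b` runs through the pencil of linear forms vanishing at `p`. One further linear condition
  -- on `(a, b)` is left for the second point or the tangency.
  let v : ℂ → ℂ → Fin 3 → ℂ := fun a b => a • (Pi.single i 1 - p.affine j i • Pi.single j 1) +
    b • (Pi.single k 1 - p.affine j k • Pi.single j 1)
  have hv : ∀ a b, ¬ (a = 0 ∧ b = 0) → v a b ≠ 0 := by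
    intro a b hab h0
    refine hab ⟨?_, ?_⟩
    · simpa [v, hij, hik] using congrFun h0 i
    · simpa [v, hkj, hik.symm] using congrFun h0 k
  have hvp : ∀ a b, toFrac F (lin (v a b)) = toFrac F (X j) *
      (algebraMap ℂ _ a * localCoord p j i + algebraMap ℂ _ b * localCoord p j k) := by
    intro a b
    have e : lin (v a b) = C a * (X i - C (p.affine j i) * X j) + C b * (X k - C (p.affine j k) * X j) := by
      apply MvPolynomial.funext
      intro x
      rw [eval_lin]
      simp [v, add_dotProduct, sub_dotProduct]
    have hX : toFrac F (X j) ≠ 0 := toFrac_ne_zero_of_eval p.eval_rep (by simpa)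
    rw [e, localCoord_eq, localCoord_eq, planeWt_eq_one, planeWt_eq_one]
    simp only [map_add, map_sub, map_mul, toFrac_C]
    field_simp
  have hpos : ∀ a b r n, HOrd r (toFrac F (lin (v a b))) n → 0 ≤ n ∧ (eval r.rep (lin (v a b)) = 0 → 0 < n) :=
    fun a b r n hn => hn.toFrac_nonneg hC (isWeightedHomogeneous_lin _)
  have hev : ∀ a b x, eval x (lin (v a b)) = a * (x i - p.affine j i * x j) +
      b * (x k - p.affine j k * x j) := by
    intro a b x
    rw [eval_lin]
    simp [v, add_dotProduct, sub_dotProduct]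
  have hzero : ∀ a b, eval p.rep (lin (v a b)) = 0 := by
    intro a b
    rw [hev, Curve.affine, Curve.affine, planeWt_eq_one, planeWt_eq_one]
    field_simp
    ring
  -- When the points coincide, both local coordinates are multiples of a uniformizer. The
  -- combination whose multiplier vanishes at `p` has order at least two, giving the tangent line.
  by_cases hpq : p = q
  · subst hpq
    obtain ⟨t, ht⟩ := hC.exists_unif p
    obtain ⟨x, c, hx, ex⟩ := ht.2 _ (hasValue_localCoord hj hw i)
    obtain ⟨y, d, hy, ey⟩ := ht.2 _ (hasValue_localCoord hj hw k)
    obtain ⟨a, b, hab, h0⟩ := key c d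
    refine ⟨v a b, hv a b hab, fun r n hn => ?_⟩
    by_cases hr : r = p
    · subst hr
      have hz := ((hasValue_algebraMap r a).mul hx).add ((hasValue_algebraMap r b).mul hy)
      rw [h0] at hz
      have e : toFrac F (lin (v a b)) = toFrac F (X j) *
          ((algebraMap ℂ _ a * x + algebraMap ℂ _ b * y) * t) := by
        rw [hvp, ex, ey]
        ring
      obtain ⟨m, hm⟩ := hz.exists_hOrd hC (by
        intro h0
        apply hn.ne_zero
        rw [e, h0]
        ring)
      have hm1 := hm.pos_of_hasValue hC hz
      have h1 := ((HU.toFrac (isWeightedHomogeneous_X ℂ planeWt j) (by simpa)).hOrd hC).mul hC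
        (hm.mul hC (ht.hOrd hC))
      rw [← e] at h1
      have := hn.unique hC h1
      simp
      omega
    · have := (hpos a b r n hn).1
      simpa [Finsupp.single_apply, Ne.symm hr] using this
  · obtain ⟨a, b, hab, h0⟩ := key (q.rep i - p.affine j i * q.rep j) (q.rep k - p.affine j k * q.rep j)
    refine ⟨v a b, hv a b hab, fun r n hn => ?_⟩
    have h1 := hpos a b r n hn
    by_cases hr : r = p
    · subst hr
      have := h1.2 (hzero a b)
      simp [Ne.symm hpq]
      omega
    · by_cases hr' : r = q
      · subst hr'
        have := h1.2 (by rw [hev]; exact h0)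
        simp [hpq]
        omega
      · simpa [Finsupp.single_apply, Ne.symm hr, Ne.symm hr'] using h1.1

/-- A function on a nonsingular plane quartic with at most two poles is constant. -/
theorem eq_algebraMap_of_poles_le (hC : NiceCurve planeWt F) (hN : F.IsWeightedHomogeneous planeWt 4)
    {p q : Curve planeWt F} {f : CoordFrac F} (hf : f ∈ functionField planeWt F)
    (h : ∀ r, ∃ n : ℤ, HOrd r f n ∧
      0 ≤ n + (Finsupp.single p 1 + Finsupp.single q 1 : Divisor planeWt F) r) :
    ∃ c, f = algebraMap ℂ _ c := by
  classical
  by_contra! hne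
  obtain ⟨a, ha, hline⟩ := exists_line hC p q
  obtain ⟨d, A, B, hA, hB, hB0, rfl⟩ := exists_div_of_mem hf
  have hl0 := toFrac_linear_ne_zero hN (by norm_num) (isWeightedHomogeneous_lin a) (lin_ne_zero ha)
  have e : ∀ P, toFrac F (P * lin a) / toFrac F B = toFrac F P / toFrac F B * toFrac F (lin a) := by
    intro P
    rw [map_mul]
    ring
  -- Multiplying `f` by the line through `p` and `q` removes its poles, so the product is a linear
  -- form. This form is not proportional to the line unless `f` is constant.
  obtain ⟨P, hP, hPe⟩ := hC.exists_polynomial (A := A * lin a) (B := B) (b := d) (n := 1) (by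
    rw [add_comm]; exact hA.mul (isWeightedHomogeneous_lin a)) hB hB0 (by
    intro r
    obtain ⟨n, hn, hn0⟩ := h r
    obtain ⟨m, hm⟩ := exists_hOrd_toFrac hC r (isWeightedHomogeneous_lin a) hl0
    refine ⟨n + m, ?_, ?_⟩
    · have := hline r m hm
      linarith
    · rw [e]
      exact hn.mul hC hm)
  rw [e] at hPe
  obtain ⟨b, rfl⟩ := exists_eq_linear hP
  change _ = toFrac F (lin b) at hPe
  have hb : ∀ c : ℂ, b ≠ c • a := by
    rintro c rfl
    refine hne c (mul_right_cancel₀ hl0 (hPe.trans ?_))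
    rw [← toFrac_C, ← map_mul]
    congr 1
    simp only [lin, Finset.mul_sum, Pi.smul_apply, smul_eq_mul, map_mul, mul_assoc]
  obtain ⟨β, u, w, e', hframe⟩ := exists_lineFrame ha hb
  refine hframe.false_of_contact_le hC hN
    (E := fun r => (Finsupp.single p 1 + Finsupp.single q 1 : Divisor planeWt F) r) ?_ ?_
  · intro s
    simp only [Finsupp.add_apply, Finset.sum_add_distrib, Finsupp.single_apply]
    rw [Finset.sum_ite_eq, Finset.sum_ite_eq]
    split_ifs <;> norm_num
  · intro r m n hm hn
    obtain ⟨k, hk, hk0⟩ := h r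
    have h1 := hk.mul hC hm
    rw [hPe] at h1
    have := hn.unique hC h1
    linarith

theorem not_isHyperelliptic (hC : NiceCurve planeWt F) (hN : F.IsWeightedHomogeneous planeWt 4) :
    ¬ IsHyperelliptic planeWt F := by
  rintro ⟨p, q, f, hf, h⟩
  simp only [hasOrder_iff hC] at h
  obtain ⟨c, hc⟩ := eq_algebraMap_of_poles_le hC hN f.2 h
  exact hf ⟨c, Subtype.ext hc.symm⟩

end NonHyperelliptic

/-! ### The points of the dual curve -/

section DualPoints

variable {S T : MvPolynomial (Fin 2) ℂ}

theorem exists_eq_linear_ellWt {P : MvPolynomial (Fin 3) ℂ} (hP : P.IsWeightedHomogeneous ellWt 1) :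
    ∃ a b : ℂ, P = C a * X 0 + C b * X 1 := by
  induction hP using IsWeightedHomogeneous.induction_on with
  | zero => exact ⟨0, 0, by simp⟩
  | add p q _ _ hp hq =>
    obtain ⟨a, b, rfl⟩ := hp
    obtain ⟨a', b', rfl⟩ := hq
    exact ⟨a + a', b + b', by simp only [map_add]; ring⟩
  | monomial d r hd =>
    have h1 : d 0 + d 1 + d 2 * 2 = 1 := by
      rw [← hd, Finsupp.weight_apply, Finsupp.sum_fintype _ _ (fun i => zero_smul ℕ (ellWt i)),
        Fin.sum_univ_three]
      simp
    have h2 : d 2 = 0 := by omega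
    rcases (show d 0 = 1 ∧ d 1 = 0 ∨ d 0 = 0 ∧ d 1 = 1 by omega) with ⟨h0, h1⟩ | ⟨h0, h1⟩
    · refine ⟨r, 0, ?_⟩
      have : d = Finsupp.single 0 1 := by
        ext i; fin_cases i <;> simp [h0, h1, h2]
      rw [this, map_zero, zero_mul, add_zero, C_mul_X_eq_monomial]
    · refine ⟨0, r, ?_⟩
      have : d = Finsupp.single 1 1 := by
        ext i; fin_cases i <;> simp [h0, h1, h2]
      rw [this, map_zero, zero_mul, zero_add, C_mul_X_eq_monomial]

variable [hF : Fact (Prime (quartic S T))] [hF' : Fact (Prime (ellEq S T))]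

/-- Linearly equivalent points of `E` are equal. -/
theorem eq_of_isPrincipal_single_sub (h : Biell S T) {a b : CurveE S T}
    (hp : IsPrincipal (Finsupp.single a 1 - Finsupp.single b 1 : Divisor ellWt (ellEq S T))) :
    a = b := by
  classical
  rw [h.niceE.isPrincipal_iff] at hp
  obtain ⟨g, hg, hord⟩ := hp
  obtain ⟨d, A, B, hA, hB, hB0, rfl⟩ := exists_div_of_mem hg
  set l := linForm (b.rep 0) (b.rep 1)
  have hl : l.IsWeightedHomogeneous ellWt 1 := isWeightedHomogeneous_linForm _ _ rfl rfl
  have hordl : ∀ r, HOrd r (toFrac (ellEq S T) (A * l) / toFrac (ellEq S T) B)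
      ((Finsupp.single a 1 + Finsupp.single (h.conj b) 1 : Divisor ellWt (ellEq S T)) r) := by
    intro r
    have h1 := (hord r).mul h.niceE (hOrd_linForm h b r)
    rw [← Finsupp.add_apply, Biell.fib, ← add_assoc, sub_add_cancel] at h1
    rw [map_mul, mul_div_right_comm]
    exact h1
  -- A function with divisor `a - b`, multiplied by the linear form through `b`, has divisor `a +
  -- conj b` and is a form of weight one. Such a form involves only `X 0, X 1`, and vanishing at `a`
  -- it has divisor `a + conj a`. Hence `conj a = conj b`.
  obtain ⟨P, hP, e⟩ := h.niceE.exists_polynomial (A := A * l) (B := B) (b := d) (n := 1)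
    (by rw [add_comm]; exact hA.mul hl) hB hB0 (fun r => ⟨_, by
      rw [Finsupp.add_apply, Finsupp.single_apply, Finsupp.single_apply]; positivity, hordl r⟩)
  rw [e] at hordl
  obtain ⟨x, y, rfl⟩ := exists_eq_linear_ellWt hP
  have hPa : x * a.rep 0 + y * a.rep 1 = 0 := by
    by_contra hne
    have h1 := (HU.toFrac (p := a) hP (by simpa using hne)).hOrd h.niceE
    have h2 := (hordl a).unique h.niceE h1
    rw [Finsupp.add_apply, Finsupp.single_eq_same, Finsupp.single_apply] at h2
    split_ifs at h2 <;> omega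
  obtain ⟨c, hx, hy⟩ : ∃ c, x = c * a.rep 1 ∧ y = -(c * a.rep 0) := by
    by_cases h0 : a.rep 0 = 0
    · have h1 : a.rep 1 ≠ 0 := fun h1 => h.xy_ne_zeroE a ⟨h0, h1⟩
      refine ⟨x / a.rep 1, by field_simp, ?_⟩
      rw [h0, mul_zero, zero_add] at hPa
      rw [h0, (mul_eq_zero.1 hPa).resolve_right h1]
      simp
    · refine ⟨-y / a.rep 0, ?_, by field_simp⟩
      field_simp
      linear_combination hPa
  have hPe : (C x * X 0 + C y * X 1 : MvPolynomial (Fin 3) ℂ) = C c * linForm (a.rep 0) (a.rep 1) := by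
    rw [linForm, hx, hy]
    simp only [map_mul, map_neg]
    ring
  have hc : c ≠ 0 := by
    rintro rfl
    apply (hordl a).ne_zero
    rw [hPe]
    simp
  rw [hPe, map_mul, toFrac_C] at hordl
  have h1 := ((hasValue_algebraMap (h.conj b) c).hU hc |>.hOrd h.niceE).mul h.niceE
    (hOrd_linForm h a (h.conj b))
  have h2 := (hordl (h.conj b)).unique h.niceE h1
  rw [Biell.fib, Finsupp.add_apply, Finsupp.add_apply, Finsupp.single_eq_same, zero_add,
    add_right_inj, Finsupp.single_apply] at h2
  have h3 : h.conj a = h.conj b := by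
    by_contra hne
    rw [if_neg hne] at h2
    exact one_ne_zero h2
  rw [← h.conj_conj a, h3, h.conj_conj]

/-- The class of `q + q'` has norm `η` if and only if `π q` and `π q'` are conjugate. -/
theorem abel_mem_normFibre_iff (h : Biell S T) (e : CurveE S T) (q q' : CurveC S T) :
    abel S T (q, q') ∈ normFibre S T (divClass (h.fib e)) ↔ proj S T q' = h.conj (proj S T q) := by
  have hpush : pushforward S T (Finsupp.single q 1 + Finsupp.single q' 1) =
      Finsupp.single (proj S T q) 1 + Finsupp.single (proj S T q') 1 := by
    rw [pushforward, Finsupp.mapDomain_add, Finsupp.mapDomain_single, Finsupp.mapDomain_single]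
  constructor
  · rintro ⟨D, hD, hη⟩
    rw [abel, h.niceC.divClass_eq_iff] at hD
    have h1 := isPrincipal_pushforward h hD
    have h2 : pushforward S T (Finsupp.single q 1 + Finsupp.single q' 1 - D) =
        Finsupp.single (proj S T q) 1 + Finsupp.single (proj S T q') 1 - pushforward S T D := by
      rw [← hpush, eq_sub_iff_add_eq]
      simp only [pushforward]
      rw [← Finsupp.mapDomain_add, sub_add_cancel]
    rw [h2, ← h.niceE.divClass_eq_iff, hη, divClass_fib_eq h e (proj S T q),
      h.niceE.divClass_eq_iff, Biell.fib, add_sub_add_left_eq_sub] at h1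
    exact eq_of_isPrincipal_single_sub h h1
  · intro hq
    refine ⟨_, rfl, ?_⟩
    change divClass (pushforward S T (Finsupp.single q 1 + Finsupp.single q' 1)) = _
    rw [hpush, hq, divClass_fib_eq h e (proj S T q)]
    rfl

/-- The map `C⁽²⁾ → Pic²(C)` is injective. -/
theorem abel_eq_abel_iff (h : Biell S T) (x y : CurveC S T × CurveC S T) :
    abel S T x = abel S T y ↔ x = y ∨ x = y.swap := by
  classical
  constructor
  · intro hxy
    rw [abel, abel, h.niceC.divClass_eq_iff, h.niceC.isPrincipal_iff] at hxy
    obtain ⟨f, hf, hord⟩ := hxy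
    -- A function with divisor `y - x` has at most the two points of `x` as poles, so it is constant
    -- and the two divisors coincide.
    obtain ⟨c, rfl⟩ := eq_algebraMap_of_poles_le h.niceC h.isHomogeneous_quartic (p := x.1) (q := x.2) hf
      (fun r => ⟨_, hord r, by
        rw [Finsupp.sub_apply, sub_add_cancel, Finsupp.add_apply, Finsupp.single_apply,
          Finsupp.single_apply]
        positivity⟩)
    have hc : c ≠ 0 := by
      rintro rfl
      exact (hord x.1).ne_zero (map_zero _)
    have h0 : ∀ r, (Finsupp.single y.1 1 + Finsupp.single y.2 1 : Divisor planeWt (quartic S T)) r =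
        (Finsupp.single x.1 1 + Finsupp.single x.2 1 : Divisor planeWt (quartic S T)) r := by
      intro r
      have := (hord r).unique h.niceC (((hasValue_algebraMap r c).hU hc).hOrd h.niceC)
      rw [Finsupp.sub_apply] at this
      exact sub_eq_zero.1 this
    obtain ⟨x1, x2⟩ := x
    obtain ⟨y1, y2⟩ := y
    have h1 := h0 x1
    have h2 := h0 x2
    have h3 := h0 y1
    have h4 := h0 y2
    simp only [Finsupp.add_apply, Finsupp.single_apply] at h1 h2 h3 h4
    simp only [Prod.mk.injEq, Prod.swap_prod_mk]
    grind
  · rintro (rfl | rfl)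
    · rfl
    · rw [abel, abel, Prod.fst_swap, Prod.snd_swap, add_comm]

end DualPoints

/-! ### The correspondence between pairs of points and the dual quartic -/

section Correspondence

variable {S T : MvPolynomial (Fin 2) ℂ}

/-- A square root of two. -/
def rootTwo : ℂ := (exists_sq 2).choose

theorem rootTwo_sq : rootTwo ^ 2 = 2 := (exists_sq 2).choose_spec

theorem rootTwo_ne_zero : rootTwo ≠ 0 := by
  intro h
  have := rootTwo_sq
  rw [h] at this
  norm_num at this

/-- The vector `v` represents the point `q`. -/
def Represents {F : MvPolynomial (Fin 3) ℂ} (q : Curve planeWt F) (v : Fin 3 → ℂ) : Prop :=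
  ∃ c : ℂ, c ≠ 0 ∧ ∀ i, v i = c * q.rep i

theorem Represents.smul {F : MvPolynomial (Fin 3) ℂ} {q : Curve planeWt F} {v v' : Fin 3 → ℂ}
    (h : Represents q v) {c : ℂ} (hc : c ≠ 0) (e : ∀ i, v' i = c * v i) : Represents q v' := by
  obtain ⟨d, hd, k⟩ := h
  exact ⟨c * d, mul_ne_zero hc hd, fun i => by rw [e, k]; ring⟩

theorem represents_mk {F : MvPolynomial (Fin 3) ℂ} {v : Fin 3 → ℂ} (hv : v ≠ 0 ∧ eval v F = 0) :
    Represents (Curve.mk v hv : Curve planeWt F) v := by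
  obtain ⟨c, hc, e⟩ := Curve.exists_scale (q := (Curve.mk v hv : Curve planeWt F)) rfl
  exact ⟨c, hc, fun i => by rw [e i, planeWt_eq_one, pow_one]⟩

theorem Represents.eq {F : MvPolynomial (Fin 3) ℂ} {q q' : Curve planeWt F} {v : Fin 3 → ℂ}
    (h : Represents q v) (h' : Represents q' v) : q = q' := by
  obtain ⟨c, hc, e⟩ := h
  obtain ⟨d, hd, e'⟩ := h'
  refine Curve.eq_of_rep (c := d⁻¹ * c) (by positivity) fun i => ?_
  rw [planeWt_eq_one, pow_one, mul_assoc, ← e, e']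
  field_simp

theorem Represents.xy_ne_zero {q : CurveC S T} (h : Biell S T) {v : Fin 3 → ℂ}
    (hv : Represents q v) : ¬ (v 0 = 0 ∧ v 1 = 0) := by
  obtain ⟨c, hc, e⟩ := hv
  rw [e, e]
  simpa [hc] using h.xy_ne_zero q

theorem Represents.exists_scale {F : MvPolynomial (Fin 3) ℂ} {q : Curve planeWt F} {v v' : Fin 3 → ℂ}
    (h : Represents q v) (h' : Represents q v') : ∃ c, c ≠ 0 ∧ ∀ i, v' i = c * v i := by
  obtain ⟨c, hc, e⟩ := h
  obtain ⟨d, hd, e'⟩ := h'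
  refine ⟨d / c, div_ne_zero hd hc, fun i => ?_⟩
  rw [e, e']
  field_simp

/-- The point `p` of the dual quartic corresponds to the pair of points `q`, `q'`. -/
def Corr (q q' : CurveC S T) (p : CurveC S (S ^ 2 - T)) : Prop :=
  ∃ x y z z' : ℂ, Represents q ![x, y, z] ∧ Represents q' ![x, y, z'] ∧
    Represents p ![x, y, (z + z') / rootTwo] ∧ z ^ 2 + z' ^ 2 = -2 * eval ![x, y] S

theorem Corr.symm {q q' : CurveC S T} {p : CurveC S (S ^ 2 - T)} (h : Corr q q' p) : Corr q' q p := by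
  obtain ⟨x, y, z, z', h1, h2, h3, h4⟩ := h
  exact ⟨x, y, z', z, h2, h1, by rwa [add_comm], by rwa [add_comm]⟩

theorem represents_proj {q : CurveC S T} {v : Fin 3 → ℂ} (hv : Represents q v) :
    ∃ c, c ≠ 0 ∧ v 0 = c * (proj S T q).rep 0 ∧ v 1 = c * (proj S T q).rep 1 ∧
      v 2 ^ 2 = c ^ 2 * (proj S T q).rep 2 := by
  obtain ⟨c, hc, e⟩ := hv
  obtain ⟨d, hd, e0, e1, e2⟩ := proj_rep q
  exact ⟨c * d, mul_ne_zero hc hd, by rw [e, e0]; ring, by rw [e, e1]; ring, by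
    rw [e, mul_pow, e2]; ring⟩

theorem Corr.proj_eq (h : Biell S T) {q q' : CurveC S T} {p : CurveC S (S ^ 2 - T)}
    (hc : Corr q q' p) : proj S T q' = h.conj (proj S T q) := by
  obtain ⟨x, y, z, z', h1, h2, -, h4⟩ := hc
  obtain ⟨c, hc, e0, e1, e2⟩ := represents_proj h1
  obtain ⟨d, hd, k0, k1, k2⟩ := represents_proj h2
  obtain ⟨b, hb, l0, l1, l2⟩ := h.conj_rep (proj S T q)
  simp only [Matrix.cons_val] at e0 e1 e2 k0 k1 k2
  have hS := eval_pair_smul h.homS c ((proj S T q).rep 0) ((proj S T q).rep 1)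
  rw [← e0, ← e1] at hS
  refine CurveE.eq_of_scale (c := d / (c * b)) (by positivity) ?_ ?_ ?_
  · rw [l0] at e0
    field_simp
    rw [← e0.symm.trans k0]; ring
  · rw [l1] at e1
    field_simp
    rw [← e1.symm.trans k1]; ring
  · field_simp
    linear_combination -c ^ 2 * l2 + e2 + k2 - h4 + 2 * hS

/-- The heart of the duality: `ζ = (z + z') / √2` satisfies `ζ² + s = z z'`, and `(z z')² = -z²(z² +
2s) = s² - t`. -/
theorem dual_equation {z z' s t : ℂ} (h : z ^ 2 + z' ^ 2 = -2 * s) (hz : (z ^ 2 + s) ^ 2 - t = 0) :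
    (((z + z') / rootTwo) ^ 2 + s) ^ 2 - (s ^ 2 - t) = 0 := by
  have h1 : ((z + z') / rootTwo) ^ 2 + s = z * z' := by
    rw [div_pow, rootTwo_sq]
    linear_combination (1 / 2) * h
  rw [h1]
  linear_combination z ^ 2 * h - hz

/-- Conjugate points of `E` have the same image in `ℙ¹`, so the coordinates of `q'` can be rescaled
to share `x, y` with `q`. Conjugacy `w' = -w - 2S` is then the relation `z² + z'² = -2S`. -/
theorem exists_corr (h : Biell S T) {q q' : CurveC S T} (hq : proj S T q' = h.conj (proj S T q)) :
    ∃ p, Corr q q' p := by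
  obtain ⟨c, hc, e0, e1, e2⟩ := proj_rep q
  obtain ⟨d, hd, k0, k1, k2⟩ := proj_rep q'
  obtain ⟨b, hb, l0, l1, l2⟩ := h.conj_rep (proj S T q)
  rw [hq] at k0 k1 k2
  have hS := eval_pair_smul h.homS c ((proj S T q).rep 0) ((proj S T q).rep 1)
  rw [← e0, ← e1] at hS
  have hF := q.eval_rep
  rw [eval_quartic] at hF
  have hsum : q.rep 2 ^ 2 + (c * b / d * q'.rep 2) ^ 2 = -2 * eval ![q.rep 0, q.rep 1] S := by
    have : (c * b / d * q'.rep 2) ^ 2 = c ^ 2 * (b ^ 2 * (h.conj (proj S T q)).rep 2) := by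
      rw [mul_pow, k2]
      field_simp
    rw [this, ← l2]
    linear_combination e2 + 2 * hS
  refine ⟨Curve.mk ![q.rep 0, q.rep 1, (q.rep 2 + c * b / d * q'.rep 2) / rootTwo]
    ⟨fun h0 => h.xy_ne_zero q ⟨congrFun h0 0, congrFun h0 1⟩, ?_⟩,
    q.rep 0, q.rep 1, q.rep 2, c * b / d * q'.rep 2, ⟨1, one_ne_zero, fun i => ?_⟩,
    ⟨c * b / d, by positivity, fun i => ?_⟩, represents_mk _, hsum⟩
  · rw [eval_quartic]
    simp only [Matrix.cons_val, map_sub, map_pow]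
    exact dual_equation hsum hF
  · fin_cases i <;> simp
  · fin_cases i
    · simp only [Fin.zero_eta, Matrix.cons_val_zero]
      rw [e0, l0, k0]
      field_simp
    · simp only [Fin.mk_one, Matrix.cons_val_one, Matrix.cons_val_zero]
      rw [e1, l1, k1]
      field_simp
    · rfl

theorem Corr.unique (h : Biell S T) {q q' : CurveC S T} {p p' : CurveC S (S ^ 2 - T)}
    (hc : Corr q q' p) (hc' : Corr q q' p') : p = p' := by
  obtain ⟨x, y, z, z', h1, h2, h3, h4⟩ := hc
  obtain ⟨a, b, w, w', k1, k2, k3, k4⟩ := hc'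
  obtain ⟨c, hc, e⟩ := h1.exists_scale k1
  obtain ⟨d, hd, e'⟩ := h2.exists_scale k2
  have e0 := e 0
  have e1 := e 1
  have e2 := e 2
  have l0 := e' 0
  have l1 := e' 1
  have l2 := e' 2
  simp only [Matrix.cons_val] at e0 e1 e2 l0 l1 l2
  have hcd : c = d := by
    by_contra hne
    have hne' := sub_ne_zero.2 hne
    refine h1.xy_ne_zero h ⟨?_, ?_⟩
    · exact (mul_eq_zero.1 (show (c - d) * x = 0 by linear_combination l0 - e0)).resolve_left hne'
    · exact (mul_eq_zero.1 (show (c - d) * y = 0 by linear_combination l1 - e1)).resolve_left hne'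
  subst hcd
  refine (h3.smul hc fun i => ?_).eq k3
  fin_cases i
  · exact e0
  · exact e1
  · change (w + w') / rootTwo = c * ((z + z') / rootTwo)
    rw [e2, l2]
    ring

theorem Corr.surj (h : Biell S T) (p : CurveC S (S ^ 2 - T)) : ∃ q q' : CurveC S T, Corr q q' p := by
  -- The coordinates `z, z'` must have sum `√2 ζ` and product `ζ² + S`. They are the roots of a
  -- quadratic with discriminant `2ζ² - 4(ζ² + S) = -2ζ² - 4S`.
  obtain ⟨δ, hδ⟩ := exists_sq (-2 * p.rep 2 ^ 2 - 4 * eval ![p.rep 0, p.rep 1] S)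
  have hr := rootTwo_sq
  have hr0 := rootTwo_ne_zero
  have hp := p.eval_rep
  rw [eval_quartic] at hp
  have hxy := h.swap.xy_ne_zero p
  set s := eval ![p.rep 0, p.rep 1] S
  set x := p.rep 0
  set y := p.rep 1
  set ζ := p.rep 2
  have hsum : ((rootTwo * ζ + δ) / 2) ^ 2 + ((rootTwo * ζ - δ) / 2) ^ 2 = -2 * s := by
    linear_combination (1 / 2) * ζ ^ 2 * hr + (1 / 2) * hδ
  have hprod : ((rootTwo * ζ + δ) / 2) * ((rootTwo * ζ - δ) / 2) = ζ ^ 2 + s := by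
    linear_combination (1 / 4) * ζ ^ 2 * hr - (1 / 4) * hδ
  have key : ∀ z z', z ^ 2 + z' ^ 2 = -2 * s → z * z' = ζ ^ 2 + s →
      eval ![x, y, z] (quartic S T) = 0 := by
    intro z z' h1 h2
    rw [map_sub, map_pow] at hp
    change (ζ ^ 2 + s) ^ 2 - (s ^ 2 - _) = 0 at hp
    rw [eval_quartic]
    simp only [Matrix.cons_val]
    linear_combination z ^ 2 * h1 - hp - (z * z' + ζ ^ 2 + s) * h2
  refine ⟨Curve.mk ![x, y, (rootTwo * ζ + δ) / 2] ⟨fun h0 => hxy ⟨congrFun h0 0, congrFun h0 1⟩,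
    key _ _ hsum hprod⟩, Curve.mk ![x, y, (rootTwo * ζ - δ) / 2]
    ⟨fun h0 => hxy ⟨congrFun h0 0, congrFun h0 1⟩, key _ _ (by rw [add_comm]; exact hsum)
      (by rw [mul_comm]; exact hprod)⟩, x, y, _, _, represents_mk _, represents_mk _,
    ⟨1, one_ne_zero, fun i => ?_⟩, hsum⟩
  fin_cases i
  · simp [x]
  · simp [y]
  · simp only [Fin.reduceFinMk, Matrix.cons_val, one_mul]
    change _ = ζ
    field_simp
    ring

/-- Once `x, y` are matched, `ζ` fixes the sum of `z, z'` and the relation on their squares fixes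
their product, hence the unordered pair. -/
theorem Corr.inj (h : Biell S T) {q q' q₁ q₁' : CurveC S T} {p : CurveC S (S ^ 2 - T)}
    (hc : Corr q q' p) (hc' : Corr q₁ q₁' p) : (q = q₁ ∧ q' = q₁') ∨ (q = q₁' ∧ q' = q₁) := by
  obtain ⟨x, y, z, z', h1, h2, h3, h4⟩ := hc
  obtain ⟨a, b, w, w', k1, k2, k3, k4⟩ := hc'
  obtain ⟨c, hc, e⟩ := h3.exists_scale k3
  have e0 := e 0
  have e1 := e 1
  have e2 := e 2
  simp only [Matrix.cons_val] at e0 e1 e2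
  have hr := rootTwo_ne_zero
  have hsum : w + w' = c * (z + z') := by
    field_simp at e2
    exact e2
  have hS := eval_pair_smul h.homS c x y
  rw [← e0, ← e1] at hS
  have hprod : (w - c * z) * (w - c * z') = 0 := by
    linear_combination w * hsum - (1 / 2) * (w + w' + c * (z + z')) * hsum + (1 / 2) * k4 - (c ^ 2 / 2) * h4 - hS
  have hfin : ∀ {r r₁ : CurveC S T} {s t : ℂ}, Represents r ![x, y, s] → Represents r₁ ![a, b, t] →
      t = c * s → r = r₁ := by
    intro r r₁ s t hr hr₁ hst
    refine (hr.smul hc fun i => ?_).eq hr₁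
    fin_cases i
    exacts [e0, e1, hst]
  rcases mul_eq_zero.1 hprod with h0 | h0
  · exact Or.inl ⟨hfin h1 k1 (by linear_combination h0), hfin h2 k2 (by linear_combination hsum - h0)⟩
  · exact Or.inr ⟨hfin h1 k2 (by linear_combination hsum - h0), hfin h2 k1 (by linear_combination h0)⟩

theorem Represents.invol {q : CurveC S T} {x y z : ℂ} (h : Represents q ![x, y, z]) :
    Represents (invol S T q) ![x, y, -z] := by
  obtain ⟨c, hc, e⟩ := h
  obtain ⟨d, hd, e0, e1, e2⟩ := invol_rep q
  refine ⟨c * d, mul_ne_zero hc hd, fun i => ?_⟩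
  have k0 := e 0
  have k1 := e 1
  have k2 := e 2
  simp only [Matrix.cons_val] at k0 k1 k2
  fin_cases i
  · simp only [Fin.zero_eta, Matrix.cons_val_zero]; rw [k0, e0]; ring
  · simp only [Fin.mk_one, Matrix.cons_val_one, Matrix.cons_val_zero]; rw [k1, e1]; ring
  · simp only [Fin.reduceFinMk, Matrix.cons_val]; rw [k2]; linear_combination c * e2

theorem Corr.invol {q q' : CurveC S T} {p : CurveC S (S ^ 2 - T)} (h : Corr q q' p) :
    Corr (invol S T q) (invol S T q') (invol S (S ^ 2 - T) p) := by
  obtain ⟨x, y, z, z', h1, h2, h3, h4⟩ := h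
  refine ⟨x, y, -z, -z', h1.invol, h2.invol, ?_, by linear_combination h4⟩
  have := h3.invol
  rwa [show (-z + -z') / rootTwo = -((z + z') / rootTwo) by ring]

end Correspondence

/-! ### Bihomogeneous polynomials on the correspondence -/

section Bihomogeneous

/-- The weights for bihomogeneous polynomials. -/
abbrev biWt : Fin 3 ⊕ Fin 3 → ℕ × ℕ :=
  Sum.elim (fun i : Fin 3 => (planeWt i, 0)) (fun i : Fin 3 => (0, planeWt i))

theorem weight_biWt (n : Fin 3 ⊕ Fin 3 →₀ ℕ) : Finsupp.weight biWt n =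
    (n (.inl 0) + n (.inl 1) + n (.inl 2), n (.inr 0) + n (.inr 1) + n (.inr 2)) := by
  rw [Finsupp.weight_apply, Finsupp.sum_fintype _ _ (fun i => zero_smul ℕ (biWt i)),
    Fintype.sum_sum_type, Fin.sum_univ_three, Fin.sum_univ_three]
  ext <;> simp

theorem eval_biMonomial (n : Fin 3 ⊕ Fin 3 →₀ ℕ) (r : ℂ) (v w : Fin 3 → ℂ) :
    eval (Sum.elim v w) (monomial n r) = r * ((v 0 ^ n (.inl 0) * v 1 ^ n (.inl 1) * v 2 ^ n (.inl 2)) *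
      (w 0 ^ n (.inr 0) * w 1 ^ n (.inr 1) * w 2 ^ n (.inr 2))) := by
  rw [eval_monomial, Finsupp.prod_fintype _ _ (fun i => pow_zero _), Fintype.prod_sum_type,
    Fin.prod_univ_three, Fin.prod_univ_three]
  simp

theorem eval_biSmul {P : MvPolynomial (Fin 3 ⊕ Fin 3) ℂ} {m : ℕ × ℕ}
    (hP : P.IsWeightedHomogeneous biWt m) (c d : ℂ) (v w : Fin 3 → ℂ) :
    eval (Sum.elim (fun i => c * v i) (fun i => d * w i)) P =
      c ^ m.1 * d ^ m.2 * eval (Sum.elim v w) P := by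
  induction hP using IsWeightedHomogeneous.induction_on with
  | zero => simp
  | add p q _ _ hp hq => rw [map_add, map_add, hp, hq, mul_add]
  | monomial n r h =>
    rw [weight_biWt] at h
    rw [eval_biMonomial, eval_biMonomial, ← h]
    ring

theorem isWeightedHomogeneous_aeval_smul {σ τ M : Type*} [AddCommMonoid M] {wt : σ → M} {wt' : τ → ℕ}
    {ψ : τ → MvPolynomial σ ℂ} {m : M} (hψ : ∀ i, (ψ i).IsWeightedHomogeneous wt (wt' i • m))
    {P : MvPolynomial τ ℂ} {d : ℕ} (hP : P.IsWeightedHomogeneous wt' d) :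
    (aeval ψ P).IsWeightedHomogeneous wt (d • m) := by
  induction hP using IsWeightedHomogeneous.induction_on with
  | zero => simpa using isWeightedHomogeneous_zero ℂ wt (d • m)
  | add p q _ _ hp hq => rw [map_add]; exact hp.add hq
  | monomial n r h =>
    rw [aeval_monomial, MvPolynomial.algebraMap_eq]
    refine IsWeightedHomogeneous.C_mul ?_ r
    rw [← h, Finsupp.weight_apply, Finsupp.sum, Finsupp.prod, Finset.sum_smul]
    refine IsWeightedHomogeneous.prod _ _ _ fun i _ => ?_
    rw [smul_assoc]
    exact (hψ i).pow (n i)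

variable {S T : MvPolynomial (Fin 2) ℂ}

theorem isWeightedHomogeneous_normForm (hS : S.IsHomogeneous 2) :
    (X 2 ^ 2 + inXY S : MvPolynomial (Fin 3) ℂ).IsWeightedHomogeneous planeWt 2 := by
  have hX : (X 2 ^ 2 : MvPolynomial (Fin 3) ℂ).IsWeightedHomogeneous planeWt 2 := by
    simpa using (isWeightedHomogeneous_X ℂ planeWt 2).pow 2
  exact hX.add (isWeightedHomogeneous_inXY hS rfl rfl)

/-- Power sums of `z`, `z'` in terms of `z + z'` and `z z'`. -/
theorem exists_powerSum (hS : S.IsHomogeneous 2) (k : ℕ) : ∃ H : MvPolynomial (Fin 3) ℂ,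
    H.IsWeightedHomogeneous planeWt k ∧ ∀ x y z z' ζ : ℂ, z + z' = rootTwo * ζ →
      z * z' = ζ ^ 2 + eval ![x, y] S → z ^ k + z' ^ k = eval ![x, y, ζ] H := by
  induction k using Nat.twoStepInduction with
  | zero =>
    exact ⟨C 2, isWeightedHomogeneous_C planeWt 2, fun x y z z' ζ _ _ => by simp; norm_num⟩
  | one =>
    exact ⟨C rootTwo * X 2, (isWeightedHomogeneous_X ℂ planeWt 2).C_mul _, fun x y z z' ζ h _ => by
      simpa using h⟩
  | more k ih1 ih2 =>
    obtain ⟨H, hH, e⟩ := ih1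
    obtain ⟨H', hH', e'⟩ := ih2
    -- Newton's recursion: each power sum is `z + z'` times the previous one minus `z z'` times the
    -- one before that.
    refine ⟨C rootTwo * X 2 * H' - (X 2 ^ 2 + inXY S) * H, ?_, fun x y z z' ζ h1 h2 => ?_⟩
    · have h1 := ((isWeightedHomogeneous_X ℂ planeWt 2).C_mul rootTwo).mul hH'
      have h2 := (isWeightedHomogeneous_normForm hS).mul hH
      rw [planeWt_eq_one, show 1 + (k + 1) = k + 2 by ring] at h1
      rw [add_comm 2 k] at h2
      exact h1.sub h2
    · have e1 := e x y z z' ζ h1 h2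
      have e2 := e' x y z z' ζ h1 h2
      simp only [map_sub, map_mul, map_add, map_pow, eval_C, eval_X, eval_inXY, Matrix.cons_val]
      rw [← e1, ← e2, ← h1, ← h2]
      ring

/-- For `c ≤ d` the common factor `(z z')^c` reduces to a power sum of exponent `d - c`. -/
theorem exists_mixedPowerSum (hS : S.IsHomogeneous 2) (c d : ℕ) : ∃ H : MvPolynomial (Fin 3) ℂ,
    H.IsWeightedHomogeneous planeWt (c + d) ∧ ∀ x y z z' ζ : ℂ, z + z' = rootTwo * ζ →
      z * z' = ζ ^ 2 + eval ![x, y] S → z ^ c * z' ^ d + z' ^ c * z ^ d = eval ![x, y, ζ] H := by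
  wlog hcd : c ≤ d generalizing c d
  · obtain ⟨H, hH, e⟩ := this d c (by omega)
    exact ⟨H, by rwa [add_comm], fun x y z z' ζ h1 h2 => by rw [← e x y z z' ζ h1 h2]; ring⟩
  obtain ⟨k, rfl⟩ := Nat.exists_eq_add_of_le hcd
  obtain ⟨H, hH, e⟩ := exists_powerSum hS k
  refine ⟨(X 2 ^ 2 + inXY S) ^ c * H, ?_, fun x y z z' ζ h1 h2 => ?_⟩
  · have h1 := ((isWeightedHomogeneous_normForm hS).pow c).mul hH
    rwa [smul_eq_mul, show c * 2 + k = c + (c + k) by ring] at h1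
  · rw [map_mul, ← e x y z z' ζ h1 h2]
    simp only [map_add, map_pow, eval_X, eval_inXY, Matrix.cons_val]
    rw [← h2]
    ring

/-- A symmetrized bihomogeneous polynomial is a polynomial on the dual quartic. -/
theorem exists_symmetrization (hS : S.IsHomogeneous 2) {A : MvPolynomial (Fin 3 ⊕ Fin 3) ℂ} {m : ℕ × ℕ}
    (hA : A.IsWeightedHomogeneous biWt m) : ∃ H : MvPolynomial (Fin 3) ℂ,
    H.IsWeightedHomogeneous planeWt (m.1 + m.2) ∧ ∀ x y z z' ζ : ℂ, z + z' = rootTwo * ζ →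
      z * z' = ζ ^ 2 + eval ![x, y] S → eval (Sum.elim ![x, y, z] ![x, y, z']) A +
        eval (Sum.elim ![x, y, z'] ![x, y, z]) A = eval ![x, y, ζ] H := by
  induction hA using IsWeightedHomogeneous.induction_on with
  | zero => exact ⟨0, isWeightedHomogeneous_zero ℂ _ _, by simp⟩
  | add p q _ _ hp hq =>
    obtain ⟨H, hH, e⟩ := hp
    obtain ⟨H', hH', e'⟩ := hq
    refine ⟨H + H', hH.add hH', fun x y z z' ζ h1 h2 => ?_⟩
    rw [map_add, map_add, map_add, ← e x y z z' ζ h1 h2, ← e' x y z z' ζ h1 h2]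
    ring
  | monomial n r h =>
    rw [weight_biWt] at h
    obtain ⟨K, hK, e⟩ := exists_mixedPowerSum hS (n (.inl 2)) (n (.inr 2))
    refine ⟨C r * (X 0 ^ (n (.inl 0) + n (.inr 0)) * X 1 ^ (n (.inl 1) + n (.inr 1)) * K), ?_,
      fun x y z z' ζ h1 h2 => ?_⟩
    · have h1 := ((((isWeightedHomogeneous_X ℂ planeWt 0).pow (n (.inl 0) + n (.inr 0))).mul
        ((isWeightedHomogeneous_X ℂ planeWt 1).pow (n (.inl 1) + n (.inr 1)))).mul hK).C_mul r
      convert h1 using 1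
      rw [← h, planeWt_eq_one, planeWt_eq_one]
      simp only [smul_eq_mul, mul_one]
      ring
    · rw [eval_biMonomial, eval_biMonomial, map_mul, map_mul, ← e x y z z' ζ h1 h2]
      simp only [map_mul, map_pow, eval_C, eval_X, Matrix.cons_val]
      ring

/-- Coordinates of a pair of points. -/
def pairRep (x : CurveC S T × CurveC S T) : Fin 3 ⊕ Fin 3 → ℂ := Sum.elim x.1.rep x.2.rep

/-- `H k` and `H' k` are the symmetrizations of `Q ^ (k + 1)` and `P Q ^ k`. If `P / Q` takes the
value `γ` at both orderings of the pair, then `H' k = γ H k` there. The factors `u`, `u'`, `e`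
account for the choices of homogeneous coordinates. The exponent `k` stays free so that `H k` can be
made nonzero at a given point. -/
theorem exists_descent_aux (h : Biell S T) {P Q : MvPolynomial (Fin 3 ⊕ Fin 3) ℂ} {m : ℕ × ℕ}
    (hP : P.IsWeightedHomogeneous biWt m) (hQ : Q.IsWeightedHomogeneous biWt m) :
    ∃ (n : ℕ → ℕ) (H' H : ℕ → MvPolynomial (Fin 3) ℂ),
      (∀ k, (H' k).IsWeightedHomogeneous planeWt (n k) ∧ (H k).IsWeightedHomogeneous planeWt (n k)) ∧
      ∀ (q q' : CurveC S T) (p : CurveC S (S ^ 2 - T)), Corr q q' p →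
        ∃ u u' : ℂ, u ≠ 0 ∧ u' ≠ 0 ∧ ∀ k, ∃ e : ℂ, e ≠ 0 ∧
          e * eval p.rep (H k) = (u * eval (pairRep (q, q')) Q) ^ (k + 1) +
            (u' * eval (pairRep (q', q)) Q) ^ (k + 1) ∧
          e * eval p.rep (H' k) =
            u * eval (pairRep (q, q')) P * (u * eval (pairRep (q, q')) Q) ^ k +
            u' * eval (pairRep (q', q)) P * (u' * eval (pairRep (q', q)) Q) ^ k := by
  have h1 : ∀ k, (P * Q ^ k).IsWeightedHomogeneous biWt ((k + 1) • m) := fun k => by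
    rw [add_comm, add_smul, one_smul]; exact hP.mul (hQ.pow k)
  have h2 : ∀ k, (Q ^ (k + 1)).IsWeightedHomogeneous biWt ((k + 1) • m) := fun k => hQ.pow (k + 1)
  choose H' hH' e' using fun k => exists_symmetrization h.homS (h1 k)
  choose H hH e using fun k => exists_symmetrization h.homS (h2 k)
  refine ⟨fun k => ((k + 1) • m).1 + ((k + 1) • m).2, H', H, fun k => ⟨hH' k, hH k⟩, ?_⟩
  rintro q q' p ⟨x, y, z, z', ⟨c, hc, r1⟩, ⟨d, hd, r2⟩, ⟨b, hb, r3⟩, h4⟩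
  have hr := rootTwo_ne_zero
  have hr2 := rootTwo_sq
  have k1 : z + z' = rootTwo * ((z + z') / rootTwo) := by field_simp
  have k2 : z * z' = ((z + z') / rootTwo) ^ 2 + eval ![x, y] S := by
    rw [div_pow, hr2]
    linear_combination (-1 / 2) * h4
  have r1' : ![x, y, z] = fun i => c * q.rep i := funext r1
  have r2' : ![x, y, z'] = fun i => d * q'.rep i := funext r2
  have r3' : ![x, y, (z + z') / rootTwo] = fun i => b ^ planeWt i * p.rep i := by
    funext i; rw [r3, planeWt_eq_one, pow_one]
  refine ⟨c ^ m.1 * d ^ m.2, d ^ m.1 * c ^ m.2, by positivity, by positivity, fun k =>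
    ⟨b ^ (((k + 1) • m).1 + ((k + 1) • m).2), pow_ne_zero _ hb, ?_, ?_⟩⟩
  · rw [← eval_smul_of_isWeightedHomogeneous (hH k), ← r3', ← e k x y z z' _ k1 k2, r1', r2',
      map_pow, map_pow, eval_biSmul hQ, eval_biSmul hQ]
    rfl
  · rw [← eval_smul_of_isWeightedHomogeneous (hH' k), ← r3', ← e' k x y z z' _ k1 k2, r1', r2',
      map_mul, map_mul, map_pow, map_pow, eval_biSmul hQ, eval_biSmul hQ, eval_biSmul hP,
      eval_biSmul hP]
    rfl

/-- A quotient of bihomogeneous polynomials which is symmetric on the correspondence is a quotient of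
homogeneous polynomials on the dual quartic. -/
theorem exists_descent (h : Biell S T) {P Q : MvPolynomial (Fin 3 ⊕ Fin 3) ℂ} {m : ℕ × ℕ}
    (hP : P.IsWeightedHomogeneous biWt m) (hQ : Q.IsWeightedHomogeneous biWt m)
    {q₀ q₀' : CurveC S T} {p₀ : CurveC S (S ^ 2 - T)} (h₀ : Corr q₀ q₀' p₀)
    (hQ₀ : eval (pairRep (q₀, q₀')) Q ≠ 0) :
    ∃ (n : ℕ) (H' H : MvPolynomial (Fin 3) ℂ), H'.IsWeightedHomogeneous planeWt n ∧
      H.IsWeightedHomogeneous planeWt n ∧ eval p₀.rep H ≠ 0 ∧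
      ∀ (q q' : CurveC S T) (p : CurveC S (S ^ 2 - T)), Corr q q' p → eval p.rep H ≠ 0 →
        (eval (pairRep (q, q')) Q ≠ 0 ∨ eval (pairRep (q', q)) Q ≠ 0) ∧
        ∀ γ : ℂ, (eval (pairRep (q, q')) Q ≠ 0 →
            γ = eval (pairRep (q, q')) P / eval (pairRep (q, q')) Q) →
          (eval (pairRep (q', q)) Q ≠ 0 →
            γ = eval (pairRep (q', q)) P / eval (pairRep (q', q)) Q) →
          γ = eval p.rep H' / eval p.rep H := by
  obtain ⟨n, H', H, hH, key⟩ := exists_descent_aux h hP hQ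
  -- If `a² + b²` and `a⁴ + b⁴` both vanished, then `a = 0`; so `k = 1` or `k = 3` works. Requiring
  -- `k ≥ 1` makes the term of an ordering drop out where `Q` vanishes, since nothing is known about
  -- `P` there.
  obtain ⟨k, hk, hne⟩ : ∃ k, 1 ≤ k ∧ eval p₀.rep (H k) ≠ 0 := by
    obtain ⟨u, u', hu, hu', he⟩ := key q₀ q₀' p₀ h₀
    by_contra! hzero
    obtain ⟨e1, -, h1, -⟩ := he 1
    obtain ⟨e3, -, h3, -⟩ := he 3
    rw [hzero 1 le_rfl, mul_zero] at h1
    rw [hzero 3 (by norm_num), mul_zero] at h3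
    set a := u * eval (pairRep (q₀, q₀')) Q with ha
    have ha0 : a ≠ 0 := mul_ne_zero hu hQ₀
    set b := u' * eval (pairRep (q₀', q₀)) Q
    have : a ^ 4 * 2 = 0 := by linear_combination -h3 + (b ^ 2 - a ^ 2) * h1
    simp [ha0] at this
  refine ⟨n k, H' k, H k, (hH k).1, (hH k).2, hne, fun q q' p hc hp => ?_⟩
  obtain ⟨u, u', hu, hu', he⟩ := key q q' p hc
  obtain ⟨e, he0, h1, h2⟩ := he k
  refine ⟨?_, fun γ hγ hγ' => ?_⟩
  · by_contra! hzero
    rw [hzero.1, hzero.2, mul_zero, mul_zero, zero_pow (by omega), add_zero] at h1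
    exact mul_ne_zero he0 hp h1
  · have e1 : ∀ {u Pv Qv : ℂ}, (Qv ≠ 0 → γ = Pv / Qv) → u * Pv * (u * Qv) ^ k = γ * (u * Qv) ^ (k + 1) := by
      intro u Pv Qv hg
      by_cases h0 : Qv = 0
      · rw [h0, mul_zero, zero_pow (by omega), zero_pow (by omega), mul_zero, mul_zero]
      · rw [hg h0]
        field_simp
        ring
    rw [e1 hγ, e1 hγ', ← mul_add, ← h1] at h2
    rw [eq_div_iff hp]
    apply mul_left_cancel₀ he0
    linear_combination -h2

/-- Homogeneous coordinates of the point corresponding to a pair. -/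
def dualCoord (j i : Fin 3) : MvPolynomial (Fin 3 ⊕ Fin 3) ℂ :=
  C ((![1, 1, rootTwo] : Fin 3 → ℂ) i) * (X (.inl i) * X (.inr j) + X (.inr i) * X (.inl j))

/-- The polynomial on pairs of points induced by a polynomial on the dual quartic. -/
def liftPoly (j : Fin 3) (Q : MvPolynomial (Fin 3) ℂ) : MvPolynomial (Fin 3 ⊕ Fin 3) ℂ :=
  X (.inl j) * X (.inr j) * aeval (dualCoord j) Q

theorem isWeightedHomogeneous_liftPoly (j : Fin 3) {Q : MvPolynomial (Fin 3) ℂ} {d : ℕ}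
    (hQ : Q.IsWeightedHomogeneous planeWt d) :
    (liftPoly j Q).IsWeightedHomogeneous biWt ((1, 1) + d • (1, 1)) := by
  have hl : ∀ i, (X (.inl i) : MvPolynomial (Fin 3 ⊕ Fin 3) ℂ).IsWeightedHomogeneous biWt (1, 0) := by
    intro i
    have := isWeightedHomogeneous_X ℂ biWt (.inl i)
    have e : biWt (.inl i) = (1, 0) := congrArg (fun k => (k, 0)) (planeWt_eq_one i)
    rwa [e] at this
  have hr : ∀ i, (X (.inr i) : MvPolynomial (Fin 3 ⊕ Fin 3) ℂ).IsWeightedHomogeneous biWt (0, 1) := by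
    intro i
    have := isWeightedHomogeneous_X ℂ biWt (.inr i)
    have e : biWt (.inr i) = (0, 1) := congrArg (fun k => (0, k)) (planeWt_eq_one i)
    rwa [e] at this
  have h1 : ∀ i k, (X (.inl i) * X (.inr k) : MvPolynomial (Fin 3 ⊕ Fin 3) ℂ).IsWeightedHomogeneous
      biWt (1, 1) := fun i k => (hl i).mul (hr k)
  refine (h1 j j).mul (isWeightedHomogeneous_aeval_smul (fun i => ?_) hQ)
  rw [planeWt_eq_one, one_smul]
  refine IsWeightedHomogeneous.C_mul ((h1 i j).add ?_) _
  rw [mul_comm]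
  exact h1 j i

theorem eval_liftPoly (j : Fin 3) (Q : MvPolynomial (Fin 3) ℂ) (v w : Fin 3 → ℂ) :
    eval (Sum.elim v w) (liftPoly j Q) = v j * w j *
      eval (fun i => (![1, 1, rootTwo] : Fin 3 → ℂ) i * (v i * w j + w i * v j)) Q := by
  rw [liftPoly, map_mul, map_mul, eval_X, eval_X, Sum.elim_inl, Sum.elim_inr]
  congr 1
  have : (eval (Sum.elim v w)).comp (aeval (dualCoord j) : MvPolynomial (Fin 3) ℂ →ₐ[ℂ] _).toRingHom =
      eval (fun i => (![1, 1, rootTwo] : Fin 3 → ℂ) i * (v i * w j + w i * v j)) := by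
    apply MvPolynomial.ringHom_ext
    · intro r; simp
    · intro i; simp [dualCoord]
  exact congrArg (fun f => f Q) this

theorem eval_liftPoly_swap (j : Fin 3) (Q : MvPolynomial (Fin 3) ℂ) (x : CurveC S T × CurveC S T) :
    eval (pairRep x.swap) (liftPoly j Q) = eval (pairRep x) (liftPoly j Q) := by
  rw [pairRep, pairRep, eval_liftPoly, eval_liftPoly, mul_comm (x.swap.1.rep j)]
  simp only [Prod.fst_swap, Prod.snd_swap, add_comm]

/-- The symmetric expressions `dualCoord` are homogeneous coordinates of `p` up to the factor `μ`.
The extra factor `q.rep j * q'.rep j` in `liftPoly` confines nonvanishing to pairs lying in the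
chart `j`. -/
theorem Corr.eval_liftPoly {q q' : CurveC S T} {p : CurveC S (S ^ 2 - T)} (h : Corr q q' p)
    {j : Fin 3} (hj : j ≠ 2) : ∃ μ : ℂ, (q.rep j ≠ 0 → q'.rep j ≠ 0 ∧ μ ≠ 0) ∧
      ∀ (d : ℕ) (Q : MvPolynomial (Fin 3) ℂ), Q.IsWeightedHomogeneous planeWt d →
        eval (pairRep (q, q')) (liftPoly j Q) = q.rep j * q'.rep j * (μ ^ d * eval p.rep Q) := by
  obtain ⟨x, y, z, z', ⟨c, hc, r1⟩, ⟨d, hd, r2⟩, ⟨b, hb, r3⟩, h4⟩ := h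
  have hr := rootTwo_ne_zero
  have hr2 := rootTwo_sq
  have hjj : ![x, y, z'] j = ![x, y, z] j := by
    fin_cases j
    · rfl
    · rfl
    · exact absurd rfl hj
  have hjq : c * q.rep j = d * q'.rep j := by rw [← r1, ← r2, hjj]
  refine ⟨2 * q.rep j * b / d, fun hne => ⟨fun h0 => hne ?_,
    div_ne_zero (mul_ne_zero (mul_ne_zero two_ne_zero hne) hb) hd⟩, fun n Q hQ => ?_⟩
  · rw [h0, mul_zero] at hjq
    exact (mul_eq_zero.1 hjq).resolve_left hc
  · rw [pairRep, BiellipticDual.eval_liftPoly, ← eval_smul_of_isWeightedHomogeneous hQ]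
    congr 3
    funext i
    have e1 := r1 i
    have e2 := r2 i
    have e3 := r3 i
    rw [planeWt_eq_one, pow_one]
    -- With common `x, y`, the sums of the coordinates are `2x`, `2y` and `z + z'`; the weight `√2`
    -- turns the last into `2ζ`.
    have hkey : (![1, 1, rootTwo] : Fin 3 → ℂ) i * (![x, y, z] i + ![x, y, z'] i) =
        2 * ![x, y, (z + z') / rootTwo] i := by
      fin_cases i
      · simp; ring
      · simp; ring
      · simp only [Fin.reduceFinMk, Matrix.cons_val]
        field_simp
        linear_combination (z + z') * hr2
    have e4 : q'.rep j = c * q.rep j / d := by field_simp; linear_combination -hjq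
    rw [e1, e2, e3] at hkey
    change (![1, 1, rootTwo] : Fin 3 → ℂ) i * (q.rep i * q'.rep j + q'.rep i * q.rep j) = _
    rw [e4]
    field_simp
    linear_combination q.rep j * hkey

end Bihomogeneous

/-! ### The topology of a multiprojective variety -/

section HomogeneousStructure

variable {X σ M : Type} [AddCommMonoid M] {wt : σ → M} {rep : X → σ → ℂ}

theorem isOpen_basic {d : M} {Q : MvPolynomial σ ℂ} (hQ : Q.IsWeightedHomogeneous wt d) :
    IsOpen[(homogeneousStructure wt rep).top] {x | eval (rep x) Q ≠ 0} :=
  TopologicalSpace.GenerateOpen.basic _ ⟨d, Q, hQ, rfl⟩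

/-- The generating sets are closed under finite intersections, by multiplying polynomials, and
therefore form a basis. -/
theorem exists_basic_subset {U : Set X} (hU : IsOpen[(homogeneousStructure wt rep).top] U) {x : X}
    (hx : x ∈ U) : ∃ (d : M) (Q : MvPolynomial σ ℂ), Q.IsWeightedHomogeneous wt d ∧
      eval (rep x) Q ≠ 0 ∧ ∀ y, eval (rep y) Q ≠ 0 → y ∈ U := by
  induction hU with
  | basic s hs =>
    obtain ⟨d, Q, hQ, rfl⟩ := hs
    exact ⟨d, Q, hQ, hx, fun y hy => hy⟩
  | univ => exact ⟨0, 1, isWeightedHomogeneous_one ℂ wt, by simp, fun y _ => trivial⟩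
  | inter s t _ _ hs ht =>
    obtain ⟨d, Q, hQ, h1, h2⟩ := hs hx.1
    obtain ⟨d', Q', hQ', h1', h2'⟩ := ht hx.2
    refine ⟨d + d', Q * Q', hQ.mul hQ', by rw [map_mul]; exact mul_ne_zero h1 h1', fun y hy => ?_⟩
    rw [map_mul] at hy
    exact ⟨h2 y (left_ne_zero_of_mul hy), h2' y (right_ne_zero_of_mul hy)⟩
  | sUnion s _ ih =>
    obtain ⟨t, ht, hxt⟩ := hx
    obtain ⟨d, Q, hQ, h1, h2⟩ := ih t ht hxt
    exact ⟨d, Q, hQ, h1, fun y hy => ⟨t, ht, h2 y hy⟩⟩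

theorem isOpen_of_basic_subset {U : Set X} (hU : ∀ x ∈ U, ∃ (d : M) (Q : MvPolynomial σ ℂ),
    Q.IsWeightedHomogeneous wt d ∧ eval (rep x) Q ≠ 0 ∧ ∀ y, eval (rep y) Q ≠ 0 → y ∈ U) :
    IsOpen[(homogeneousStructure wt rep).top] U := by
  let _ := (homogeneousStructure wt rep).top
  refine isOpen_iff_forall_mem_open.2 fun x hx => ?_
  obtain ⟨d, Q, hQ, h1, h2⟩ := hU x hx
  exact ⟨_, h2, isOpen_basic hQ, h1⟩

end HomogeneousStructure

/-! ### The isomorphism with the dual quartic -/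

section Isomorphism

variable {S T : MvPolynomial (Fin 2) ℂ} [Fact (Prime (quartic S T))] [Fact (Prime (ellEq S T))]
  [Fact (Prime (quartic S (S ^ 2 - T)))] [Fact (Prime (ellEq S (S ^ 2 - T)))]

/-- `Corr` is symmetric in the pair and `abel` identifies only a pair with its swap. So the point
attached to a class does not depend on the chosen representatives. -/
theorem exists_equiv (h : Biell S T) (e : CurveE S T) :
    ∃ φ : curveD S T (divClass (h.fib e)) ≃ CurveC S (S ^ 2 - T),
      ∀ q q' p, Corr q q' p ↔ ∃ L, abel S T (q, q') = L.1.1 ∧ φ L = p := by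
  have hex : ∀ L : curveD S T (divClass (h.fib e)), ∃ p, ∃ q q', abel S T (q, q') = L.1.1 ∧
      Corr q q' p := by
    rintro ⟨⟨_, ⟨q, q'⟩, rfl⟩, hL⟩
    obtain ⟨p, hp⟩ := exists_corr h ((abel_mem_normFibre_iff h e q q').1 hL)
    exact ⟨p, q, q', rfl, hp⟩
  choose f hf using hex
  have hf' : ∀ L q q', abel S T (q, q') = L.1.1 → Corr q q' (f L) := by
    intro L q q' hL
    obtain ⟨r, r', hr, hc⟩ := hf L
    rcases (abel_eq_abel_iff h _ _).1 (hL.trans hr.symm) with h0 | h0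
    · obtain ⟨rfl, rfl⟩ := Prod.ext_iff.1 h0
      exact hc
    · obtain ⟨rfl, rfl⟩ := Prod.ext_iff.1 h0
      exact hc.symm
  have hmem : ∀ q q' p, Corr q q' p → ∃ L : curveD S T (divClass (h.fib e)),
      abel S T (q, q') = L.1.1 ∧ f L = p := by
    intro q q' p hc
    have hL := (abel_mem_normFibre_iff h e q q').2 (hc.proj_eq h)
    refine ⟨⟨⟨_, ⟨(q, q'), rfl⟩⟩, hL⟩, rfl, ?_⟩
    exact (hf' ⟨⟨_, ⟨(q, q'), rfl⟩⟩, hL⟩ q q' rfl).unique h hc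
  have hbij : Function.Bijective f := by
    refine ⟨fun L L' hLL => ?_, fun p => ?_⟩
    · obtain ⟨q, q', hq, hc⟩ := hf L
      obtain ⟨r, r', hr, hc'⟩ := hf L'
      rw [← hLL] at hc'
      refine Subtype.ext (Subtype.ext ?_)
      rw [← hq, ← hr]
      refine (abel_eq_abel_iff h _ _).2 ?_
      rcases Corr.inj h hc hc' with ⟨rfl, rfl⟩ | ⟨rfl, rfl⟩
      · exact Or.inl rfl
      · exact Or.inr rfl
    · obtain ⟨q, q', hc⟩ := Corr.surj h p
      obtain ⟨L, -, hL⟩ := hmem q q' p hc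
      exact ⟨L, hL⟩
  refine ⟨Equiv.ofBijective f hbij, fun q q' p => ⟨hmem q q' p, ?_⟩⟩
  rintro ⟨L, hL, rfl⟩
  exact hf' L q q' hL

variable {ξ : Pic ellWt (ellEq S T)} {φ : curveD S T ξ ≃ CurveC S (S ^ 2 - T)}

/-- The lifted polynomials are symmetric, so their values and quotients are well defined on `W`,
whichever representatives are chosen. -/
theorem eval_liftPoly_eq_of_abel_eq (h : Biell S T) (j : Fin 3) (Q : MvPolynomial (Fin 3) ℂ)
    {x y : CurveC S T × CurveC S T} (hxy : abel S T x = abel S T y) :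
    eval (pairRep x) (liftPoly j Q) = eval (pairRep y) (liftPoly j Q) := by
  rcases (abel_eq_abel_iff h _ _).1 hxy with rfl | rfl
  · rfl
  · exact eval_liftPoly_swap j Q y

theorem isOpen_liftPoly (h : Biell S T) (j : Fin 3) {Q : MvPolynomial (Fin 3) ℂ} {d : ℕ}
    (hQ : Q.IsWeightedHomogeneous planeWt d) : IsOpen[(W.structure S T).top]
      {L : W S T | eval (pairRep L.2.choose) (liftPoly j Q) ≠ 0} := by
  refine isOpen_coinduced.2 ?_
  have : Set.rangeFactorization (abel S T) ⁻¹'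
      {L : W S T | eval (pairRep L.2.choose) (liftPoly j Q) ≠ 0} =
      {x | eval (pairRep x) (liftPoly j Q) ≠ 0} := by
    ext x
    change eval (pairRep (Set.rangeFactorization (abel S T) x).2.choose) _ ≠ 0 ↔ _
    rw [eval_liftPoly_eq_of_abel_eq h j Q (Set.rangeFactorization (abel S T) x).2.choose_spec]
    rfl
  rw [this]
  exact isOpen_basic (isWeightedHomogeneous_liftPoly j hQ)

theorem exists_rep_ne_zero (h : Biell S T) (q : CurveC S T) : ∃ j : Fin 3, j ≠ 2 ∧ q.rep j ≠ 0 := by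
  have h0 := Represents.xy_ne_zero h (q := q) (v := q.rep)
    ⟨1, one_ne_zero, fun i => (one_mul _).symm⟩
  by_cases h1 : q.rep 0 = 0
  · exact ⟨1, by decide, fun h2 => h0 ⟨h1, h2⟩⟩
  · exact ⟨0, by decide, h1⟩

theorem corr_choose (hφ : ∀ q q' p, Corr q q' p ↔ ∃ L, abel S T (q, q') = L.1.1 ∧ φ L = p)
    (L : curveD S T ξ) : Corr L.1.2.choose.1 L.1.2.choose.2 (φ L) :=
  (hφ _ _ _).2 ⟨L, L.1.2.choose_spec, rfl⟩

theorem eval_ne_zero_of_liftPoly_ne_zero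
    (hφ : ∀ q q' p, Corr q q' p ↔ ∃ L, abel S T (q, q') = L.1.1 ∧ φ L = p)
    {L : curveD S T ξ} {j : Fin 3} (hj : j ≠ 2) {Q : MvPolynomial (Fin 3) ℂ} {d : ℕ}
    (hQ : Q.IsWeightedHomogeneous planeWt d)
    (hne : eval (pairRep L.1.2.choose) (liftPoly j Q) ≠ 0) :
    eval (φ L).rep Q ≠ 0 ∧ ∀ P : MvPolynomial (Fin 3) ℂ, P.IsWeightedHomogeneous planeWt d →
      eval (φ L).rep P / eval (φ L).rep Q = eval (pairRep L.1.2.choose) (liftPoly j P) /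
        eval (pairRep L.1.2.choose) (liftPoly j Q) := by
  obtain ⟨μ, -, hμ⟩ := (corr_choose hφ L).eval_liftPoly hj
  have hd := hμ d Q hQ
  rw [Prod.mk.eta] at hd
  rw [hd] at hne
  refine ⟨right_ne_zero_of_mul (right_ne_zero_of_mul hne), fun P hP => ?_⟩
  have hd' := hμ d P hP
  rw [Prod.mk.eta] at hd'
  rw [hd, hd', mul_div_mul_left _ _ (left_ne_zero_of_mul hne),
    mul_div_mul_left _ _ (left_ne_zero_of_mul (right_ne_zero_of_mul hne))]

theorem exists_liftPoly_ne_zero (h : Biell S T)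
    (hφ : ∀ q q' p, Corr q q' p ↔ ∃ L, abel S T (q, q') = L.1.1 ∧ φ L = p)
    {L : curveD S T ξ} {Q : MvPolynomial (Fin 3) ℂ} {d : ℕ}
    (hQ : Q.IsWeightedHomogeneous planeWt d) (hne : eval (φ L).rep Q ≠ 0) :
    ∃ j : Fin 3, j ≠ 2 ∧ eval (pairRep L.1.2.choose) (liftPoly j Q) ≠ 0 := by
  obtain ⟨j, hj, hq⟩ := exists_rep_ne_zero h L.1.2.choose.1
  obtain ⟨μ, hμ0, hμ⟩ := (corr_choose hφ L).eval_liftPoly hj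
  have hd := hμ d Q hQ
  rw [Prod.mk.eta] at hd
  refine ⟨j, hj, ?_⟩
  rw [hd]
  exact mul_ne_zero (mul_ne_zero hq (hμ0 hq).1) (mul_ne_zero (pow_ne_zero _ (hμ0 hq).2) hne)

/-- A fraction `P / Q` on the dual quartic pulls back to `liftPoly j P / liftPoly j Q`. This is
defined by bihomogeneous polynomials on all of `C × C`, so it extends to an open subset of `W`, as
the induced structure requires. -/
theorem isMorphism_toDual (h : Biell S T)
    (hφ : ∀ q q' p, Corr q q' p ↔ ∃ L, abel S T (q, q') = L.1.1 ∧ φ L = p) :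
    IsMorphism (curveD.structure S T ξ) (Curve.structure planeWt (quartic S (S ^ 2 - T))) φ := by
  refine ⟨?_, ?_⟩
  · let _ := (curveD.structure S T ξ).top
    let _ := (W.structure S T).top
    refine continuous_generateFrom_iff.2 ?_
    rintro _ ⟨d, Q, hQ, rfl⟩
    refine isOpen_iff_forall_mem_open.2 fun L hL => ?_
    obtain ⟨j, hj, hne⟩ := exists_liftPoly_ne_zero h hφ hQ hL
    exact ⟨{L | eval (pairRep L.1.2.choose) (liftPoly j Q) ≠ 0},
      fun L' hL' => (eval_ne_zero_of_liftPoly_ne_zero hφ hj hQ hL').1,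
      isOpen_induced_iff.2 ⟨_, isOpen_liftPoly h j hQ, rfl⟩, hne⟩
  · rintro L g ⟨d, P, Q, hP, hQ, hne, hg⟩
    obtain ⟨j, hj, hne⟩ := exists_liftPoly_ne_zero h hφ hQ hne
    refine ⟨fun M => eval (pairRep M.2.choose) (liftPoly j P) /
      eval (pairRep M.2.choose) (liftPoly j Q), _, isOpen_liftPoly h j hQ, hne,
      ⟨_, isOpen_liftPoly h j hQ, hne, fun x hx => ?_⟩, fun M hM => ?_⟩
    · have hs : ∀ (x : CurveC S T × CurveC S T) (A : MvPolynomial (Fin 3) ℂ),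
          eval (pairRep (Set.rangeFactorization (abel S T) x).2.choose) (liftPoly j A) =
            eval (pairRep x) (liftPoly j A) := fun x A =>
        eval_liftPoly_eq_of_abel_eq h j A (Set.rangeFactorization (abel S T) x).2.choose_spec
      refine ⟨_, liftPoly j P, liftPoly j Q, isWeightedHomogeneous_liftPoly j hP,
        isWeightedHomogeneous_liftPoly j hQ, ?_, fun y _ => ?_⟩
      · exact (hs x Q).symm.trans_ne hx
      · exact congrArg₂ (· / ·) (hs y P) (hs y Q)
    · obtain ⟨h1, h2⟩ := eval_ne_zero_of_liftPoly_ne_zero hφ hj hQ hM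
      exact (hg _ h1).trans (h2 P hP)

/-- Open sets and regular functions on `W` are described upstairs by bihomogeneous polynomials that
need not be symmetric. `exists_descent` replaces them by polynomials on the dual quartic. -/
theorem isMorphism_ofDual (h : Biell S T)
    (hφ : ∀ q q' p, Corr q q' p ↔ ∃ L, abel S T (q, q') = L.1.1 ∧ φ L = p) :
    IsMorphism (Curve.structure planeWt (quartic S (S ^ 2 - T))) (curveD.structure S T ξ) φ.symm := by
  have hpair : ∀ p, ∃ q q', Corr q q' p ∧ abel S T (q, q') = (φ.symm p).1.1 := fun p => by
    obtain ⟨q, q', hc⟩ := Corr.surj h p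
    obtain ⟨L, hL, rfl⟩ := (hφ _ _ _).1 hc
    exact ⟨q, q', hc, by rwa [Equiv.symm_apply_apply]⟩
  have habel : ∀ {q q'} {L : W S T}, abel S T (q, q') = L.1 →
      Set.rangeFactorization (abel S T) (q, q') = L ∧
      Set.rangeFactorization (abel S T) (q', q) = L := fun {q q' L} hL =>
    ⟨Subtype.ext hL, Subtype.ext (((abel_eq_abel_iff h (q', q) (q, q')).2 (Or.inr rfl)).trans hL)⟩
  have hcont : ∀ U : Set (W S T), IsOpen[(W.structure S T).top] U →
      IsOpen[(Curve.structure planeWt (quartic S (S ^ 2 - T))).top] {p | (φ.symm p).1 ∈ U} := by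
    intro U hU
    refine isOpen_of_basic_subset fun p hp => ?_
    obtain ⟨q, q', hc, hab⟩ := hpair p
    have hpre := isOpen_coinduced.1 hU
    obtain ⟨m, Q, hQ, hne, hsub⟩ := exists_basic_subset hpre (x := (q, q'))
      (show Set.rangeFactorization (abel S T) (q, q') ∈ U by rwa [(habel hab).1])
    -- Only the denominator matters for openness, so the numerator is taken equal to `Q`. Where `H`
    -- is nonzero, at least one ordering of the pair lies in the basic open set.
    obtain ⟨n, _, H, _, hH, hne', hall⟩ := exists_descent h hQ hQ hc hne
    refine ⟨n, H, hH, hne', fun p₁ hp₁ => ?_⟩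
    obtain ⟨r, r', hc₁, hab₁⟩ := hpair p₁
    rcases (hall r r' p₁ hc₁ hp₁).1 with h0 | h0
    · have := hsub (r, r') h0
      rwa [Set.mem_preimage, (habel hab₁).1] at this
    · have := hsub (r', r) h0
      rwa [Set.mem_preimage, (habel hab₁).2] at this
  refine ⟨?_, ?_⟩
  · let _ := (Curve.structure planeWt (quartic S (S ^ 2 - T))).top
    let _ := (curveD.structure S T ξ).top
    let _ := (W.structure S T).top
    refine continuous_def.2 fun V hV => ?_
    obtain ⟨U, hU, rfl⟩ := isOpen_induced_iff.1 hV
    exact hcont U hU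
  · rintro p g ⟨G, U, hU, hpU, ⟨U', -, hpU', hreg⟩, hgG⟩
    obtain ⟨q, q', hc, hab⟩ := hpair p
    obtain ⟨m, P, Q, hP, hQ, hne, hG⟩ := hreg (q, q') (by rwa [(habel hab).1])
    obtain ⟨n, H', H, hH', hH, hne', hall⟩ := exists_descent h hP hQ hc hne
    -- The factor `A` restricts to the neighbourhood where `g` agrees with the function `G` on `W`.
    obtain ⟨d, A, hA, hneA, hsub⟩ := exists_basic_subset (hcont U hU) hpU
    refine ⟨n + d, H' * A, H * A, hH'.mul hA, hH.mul hA, by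
      rw [map_mul]; exact mul_ne_zero hne' hneA, fun p₁ hp₁ => ?_⟩
    rw [map_mul] at hp₁
    have hA₁ := right_ne_zero_of_mul hp₁
    obtain ⟨r, r', hc₁, hab₁⟩ := hpair p₁
    rw [map_mul, map_mul, mul_div_mul_right _ _ hA₁, Function.comp_apply, hgG _ (hsub p₁ hA₁)]
    refine (hall r r' p₁ hc₁ (left_ne_zero_of_mul hp₁)).2 _ (fun h0 => ?_) (fun h0 => ?_)
    · rw [← (habel hab₁).1]
      exact hG _ h0
    · rw [← (habel hab₁).2]
      exact hG _ h0

theorem exists_isInvolImage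
    (hφ : ∀ q q' p, Corr q q' p ↔ ∃ L, abel S T (q, q') = L.1.1 ∧ φ L = p) (L : curveD S T ξ) :
    ∃ L' : curveD S T ξ, IsInvolImage S T L.1.1 L'.1.1 ∧ φ L' = invol S (S ^ 2 - T) (φ L) := by
  obtain ⟨L', hL', e⟩ := (hφ _ _ _).1 (corr_choose hφ L).invol
  refine ⟨L', ⟨_, L.1.2.choose_spec, ?_⟩, e⟩
  rw [Finsupp.mapDomain_add, Finsupp.mapDomain_single, Finsupp.mapDomain_single]
  exact hL'

end Isomorphism

end BiellipticDual

end

/-! ### The theorem. -/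

open BiellipticDual in
theorem mainTheorem10 (S T : MvPolynomial (Fin 2) ℂ) (hS : S.IsHomogeneous 2)
    (hT : T.IsHomogeneous 4) (hC : IsNonsingular (quartic S T)) :
    (∃! η : Pic ellWt (ellEq S T), IsCanonicalPoint S T η) ∧
    IsNonsingular (quartic S (S ^ 2 - T)) ∧
    ¬ IsHyperelliptic planeWt (quartic S (S ^ 2 - T)) ∧
    ∀ η : Pic ellWt (ellEq S T), IsCanonicalPoint S T η →
      ∃ φ : curveD S T η ≃ CurveC S (S ^ 2 - T),
        IsMorphism (curveD.structure S T η)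
          (Curve.structure planeWt (quartic S (S ^ 2 - T))) φ ∧
        IsMorphism (Curve.structure planeWt (quartic S (S ^ 2 - T)))
          (curveD.structure S T η) φ.symm ∧
        ∀ L : curveD S T η, ∃ L' : curveD S T η, IsInvolImage S T L.1.1 L'.1.1 ∧
          φ L' = invol S (S ^ 2 - T) (φ L) := by
  obtain h := Biell.of_isNonsingular hS hT hC
  have : Fact (Prime (quartic S T)) := ⟨h.prime_quartic⟩
  have : Fact (Prime (ellEq S T)) := ⟨h.prime_ellEq⟩
  have : Fact (Prime (quartic S (S ^ 2 - T))) := ⟨h.swap.prime_quartic⟩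
  have : Fact (Prime (ellEq S (S ^ 2 - T))) := ⟨h.swap.prime_ellEq⟩
  refine ⟨existsUnique_isCanonicalPoint h, h.swap.isNonsingular_quartic,
    not_isHyperelliptic h.swap.niceC h.swap.isHomogeneous_quartic, fun η hη => ?_⟩
  obtain ⟨e⟩ := h.niceE.nonempty
  obtain rfl := eq_of_isCanonicalPoint h e hη
  obtain ⟨φ, hφ⟩ := exists_equiv h e
  exact ⟨φ, isMorphism_toDual h hφ, isMorphism_ofDual h hφ, exists_isInvolImage hφ⟩
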